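/- Let $0<q<1$, $N\ge 0$ an integer, $[k]=\{1,\dots,k\}$, and let $$\hat R=\sum_{i,j}q^{-\delta_{ij}}e_{ji}\otimes e_{ij}+(q^{-1}-q)\sum_{i<j}e_{jj}\otimes e_{ii}\in M_N(\mathbb C)\otimes M_N(\mathbb C).$$ Let $\mathcal O_q(H(N))$ be the universal unital complex algebra generated by the entries of $Z=(Z_{ij})_{1\le i,j\le N}$ with relations $\hat R_{12}Z_{23}\hat R_{12}Z_{23}=Z_{23}\hat R_{12}Z_{23}\hat R_{12}$, with the $*$-structure $Z_{ij}^*=Z_{ji}$. A $*$-character is a unital $*$-homomorphism $\chi:\mathcal O_q(H(N))\to\mathbb C$; it is regarded as a representation on $\mathbb C$. A representation on a Hilbert space $V$ is a unital $*$-homomorphism $\pi:\mathcal O_q(H(N))\to B(V)$; it is irreducible if $V\ne0$ and the only closed invariant subspaces are $0$ and $V$. *Quantum minors.* Let $\mathbf r$ be the coquasitriangular structure of $\mathcal O_q(U(N))$, whose values on generators are $\mathbf r(X_{aa},X_{cc})=q^{-\delta_{ac}}$, $\mathbf r(X_{ab},X_{ba})=q^{-1}-q$ for $a<b$, and $0$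 otherwise, extended by $\mathbf r(f,gh)=\mathbf r(f_{(1)},h)\mathbf r(f_{(2)},g)$; let $\mathbf r^{-1}$ be its convolution inverse. For $I=\{i_1<\dots<i_k\}$ and $J$ of size $k$ let $X_{IJ}=\sum_{\sigma:I\to J\text{ bijective}}(-q)^{l(\sigma)}X_{i_1\sigma(i_1)}\cdots X_{i_k\sigma(i_k)}$, with $l(\sigma)$ the number of inversions, and put $\hat R^{ab}_{IJ}=\mathbf r(X_{ba},X_{IJ})$, $(\hat R^{-1})^{ab}_{IJ}=\mathbf r^{-1}(X_{ba},X_{IJ})$. The quantum minors $Z_{I,J}\in\mathcal O_q(H(N))$, for $I,J\subseteq[N]$ with $|I|=|J|=k$, are given by $Z_{\emptyset,\emptyset}=1$ and the Laplace expansion $$Z_{I,J}=\sum_{p\in J}\ \sum_{s,t\in[N]}\ \sum_{|S'|=|T'|=k-1}(-q)^{|\{j\in J\,:\,j<p\}|}\,(\hat R^{-1})^{s,i_1}_{I\setminus\{i_1\},T'}\,\hat R^{p,t}_{T',S'}\,Z_{st}\,Z_{S',J\setminus\{p\}}.$$ In particular $Z_{\{i\},\{j\}}=Z_{ij}$. Write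 $Z_{[k]}=Z_{[k],[k]}$. Let $I_M$ be the two-sided $*$-ideal generated by all quantum minors of size $M$; $\pi$ has rank $M$ if $I_{M+1}\subseteq\ker\pi$ and $I_M\not\subseteq\ker\pi$. *Shapes.* A shape $S=(\tau,u)$ is a permutation $\tau$ of $[N]$ with a map $u:[N]\to\{0\}\cup\mathbb T$ such that $u_i\ne0$ whenever $\tau(i)\neq i$. Let $P=\{p: u_p\ne0\}=\{p_1<\dots<p_M\}$, $P_{[k]}=\{p_1,\dots,p_k\}$, $u_{P_{[k]}}=\prod_{p\in P_{[k]}}u_p$ and $Z_{S,k}=Z_{\tau(P_{[k]}),P_{[k]}}$. Let $I_S^{\le}$ be the two-sided $*$-ideal generated by $I_{M+1}$ and, for all $k\le M$, by the $Z_{I,J}$ with $|I|=|J|=k$ and $(J,I)<(P_{[k]},\tau(P_{[k]}))$ lexicographically. A representation $\pi$ has shape $S$ if $I_S^{\le}\subseteq\ker\pi$ and, for all $1\le k\le M$, $\operatorname{Ker}\pi(Z_{S,k})=0$ and $(-1)^{l(\tau|_{P_{[k]}})}\,\overline{u_{P_{[k]}}}\,\pi(Z_{S,k})$ is a positive operator.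 *Big cell representations.* For $\epsilon\in\{1,-1,0\}^N$ in standard form of rank $M$ (its first $M$ entries are nonzero, the others zero) put $\epsilon_{(0,i]}=\epsilon_1\cdots\epsilon_i$. A big cell representation of shape $\epsilon$ is an irreducible representation of rank $M$ whose shape is $\tau=\mathrm{id}$, $u_i=\epsilon_{(0,i]}$. It has signature $+$ (respectively $-$) if $\epsilon_{(0,i]}=1$ (respectively $-1$) for all $i\in[N]$. **Theorem.** Let $\pi$ be an irreducible representation of $\mathcal O_q(H(N))$ on a finite-dimensional Hilbert space. Then $\pi$ has exactly one shape $S$, and there is a $*$-character of $\mathcal O_q(H(N))$ which has the same shape $S$. Moreover, if $N\ge1$ and $\pi(Z_{11})$ has trivial kernel, then $\pi(Z_{[k]})$ has trivial kernel for all $1\le k\le N$, and $\pi$ is a big cell representation of signature $+$ or $-$. -/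

import Mathlib

open scoped Kronecker ComplexConjugate

noncomputable section

namespace REA

/-! ### The reflection equation algebra -/

/-- The free unital complex algebra on symbols `Z i j`; it will carry the `*`-structure with
`(Z i j)* = Z j i`, which is why it is kept apart from `FreeAlgebra`. -/
def FreeZ (N : ℕ) : Type := FreeAlgebra ℂ (Fin N × Fin N)

instance (N : ℕ) : Ring (FreeZ N) := inferInstanceAs (Ring (FreeAlgebra ℂ (Fin N × Fin N)))

instance (N : ℕ) : Algebra ℂ (FreeZ N) :=
  inferInstanceAs (Algebra ℂ (FreeAlgebra ℂ (Fin N × Fin N)))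

/-- The generator `Z i j` of the free algebra. -/
def freeGen {N : ℕ} (i j : Fin N) : FreeZ N := FreeAlgebra.ι ℂ (i, j)

/-- The same ring with complex scalars acting through complex conjugation; auxiliary. -/
def FreeConj (N : ℕ) : Type := FreeAlgebra ℂ (Fin N × Fin N)

instance (N : ℕ) : Ring (FreeConj N) := inferInstanceAs (Ring (FreeAlgebra ℂ (Fin N × Fin N)))

instance (N : ℕ) : Algebra ℂ (FreeConj N) :=
  ((algebraMap ℂ (FreeAlgebra ℂ (Fin N × Fin N))).comp (starRingEnd ℂ)).toAlgebra'
    (fun c x => Algebra.commutes (A := FreeAlgebra ℂ (Fin N × Fin N)) (conj c) x)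

/-- Auxiliary form of `conjSwap`, with values in the conjugate algebra. -/
def conjSwapHom (N : ℕ) : FreeAlgebra ℂ (Fin N × Fin N) →ₐ[ℂ] FreeConj N :=
  FreeAlgebra.lift ℂ (fun p => (FreeAlgebra.ι ℂ p.swap : FreeAlgebra ℂ (Fin N × Fin N)))

/-- The conjugate-linear ring endomorphism of the free algebra that sends `Z i j` to `Z j i`. -/
def conjSwap (N : ℕ) :
    FreeAlgebra ℂ (Fin N × Fin N) →+* FreeAlgebra ℂ (Fin N × Fin N) :=
  (conjSwapHom N).toRingHom

theorem conjSwap_ι {N : ℕ} (p : Fin N × Fin N) :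
    conjSwap N (FreeAlgebra.ι ℂ p) = FreeAlgebra.ι ℂ p.swap :=
  FreeAlgebra.lift_ι_apply (R := ℂ) (A := FreeConj N)
    (fun p : Fin N × Fin N => (FreeAlgebra.ι ℂ p.swap : FreeAlgebra ℂ (Fin N × Fin N))) p

theorem conjSwap_algebraMap {N : ℕ} (c : ℂ) :
    conjSwap N (algebraMap ℂ _ c) = algebraMap ℂ _ (conj c) :=
  (conjSwapHom N).commutes c

theorem conjSwap_conjSwap {N : ℕ} (a : FreeAlgebra ℂ (Fin N × Fin N)) :
    conjSwap N (conjSwap N a) = a := by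
  induction a with
  | grade0 c => rw [conjSwap_algebraMap, conjSwap_algebraMap, Complex.conj_conj]
  | grade1 p => rw [conjSwap_ι, conjSwap_ι, Prod.swap_swap]
  | mul a b ha hb => rw [map_mul, map_mul, ha, hb]
  | add a b ha hb => rw [map_add, map_add, ha, hb]

theorem conjSwap_star {N : ℕ} (a : FreeAlgebra ℂ (Fin N × Fin N)) :
    conjSwap N (star a) = star (conjSwap N a) := by
  induction a with
  | grade0 c => rw [FreeAlgebra.star_algebraMap, conjSwap_algebraMap, FreeAlgebra.star_algebraMap]
  | grade1 p => rw [FreeAlgebra.star_ι, conjSwap_ι, FreeAlgebra.star_ι]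
  | mul a b ha hb => rw [star_mul, map_mul, map_mul, star_mul, ha, hb]
  | add a b ha hb => rw [star_add, map_add, map_add, star_add, ha, hb]

/-- The conjugate-linear involution of the free algebra with `(Z i j)* = Z j i`; Mathlib's `star`
on `FreeAlgebra` is the linear map that reverses words. -/
instance (N : ℕ) : StarRing (FreeZ N) where
  star a := (star (conjSwap N a : FreeAlgebra ℂ (Fin N × Fin N)) : FreeAlgebra ℂ (Fin N × Fin N))
  star_involutive a := by
    change star (conjSwap N (star (conjSwap N a))) = a
    exact ((congrArg star (conjSwap_star _)).trans (star_star _)).trans (conjSwap_conjSwap a)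
  star_mul a b := by
    change star (conjSwap N (a * b)) = star (conjSwap N b) * star (conjSwap N a)
    exact (congrArg star (map_mul (conjSwap N) a b)).trans (star_mul _ _)
  star_add a b := by
    change star (conjSwap N (a + b)) = star (conjSwap N a) + star (conjSwap N b)
    exact (congrArg star (map_add (conjSwap N) a b)).trans (star_add _ _)

theorem star_freeGen {N : ℕ} (i j : Fin N) : star (freeGen i j) = freeGen j i := by
  change star (conjSwap N (FreeAlgebra.ι ℂ (i, j))) = FreeAlgebra.ι ℂ (j, i)
  rw [conjSwap_ι, FreeAlgebra.star_ι, Prod.swap_prod_mk]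

theorem star_algebraMap_freeZ {N : ℕ} (c : ℂ) :
    star (algebraMap ℂ (FreeZ N) c) = algebraMap ℂ (FreeZ N) (conj c) := by
  change star (conjSwap N (algebraMap ℂ (FreeAlgebra ℂ (Fin N × Fin N)) c)) =
    algebraMap ℂ (FreeAlgebra ℂ (Fin N × Fin N)) (conj c)
  rw [conjSwap_algebraMap, FreeAlgebra.star_algebraMap]

instance (N : ℕ) : StarModule ℂ (FreeZ N) where
  star_smul c a := by
    rw [Algebra.smul_def, Algebra.smul_def, star_mul, star_algebraMap_freeZ]
    exact (Algebra.commutes _ _).symm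

/-- The braid operator
`∑ i j, q ^ (-δ i j) e j i ⊗ e i j + (q⁻¹ - q) ∑ i < j, e j j ⊗ e i i`. -/
def braid (q : ℝ) (N : ℕ) : Matrix (Fin N × Fin N) (Fin N × Fin N) ℂ :=
  (∑ i : Fin N, ∑ j : Fin N,
    (if i = j then (q : ℂ)⁻¹ else 1) • (Matrix.single j i (1 : ℂ) ⊗ₖ Matrix.single i j (1 : ℂ))) +
  ((q : ℂ)⁻¹ - q) • ∑ i : Fin N, ∑ j : Fin N,
    if i < j then Matrix.single j j (1 : ℂ) ⊗ₖ Matrix.single i i (1 : ℂ) else 0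

theorem braid_conjTranspose (q : ℝ) (N : ℕ) : (braid q N).conjTranspose = braid q N := by
  have h (i j k l : Fin N) : (Matrix.single i j (1 : ℂ) ⊗ₖ Matrix.single k l (1 : ℂ)).conjTranspose
      = Matrix.single j i (1 : ℂ) ⊗ₖ Matrix.single l k (1 : ℂ) := by
    rw [Matrix.conjTranspose_kronecker, Matrix.conjTranspose_single, Matrix.conjTranspose_single,
      star_one]
  have hq : star ((q : ℂ)⁻¹ - q) = (q : ℂ)⁻¹ - q := by simp
  unfold braid
  rw [Matrix.conjTranspose_add, Matrix.conjTranspose_smul, hq]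
  congr 2
  · simp only [Matrix.conjTranspose_sum, Matrix.conjTranspose_smul, h]
    rw [Finset.sum_comm]
    refine Finset.sum_congr rfl fun i _ => Finset.sum_congr rfl fun j _ => ?_
    congr 1
    by_cases hij : i = j
    · simp [hij]
    · simp [hij, Ne.symm hij]
  · simp only [Matrix.conjTranspose_sum]
    refine Finset.sum_congr rfl fun i _ => Finset.sum_congr rfl fun j _ => ?_
    split_ifs
    · exact h _ _ _ _
    · exact Matrix.conjTranspose_zero

/-- The braid operator with entries in the free algebra. -/
def braidZ (q : ℝ) (N : ℕ) : Matrix (Fin N × Fin N) (Fin N × Fin N) (FreeZ N) :=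
  (braid q N).map (algebraMap ℂ (FreeZ N))

/-- The matrix `Z₂₃ = 1 ⊗ Z` over the free algebra. -/
def matZ (N : ℕ) : Matrix (Fin N × Fin N) (Fin N × Fin N) (FreeZ N) :=
  (1 : Matrix (Fin N) (Fin N) (FreeZ N)) ⊗ₖ Matrix.of (fun i j => freeGen i j)

/-- The entries of the reflection equation `R Z R Z = Z R Z R`, read in both directions. -/
inductive ReflRel (q : ℝ) (N : ℕ) : FreeZ N → FreeZ N → Prop
  | fwd (x y : Fin N × Fin N) :
      ReflRel q N ((braidZ q N * matZ N * braidZ q N * matZ N) x y)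
        ((matZ N * braidZ q N * matZ N * braidZ q N) x y)
  | bwd (x y : Fin N × Fin N) :
      ReflRel q N ((matZ N * braidZ q N * matZ N * braidZ q N) x y)
        ((braidZ q N * matZ N * braidZ q N * matZ N) x y)

theorem braidZ_conjTranspose (q : ℝ) (N : ℕ) : (braidZ q N).conjTranspose = braidZ q N := by
  ext x y
  have h := congrFun (congrFun (braid_conjTranspose q N) x) y
  rw [Matrix.conjTranspose_apply] at h ⊢
  rw [braidZ, Matrix.map_apply, Matrix.map_apply, star_algebraMap_freeZ]
  exact congrArg _ h

theorem matZ_conjTranspose (N : ℕ) : (matZ N).conjTranspose = matZ N := by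
  ext x y
  rw [Matrix.conjTranspose_apply, matZ, Matrix.kronecker_apply, Matrix.kronecker_apply,
    Matrix.one_apply, Matrix.one_apply, Matrix.of_apply, Matrix.of_apply, star_mul, star_freeGen]
  by_cases h : x.1 = y.1
  · simp [h]
  · simp [h, Ne.symm h]

theorem star_leftSide (q : ℝ) (N : ℕ) (x y : Fin N × Fin N) :
    star ((braidZ q N * matZ N * braidZ q N * matZ N) x y) =
      (matZ N * braidZ q N * matZ N * braidZ q N) y x := by
  rw [← Matrix.conjTranspose_apply]
  simp only [Matrix.conjTranspose_mul, braidZ_conjTranspose, matZ_conjTranspose, Matrix.mul_assoc]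

theorem ReflRel.star_closed (q : ℝ) (N : ℕ) (a b : FreeZ N) (h : ReflRel q N a b) :
    ReflRel q N (star a) (star b) := by
  cases h with
  | fwd x y =>
    rw [star_leftSide, ← star_leftSide q N y x, star_star]
    exact ReflRel.bwd y x
  | bwd x y =>
    rw [star_leftSide, ← star_leftSide q N y x, star_star]
    exact ReflRel.fwd y x

/-- The `*`-algebra `𝒪_q(H(N))`: the universal unital complex algebra generated by the entries of
`Z`, subject to the reflection equation, with the `*`-structure `Z* = Z`. -/
def OqH (q : ℝ) (N : ℕ) : Type := RingQuot (ReflRel q N)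

variable {q : ℝ} {N : ℕ}

instance : Ring (OqH q N) := inferInstanceAs (Ring (RingQuot (ReflRel q N)))

instance : Algebra ℂ (OqH q N) := inferInstanceAs (Algebra ℂ (RingQuot (ReflRel q N)))

/-- The quotient map from the free algebra. -/
def toOqH (q : ℝ) (N : ℕ) : FreeZ N →ₐ[ℂ] OqH q N := RingQuot.mkAlgHom ℂ (ReflRel q N)

/-- The generator `Z i j` of `𝒪_q(H(N))`. -/
def Z (q : ℝ) {N : ℕ} (i j : Fin N) : OqH q N := toOqH q N (freeGen i j)

theorem toOqH_surjective : Function.Surjective (toOqH q N) :=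
  RingQuot.mkAlgHom_surjective ℂ (ReflRel q N)

theorem toOqH_rel {a b : FreeZ N} (h : ReflRel q N a b) : toOqH q N a = toOqH q N b :=
  RingQuot.mkAlgHom_rel ℂ h

/-- The map `a ↦ a*` from the free algebra to the opposite of `𝒪_q(H(N))`. -/
def starToOp (q : ℝ) (N : ℕ) : FreeZ N →+* (OqH q N)ᵐᵒᵖ :=
  (toOqH q N).toRingHom.op.comp (starRingEquiv (R := FreeZ N)).toRingHom

/-- The map induced by `starToOp` on the quotient. -/
def starOp (q : ℝ) (N : ℕ) : OqH q N →+* (OqH q N)ᵐᵒᵖ :=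
  RingQuot.lift (r := ReflRel q N) ⟨starToOp q N, fun a b h =>
    congrArg MulOpposite.op (toOqH_rel (ReflRel.star_closed q N a b h))⟩

theorem starOp_toOqH (a : FreeZ N) :
    starOp q N (toOqH q N a) = MulOpposite.op (toOqH q N (star a)) := by
  have h : toOqH q N a = RingQuot.mkRingHom (ReflRel q N) a :=
    congrArg (fun f : FreeZ N →+* RingQuot (ReflRel q N) => f a)
      (RingQuot.mkAlgHom_coe ℂ (ReflRel q N))
  rw [h]
  exact RingQuot.lift_mkRingHom_apply _ _ _

instance : StarRing (OqH q N) where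
  star x := (starOp q N x).unop
  star_involutive x := by
    obtain ⟨a, rfl⟩ := toOqH_surjective x
    beta_reduce
    rw [starOp_toOqH, MulOpposite.unop_op, starOp_toOqH, MulOpposite.unop_op, star_star]
  star_mul x y := by rw [map_mul, MulOpposite.unop_mul]
  star_add x y := by rw [map_add, MulOpposite.unop_add]

theorem star_toOqH (a : FreeZ N) : star (toOqH q N a) = toOqH q N (star a) :=
  congrArg MulOpposite.unop (starOp_toOqH a)

theorem star_Z (i j : Fin N) : star (Z q i j) = Z q j i := by
  rw [Z, star_toOqH, star_freeGen, Z]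

instance : StarModule ℂ (OqH q N) where
  star_smul c x := by
    obtain ⟨a, rfl⟩ := toOqH_surjective x
    rw [← map_smul, star_toOqH, star_toOqH, star_smul, map_smul]

/-! ### Quantum minors -/

/-- The number `l(σ)` of inversions of a map between totally ordered sets. -/
def inversions {α β : Type*} [Fintype α] [LinearOrder α] [LinearOrder β] (σ : α → β) : ℕ :=
  (Finset.univ.filter fun p : α × α => p.1 < p.2 ∧ σ p.2 < σ p.1).card

/-- The coquasitriangular structure `r(X a b, X c d)` of `𝒪_q(U(N))` on generators: the nonzero
values are `r(X a a, X c c) = q ^ (-δ a c)` and `r(X a b, X b a) = q⁻¹ - q` for `a < b`. -/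
def rGen (q : ℝ) (a b c d : Fin N) : ℂ :=
  if a = b ∧ c = d then (if a = c then (q : ℂ)⁻¹ else 1)
  else if a < b ∧ c = b ∧ d = a then (q : ℂ)⁻¹ - q else 0

/-- The convolution inverse `r⁻¹(X a b, X c d)` on generators; it arises from `r` on exchanging
`q` and `q⁻¹`. -/
def rInvGen (q : ℝ) (a b c d : Fin N) : ℂ := rGen q⁻¹ a b c d

/-- `r(X a b, w)` for a word `w` in the generators, from `r(f, g h) = r(f₁, h) r(f₂, g)`. -/
def rWord (q : ℝ) (a b : Fin N) : List (Fin N × Fin N) → ℂ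
  | [] => if a = b then 1 else 0
  | cd :: w => ∑ e : Fin N, rWord q a e w * rGen q e b cd.1 cd.2

/-- `r⁻¹(X a b, w)` for a word `w` in the generators, from
`r⁻¹(f, g h) = r⁻¹(f₁, g) r⁻¹(f₂, h)`. -/
def rInvWord (q : ℝ) (a b : Fin N) : List (Fin N × Fin N) → ℂ
  | [] => if a = b then 1 else 0
  | cd :: w => ∑ e : Fin N, rInvGen q a e cd.1 cd.2 * rInvWord q e b w

/-- The word `X i₁ σ(i₁) ⋯ X iₖ σ(iₖ)` attached to a bijection `σ` from `I = {i₁ < ⋯ < iₖ}`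
to `J`. -/
def minorWord (I J : Finset (Fin N)) (σ : {i // i ∈ I} ≃ {j // j ∈ J}) : List (Fin N × Fin N) :=
  (I.attach.sort (· ≤ ·)).map fun i => (i.1, (σ i).1)

/-- `R̂^{a b}_{I J} = r(X b a, X_{I J})`, where
`X_{I J} = ∑ σ, (-q) ^ l(σ) X i₁ σ(i₁) ⋯ X iₖ σ(iₖ)` is the quantum minor of `𝒪_q(U(N))`. -/
def rHat (q : ℝ) (a b : Fin N) (I J : Finset (Fin N)) : ℂ :=
  ∑ σ : {i // i ∈ I} ≃ {j // j ∈ J}, (-(q : ℂ)) ^ inversions σ * rWord q b a (minorWord I J σ)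

/-- `(R̂⁻¹)^{a b}_{I J} = r⁻¹(X b a, X_{I J})`. -/
def rHatInv (q : ℝ) (a b : Fin N) (I J : Finset (Fin N)) : ℂ :=
  ∑ σ : {i // i ∈ I} ≃ {j // j ∈ J}, (-(q : ℂ)) ^ inversions σ * rInvWord q b a (minorWord I J σ)

/-- Quantum minors of size `k`, by the Laplace expansion along the smallest index `i` of `I`:
`Z_{I J} = ∑ (-q) ^ (pos(p) - 1) (R̂⁻¹)^{s i}_{I∖i, T'} R̂^{p t}_{T' S'} Z_{s t} Z_{S', J∖p}`
over `p ∈ J` (with position `pos(p)` in `J`), over `s, t ∈ [N]` and over `S', T' ⊆ [N]` of size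
`k - 1`. -/
def qMinorAux (q : ℝ) : ℕ → Finset (Fin N) → Finset (Fin N) → OqH q N
  | 0, _, _ => 1
  | k + 1, I, J =>
    if h : I.Nonempty then
      ∑ p ∈ J, ∑ s : Fin N, ∑ t : Fin N,
        ∑ S' ∈ Finset.powersetCard k Finset.univ, ∑ T' ∈ Finset.powersetCard k Finset.univ,
          ((-(q : ℂ)) ^ (J.filter (· < p)).card *
            rHatInv q s (I.min' h) (I.erase (I.min' h)) T' * rHat q p t T' S') •
            (Z q s t * qMinorAux q k S' (J.erase p))
    else 0

/-- The quantum minor `Z_{I J}` of `𝒪_q(H(N))`, for `I` and `J` of the same size. -/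
def qMinor (q : ℝ) (I J : Finset (Fin N)) : OqH q N := qMinorAux q I.card I J

/-- The set `[k] = {1, …, k}` inside `[N]`. -/
def initialSet (N k : ℕ) : Finset (Fin N) := Finset.univ.filter fun i => i.val < k

/-- The leading quantum minor `Z_[k]`. -/
def leadingMinor (q : ℝ) (N k : ℕ) : OqH q N := qMinor q (initialSet N k) (initialSet N k)

/-! ### Ideals, rank and shapes -/

/-- The two-sided `*`-ideal generated by a set. -/
def starIdeal (s : Set (OqH q N)) : TwoSidedIdeal (OqH q N) := TwoSidedIdeal.span (s ∪ star '' s)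

/-- The `*`-ideal `I_M` generated by the quantum minors of size `M`. -/
def rankIdeal (q : ℝ) (N M : ℕ) : TwoSidedIdeal (OqH q N) :=
  starIdeal {z | ∃ I J : Finset (Fin N), I.card = M ∧ J.card = M ∧ z = qMinor q I J}

/-- The lexicographic order on sets of the same size, viewed as increasing lists. -/
def setLT (I J : Finset (Fin N)) : Prop := I.sort (· ≤ ·) < J.sort (· ≤ ·)

/-- The lexicographic order on pairs of sets of the same size. -/
def pairLT (I J I' J' : Finset (Fin N)) : Prop := setLT I I' ∨ (I = I' ∧ setLT J J')

/-- A shape: a permutation `τ` of `[N]` and a map `u : [N] → {0} ∪ 𝕋` with `u i ≠ 0` whenever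
`τ i ≠ i`. -/
@[ext]
structure Shape (N : ℕ) where
  τ : Equiv.Perm (Fin N)
  u : Fin N → ℂ
  u_mem : ∀ i, u i = 0 ∨ ‖u i‖ = 1
  u_ne_zero : ∀ i, τ i ≠ i → u i ≠ 0

namespace Shape

/-- The associated set `P` of a shape. -/
def P (S : Shape N) : Finset (Fin N) := Finset.univ.filter fun p => S.u p ≠ 0

/-- The rank of a shape. -/
def rank (S : Shape N) : ℕ := S.P.card

/-- The set `P_[k]` of the `k` smallest elements of `P`. -/
def initial (S : Shape N) (k : ℕ) : Finset (Fin N) :=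
  S.P.filter fun p => (S.P.filter (· ≤ p)).card ≤ k

/-- The set `τ(P_[k])`. -/
def image (S : Shape N) (k : ℕ) : Finset (Fin N) := (S.initial k).image S.τ

/-- The minor `Z_{S,k} = Z_{τ(P_[k]), P_[k]}`. -/
def minor (q : ℝ) (S : Shape N) (k : ℕ) : OqH q N := qMinor q (S.image k) (S.initial k)

/-- The `*`-ideal generated by `I_{M+1}`, with `M` the rank of `S`, and by the minors `Z_{I J}` of
size `k ≤ M` with `(J, I) < (P_[k], τ(P_[k]))`. -/
def ideal (q : ℝ) (S : Shape N) : TwoSidedIdeal (OqH q N) :=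
  starIdeal ({z | z ∈ rankIdeal q N (S.rank + 1)} ∪
    {z | ∃ k ≤ S.rank, ∃ I J : Finset (Fin N), I.card = k ∧ J.card = k ∧
      pairLT J I (S.initial k) (S.image k) ∧ z = qMinor q I J})

/-- The phase `(-1) ^ l(τ|P_[k])` times the conjugate of `u_{P_[k]} = ∏ p ∈ P_[k], u p`. -/
def phase (S : Shape N) (k : ℕ) : ℂ :=
  (-1) ^ inversions (fun p : {p // p ∈ S.initial k} => S.τ p) * conj (∏ p ∈ S.initial k, S.u p)

end Shape

/-! ### Representations -/

section Rep

variable {H : Type*} [NormedAddCommGroup H] [InnerProductSpace ℂ H] [CompleteSpace H]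

/-- Irreducibility of a bounded `*`-representation on a Hilbert space: the space is nonzero and
has no closed invariant subspaces besides zero and itself. -/
def IsIrreducible (π : OqH q N →⋆ₐ[ℂ] (H →L[ℂ] H)) : Prop :=
  Nontrivial H ∧ ∀ W : Submodule ℂ H, IsClosed (W : Set H) →
    (∀ a : OqH q N, ∀ v ∈ W, π a v ∈ W) → W = ⊥ ∨ W = ⊤

/-- The operator `π z` has trivial kernel. -/
def TrivialKer (π : OqH q N →⋆ₐ[ℂ] (H →L[ℂ] H)) (z : OqH q N) : Prop :=
  LinearMap.ker (π z : H →ₗ[ℂ] H) = ⊥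

/-- `π` has rank `M`. -/
def HasRank (π : OqH q N →⋆ₐ[ℂ] (H →L[ℂ] H)) (M : ℕ) : Prop :=
  rankIdeal q N (M + 1) ≤ TwoSidedIdeal.ker π ∧ ¬ rankIdeal q N M ≤ TwoSidedIdeal.ker π

/-- `π` has shape `S`. -/
def HasShape (π : OqH q N →⋆ₐ[ℂ] (H →L[ℂ] H)) (S : Shape N) : Prop :=
  S.ideal q ≤ TwoSidedIdeal.ker π ∧
  (∀ k, 1 ≤ k → k ≤ S.rank → TrivialKer π (S.minor q k)) ∧
  (∀ k, 1 ≤ k → k ≤ S.rank → (S.phase k • π (S.minor q k)).IsPositive)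

end Rep

/-- A `*`-character, viewed as a representation on the one-dimensional Hilbert space `ℂ`. -/
def characterRep (χ : OqH q N →⋆ₐ[ℂ] ℂ) : OqH q N →⋆ₐ[ℂ] (ℂ →L[ℂ] ℂ) :=
  (StarAlgHom.ofId ℂ (ℂ →L[ℂ] ℂ)).comp χ

/-! ### Big cell representations -/

/-- The sign vector `ε` is in standard form of rank `M`: exactly its first `M` entries are
nonzero. -/
def IsStandard (ε : Fin N → SignType) (M : ℕ) : Prop :=
  M ≤ N ∧ ∀ i, ε i ≠ 0 ↔ i.val < M

/-- The partial product `ε_(0,i] = ε₁ ⋯ εᵢ`. -/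
def partialSign (ε : Fin N → SignType) (i : Fin N) : SignType := ∏ k ∈ Finset.Iic i, ε k

/-- The shape with `τ = id` and `u i = ε_(0,i]`. -/
def bigCellShape (ε : Fin N → SignType) : Shape N where
  τ := 1
  u i := ((partialSign ε i : SignType) : ℂ)
  u_mem i := by
    cases partialSign ε i <;> simp
  u_ne_zero i h := absurd rfl h

/-- `π` is a big cell representation of shape `ε`. -/
def IsBigCell {H : Type*} [NormedAddCommGroup H] [InnerProductSpace ℂ H] [CompleteSpace H]
    (π : OqH q N →⋆ₐ[ℂ] (H →L[ℂ] H)) (ε : Fin N → SignType) : Prop :=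
  IsIrreducible π ∧ ∃ M, IsStandard ε M ∧ HasRank π M ∧ HasShape π (bigCellShape ε)

end REA

end

set_option linter.unusedSimpArgs false
set_option linter.unusedSectionVars false

/-! Put z_ij = π(Z_ij). These operators satisfy the reflection equation, and z_ij* = z_ji. Finite
dimension enters mainly through the trace. For b < a one entry of the reflection equation gives
`opTrace_relation`: in Hilbert–Schmidt norms, Σ_{x<b} ‖z_ax‖² + tr(z_bb z_aa) = Σ_{x<a} ‖z_bx‖². If
the first diagonal entry of a block vanishes, this kills the first row of the block except for its
last place, which must then be nonzero. Repeating the argument (`exists_arcPattern`), z consists of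
m zero rows and columns, then l nested "arcs" on an antidiagonal with zeros before them, and in
their middle a block which is empty or has a nonzero first diagonal entry.

An entry that comes first in its row and column q-commutes with every generator (`IsRE.qcomm`). In
an irreducible representation such an entry, if nonzero, is injective, its eigenvalues lie on one
ray, and it is normal; so it is a phase times a positive operator
(`IsIrreducible.exists_phase_entry`). For the corner of the middle block, which is self-adjoint, the
phase is a sign. The Schur complement of the corner again satisfies the reflection equation
(`isRE_schur`), and its corner has the same sign (`posInj_schur`, where a determinant argument uses
0 < q < 1). By induction every leading minor of the block has the sign given by a power of one sign
(`posInj_leading`).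

To pass from entries to minors, the quantum minors are identified with the entries of fused matrices
on q-exterior powers (`qMinorAux_eq`). The q-antisymmetry of these (`anti_phi`) yields a Laplace
expansion along every row (`fminor_eq_laplace`). With the arc pattern, the minors Z_{S,k} become, up
to sign and a power of q, products of arc entries and a leading minor of the block; the factors
commute up to scalars, so their positivity multiplies (`PosInj.mul`). Lexicographically smaller
minors and those of size above the rank vanish by counting zeros. Hence π has the shape read off
from m, l, the arc phases and the sign (`ArcParams.Fits.hasShape`).

Uniqueness is formal: two shapes of one nonzero representation have the same lexicographically first
minors, and a nonzero operator has at most one phase making it positive. For existence of the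
character, the matrix with the arc phases on the arcs and the sign on the middle diagonal is a
hermitian scalar solution of the reflection equation (`ArcParams.isRE_entry`) with the same
parameters. Finally, z_11 ≠ 0 excludes zero rows and arcs, so the middle block is everything and its
one sign is the signature. -/

namespace REA

/-! ### q-antisymmetric functions on words and their normal ordering. -/

section Antisymmetric

variable {ι A : Type*} [LinearOrder ι] [Ring A] [Algebra ℂ A] {q : ℂ}

/-- `q`-antisymmetry of a function on words. Words are read from right to left, so that the
increasing words of a `q`-exterior power correspond to decreasing lists. -/
def Anti (q : ℂ) (F : List ι → A) : Prop :=
  (∀ l a u, F (l ++ a :: a :: u) = 0) ∧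
    ∀ l a b u, a < b → F (l ++ a :: b :: u) = -q • F (l ++ b :: a :: u)

theorem Anti.cons {F : List ι → A} (h : Anti q F) (c : ι) : Anti q fun v => F (c :: v) :=
  ⟨fun l a u => h.1 (c :: l) a u, fun l a b u hab => h.2 (c :: l) a b u hab⟩

theorem Anti.append {F : List ι → A} (h : Anti q F) (l' : List ι) :
    Anti q fun v => F (l' ++ v) :=
  ⟨fun l a u => by simpa using h.1 (l' ++ l) a u,
    fun l a b u hab => by simpa using h.2 (l' ++ l) a b u hab⟩

theorem Anti.smul {F : List ι → A} (hF : Anti q F) (c : ℂ) : Anti q fun v => c • F v :=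
  ⟨fun l a u => by beta_reduce; rw [hF.1, smul_zero],
    fun l a b u hab => by beta_reduce; rw [hF.2 _ _ _ _ hab, smul_comm]⟩

theorem Anti.mul_left {F : List ι → A} (hF : Anti q F) (x : A) : Anti q fun v => x * F v :=
  ⟨fun l a u => by beta_reduce; rw [hF.1, mul_zero],
    fun l a b u hab => by beta_reduce; rw [hF.2 _ _ _ _ hab, mul_smul_comm]⟩

theorem Anti.sum {κ : Type*} (s : Finset κ) {F : κ → List ι → A} (hF : ∀ k ∈ s, Anti q (F k)) :
    Anti q fun v => ∑ k ∈ s, F k v :=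
  ⟨fun l a u => Finset.sum_eq_zero fun k hk => (hF k hk).1 l a u,
    fun l a b u hab => by
      rw [Finset.smul_sum]; exact Finset.sum_congr rfl fun k hk => (hF k hk).2 l a b u hab⟩

/-- A repeated letter in front of a decreasing word kills an antisymmetric function. -/
theorem Anti.eq_zero_of_mem {F : List ι → A} (h : Anti q F) {x : ι} {u : List ι} (hx : x ∈ u)
    (hu : u.Pairwise (· > ·)) : F (x :: u) = 0 := by
  induction u generalizing F with
  | nil => simp at hx
  | cons b u ih =>
    by_cases hb : x = b
    · subst hb; exact h.1 [] x u
    · have hxu : x ∈ u := by simpa [hb] using hx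
      have hlt : x < b := (List.pairwise_cons.1 hu).1 x hxu
      have := h.2 [] x b u hlt
      simp only [List.nil_append] at this
      rw [this, ih (h.cons b) hxu (List.pairwise_cons.1 hu).2, smul_zero]

/-- Each letter larger than `x` is passed at the cost of one factor -q; since `u` is decreasing,
these letters form an initial segment. -/
theorem Anti.orderedInsert {F : List ι → A} (h : Anti q F) {x : ι} {u : List ι} (hx : x ∉ u)
    (hu : u.Pairwise (· > ·)) :
    F (x :: u) = (-q) ^ (u.filter (x < ·)).length • F (u.orderedInsert (· ≥ ·) x) := by
  induction u generalizing F with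
  | nil => simp
  | cons b u ih =>
    have hb : x ≠ b := fun hb => hx (by simp [hb])
    have hxu : x ∉ u := fun hb => hx (by simp [hb])
    rcases lt_or_gt_of_ne hb with hlt | hgt
    · have := h.2 [] x b u hlt
      simp only [List.nil_append] at this
      rw [this, ih (h.cons b) hxu (List.pairwise_cons.1 hu).2]
      have h1 : List.orderedInsert (· ≥ ·) x (b :: u) =
          b :: List.orderedInsert (· ≥ ·) x u := by
        rw [List.orderedInsert_cons, if_neg (not_le.2 hlt)]
      rw [h1, List.filter_cons_of_pos (by simpa using hlt), List.length_cons, pow_succ', mul_smul]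
    · have h1 : List.orderedInsert (· ≥ ·) x (b :: u) = x :: b :: u := by
        rw [List.orderedInsert_cons, if_pos hgt.le]
      have h2 : (b :: u).filter (x < ·) = [] := by
        rw [List.filter_eq_nil_iff]
        intro a ha
        have hab : a ≤ b := by
          rcases List.mem_cons.1 ha with rfl | ha
          · exact le_rfl
          · exact ((List.pairwise_cons.1 hu).1 a ha).le
        simpa using hab.trans hgt.le
      rw [h1, h2, List.length_nil, pow_zero, one_smul]

/-- The elements of a finite set in decreasing order. -/
def desc (T : Finset ι) : List ι := T.sort (· ≥ ·)

theorem desc_pairwise (T : Finset ι) : (desc T).Pairwise (· > ·) := by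
  have h1 := Finset.pairwise_sort T (· ≥ ·)
  have h2 : (desc T).Nodup := Finset.sort_nodup T (· ≥ ·)
  exact (h1.and h2).imp fun {a b} h => lt_of_le_of_ne h.1 (Ne.symm h.2)

@[simp] theorem mem_desc {T : Finset ι} {x : ι} : x ∈ desc T ↔ x ∈ T := Finset.mem_sort _

theorem desc_nodup (T : Finset ι) : (desc T).Nodup := Finset.sort_nodup T (· ≥ ·)

@[simp] theorem desc_empty : desc (∅ : Finset ι) = [] := Finset.sort_empty _

@[simp] theorem length_desc (T : Finset ι) : (desc T).length = T.card := Finset.length_sort _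

/-- A strictly decreasing list is determined by its members. This turns identities of sorted words
into membership checks. -/
theorem eq_desc {u : List ι} {T : Finset ι} (hu : u.Pairwise (· > ·)) (h : ∀ x, x ∈ u ↔ x ∈ T) :
    u = desc T := by
  have hn : u.Nodup := hu.imp fun {a b} h => ne_of_gt h
  have hp : u.Perm (desc T) := by
    rw [List.perm_ext_iff_of_nodup hn (desc_nodup T)]
    intro a; rw [h, mem_desc]
  exact hp.eq_of_pairwise (fun a b _ _ h1 h2 => absurd h1 (lt_asymm h2)) hu (desc_pairwise T)

theorem orderedInsert_desc {T : Finset ι} {x : ι} (hx : x ∉ T) :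
    (desc T).orderedInsert (· ≥ ·) x = desc (insert x T) := by
  have hs : ((desc T).orderedInsert (· ≥ ·) x).Pairwise (· ≥ ·) :=
    List.Pairwise.orderedInsert x _ (Finset.pairwise_sort T (· ≥ ·))
  have hn : ((desc T).orderedInsert (· ≥ ·) x).Nodup := by
    rw [(List.perm_orderedInsert (· ≥ ·) x (desc T)).nodup_iff]
    exact List.nodup_cons.2 ⟨by simpa using hx, desc_nodup T⟩
  refine eq_desc ((hs.and hn).imp fun {a b} h => lt_of_le_of_ne h.1 (Ne.symm h.2)) fun y => ?_
  rw [List.mem_orderedInsert, mem_desc, Finset.mem_insert]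

theorem length_filter_desc (T : Finset ι) (p : ι → Prop) [DecidablePred p] :
    ((desc T).filter (p ·)).length = (T.filter p).card := by
  rw [← List.toFinset_card_of_nodup ((desc_nodup T).filter _)]
  congr 1
  ext y; simp

/-- Moving a letter in front of a decreasing word to its place. -/
theorem Anti.insert_desc {F : List ι → A} (h : Anti q F) {x : ι} {T : Finset ι} (hx : x ∉ T) :
    F (x :: desc T) = (-q) ^ (T.filter (x < ·)).card • F (desc (insert x T)) := by
  rw [h.orderedInsert (by simpa using hx) (desc_pairwise T), orderedInsert_desc hx,
    length_filter_desc]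

end Antisymmetric

/-! ### Braiding a basis vector past a tensor. -/

section Move

variable {ι A : Type*} [LinearOrder ι] [Ring A] [Algebra ℂ A]

/-- The value at the word `s :: u` of the braiding of the basis vector `p` past the tensor `F`. -/
noncomputable def mv (q : ℂ) (p : ι) : List ι → (List ι → A) → ι → A
  | [], F, s => if s = p then F [] else 0
  | a :: u, F, s =>
    (if a = s then q⁻¹ else 1) • mv q p u (fun v => F (a :: v)) s +
      (if s < a then q⁻¹ - q else 0) • mv q p u (fun v => F (s :: v)) a

variable {q : ℂ}

theorem mv_zero (p : ι) (u : List ι) (s : ι) : mv q p u (fun _ => (0 : A)) s = 0 := by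
  induction u generalizing s with
  | nil => simp [mv]
  | cons a u ih => simp [mv, ih]

theorem mv_add (p : ι) (u : List ι) (F G : List ι → A) (s : ι) :
    mv q p u (fun v => F v + G v) s = mv q p u F s + mv q p u G s := by
  induction u generalizing s F G with
  | nil => simp only [mv]; split_ifs <;> simp
  | cons a u ih => simp only [mv, ih]; module

theorem mv_smul (p : ι) (u : List ι) (c : ℂ) (F : List ι → A) (s : ι) :
    mv q p u (fun v => c • F v) s = c • mv q p u F s := by
  induction u generalizing s F with
  | nil => simp only [mv]; split_ifs <;> simp
  | cons a u ih => simp only [mv, ih]; module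

theorem mv_mul_left (p : ι) (u : List ι) (x : A) (F : List ι → A) (s : ι) :
    mv q p u (fun v => x * F v) s = x * mv q p u F s := by
  induction u generalizing s F with
  | nil => simp only [mv]; split_ifs <;> simp
  | cons a u ih => simp only [mv, ih, mul_add, mul_smul_comm]

theorem mv_sum {κ : Type*} (K : Finset κ) (p : ι) (u : List ι) (F : κ → List ι → A) (s : ι) :
    mv q p u (fun v => ∑ k ∈ K, F k v) s = ∑ k ∈ K, mv q p u (F k) s := by
  classical
  induction K using Finset.induction_on with
  | empty => simp [mv_zero]
  | insert a K ha ih => simp only [Finset.sum_insert ha, mv_add, ih]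

theorem mv_map {B : Type*} [Ring B] [Algebra ℂ B] (f : A →ₐ[ℂ] B) (p : ι) (u : List ι)
    (F : List ι → A) (s : ι) : mv q p u (fun v => f (F v)) s = f (mv q p u F s) := by
  induction u generalizing s F with
  | nil => simp only [mv]; split_ifs <;> simp
  | cons a u ih =>
    simp only [mv]; rw [ih (fun v => F (a :: v)), ih (fun v => F (s :: v)), map_add, map_smul, map_smul]

theorem anti_head {F : List ι → A} (hF : Anti q F) {a b : ι} (h : a < b) :
    (fun v => F (a :: b :: v)) = fun v => -q • F (b :: a :: v) :=
  funext fun v => hF.2 [] a b v h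

theorem anti_head_self {F : List ι → A} (hF : Anti q F) (a : ι) :
    (fun v => F (a :: a :: v)) = fun _ => 0 :=
  funext fun v => hF.1 [] a v

/-- The braiding commutes with the braid operator on two adjacent letters. Concretely, the prefix is
peeled off by induction. Unfolding the recursion over the two letters `a`, `b` then leaves scalar
identities, one for each relative order of `a`, `b` and `s`, because `F` is antisymmetric in its
first two letters. -/
theorem Anti.mv (hq : q ≠ 0) {F : List ι → A} (hF : Anti q F) (p s : ι) :
    Anti q fun u => mv q p u F s := by
  have key1 : ∀ (l : List ι) (F : List ι → A), Anti q F → ∀ s a u,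
      REA.mv q p (l ++ a :: a :: u) F s = 0 := by
    intro l
    induction l with
    | nil =>
      intro F hF s a u
      simp only [List.nil_append, REA.mv]
      rw [anti_head_self hF]
      rcases lt_trichotomy a s with h | h | h
      · simp [h.ne, h.not_gt, mv_zero]
      · subst h; simp [anti_head_self hF, mv_zero]
      · rw [anti_head hF h, mv_smul]
        simp only [h.ne', if_false, h, if_true, mv_zero, lt_irrefl]
        match_scalars
        field_simp
        ring
    | cons c l ih =>
      intro F hF s a u
      simp only [List.cons_append, REA.mv]
      rw [ih _ (hF.cons c), ih _ (hF.cons s)]; simp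
  have key2 : ∀ (l : List ι) (F : List ι → A), Anti q F → ∀ s a b u, a < b →
      REA.mv q p (l ++ a :: b :: u) F s = -q • REA.mv q p (l ++ b :: a :: u) F s := by
    intro l
    induction l with
    | nil =>
      intro F hF s a b u hab
      simp only [List.nil_append, REA.mv]
      rw [anti_head hF hab]
      rcases lt_trichotomy a s with h | h | h
      · rcases lt_trichotomy b s with h' | h' | h'
        · rw [anti_head hF h, anti_head hF h']
          simp only [mv_smul, hab.ne, hab.ne', h.ne, h.ne', h'.ne, h'.ne', hab, h, h', hab.not_gt,
            h.not_gt, h'.not_gt, if_true, if_false]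
          match_scalars <;> field_simp <;> ring
        · subst h'
          rw [anti_head hF h, anti_head_self hF]
          simp only [mv_smul, mv_zero, hab.ne, hab.ne', hab, hab.not_gt, lt_irrefl,
            if_true, if_false]
          match_scalars <;> field_simp <;> ring
        · rw [anti_head hF h, anti_head hF h']
          simp only [mv_smul, hab.ne, hab.ne', h.ne, h.ne', h'.ne, h'.ne', hab, h, h', hab.not_gt,
            h.not_gt, h'.not_gt, if_true, if_false]
          match_scalars <;> field_simp <;> ring
      · subst h
        rw [anti_head hF hab, anti_head_self hF]
        simp only [mv_smul, mv_zero, hab.ne, hab.ne', hab, hab.not_gt, lt_irrefl,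
          if_true, if_false]
        match_scalars <;> field_simp <;> ring
      · have h' : s < b := h.trans hab
        rw [anti_head hF h, anti_head hF h']
        simp only [mv_smul, hab.ne, hab.ne', h.ne, h.ne', h'.ne, h'.ne', hab, h, h', hab.not_gt,
          h.not_gt, h'.not_gt, if_true, if_false]
        match_scalars <;> field_simp <;> ring
    | cons c l ih =>
      intro F hF s a b u hab
      simp only [List.cons_append, REA.mv]
      rw [ih _ (hF.cons c) _ _ _ _ hab, ih _ (hF.cons s) _ _ _ _ hab]; module
  exact ⟨fun l a u => key1 l F hF s a u, fun l a b u hab => key2 l F hF s a b u hab⟩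

/-- Braiding two basis vectors `p`, `p'` past a tensor, at the word `b :: a :: u`. -/
noncomputable def mv₂ (q : ℂ) (p p' : ι) (F : List ι → A) (b a : ι) (u : List ι) : A :=
  mv q p u (fun v => mv q p' v F b) a

theorem mv₂_cons (p p' : ι) (F : List ι → A) (b a c : ι) (u : List ι) :
    mv₂ q p p' F b a (c :: u) =
      (if c = a then q⁻¹ else 1) • ((if c = b then q⁻¹ else 1) •
        mv₂ q p p' (fun v => F (c :: v)) b a u +
          (if b < c then q⁻¹ - q else 0) • mv₂ q p p' (fun v => F (b :: v)) c a u) +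
      (if a < c then q⁻¹ - q else 0) • ((if a = b then q⁻¹ else 1) •
        mv₂ q p p' (fun v => F (a :: v)) b c u +
          (if b < a then q⁻¹ - q else 0) • mv₂ q p p' (fun v => F (b :: v)) a c u) := by
  simp only [mv₂, mv, mv_add, mv_smul]

/-- Naturality of the braiding of two basis vectors past a tensor. -/
theorem braid_mv₂ (hq : q ≠ 0) (p p' : ι) (F : List ι → A) (b a : ι) (u : List ι) :
    (if a = b then q⁻¹ else 1) • mv₂ q p p' F a b u +
        (if b < a then q⁻¹ - q else 0) • mv₂ q p p' F b a u =
      (if p = p' then q⁻¹ else 1) • mv₂ q p' p F b a u +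
        (if p' < p then q⁻¹ - q else 0) • mv₂ q p p' F b a u := by
  induction u generalizing F a b with
  | nil =>
    simp only [mv₂, mv]
    by_cases h1 : a = p' <;> by_cases h2 : b = p <;> by_cases h3 : b = p' <;>
      by_cases h4 : a = p <;> simp_all
  | cons c u ih =>
    -- The induction hypothesis, solved for the exchanged pair: everything is expressed through `mv₂
    -- q p p'`, with coefficients that depend on the letters and on one constant.
    have e1 : ∀ (x y z : ι), (if p = p' then q⁻¹ else 1) • mv₂ q p' p (fun v => F (x :: v)) y z u =
      (if z = y then q⁻¹ else 1) • mv₂ q p p' (fun v => F (x :: v)) z y u +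
        (if y < z then q⁻¹ - q else 0) • mv₂ q p p' (fun v => F (x :: v)) y z u -
        (if p' < p then q⁻¹ - q else 0) • mv₂ q p p' (fun v => F (x :: v)) y z u := by
      intro x y z
      rw [ih, add_sub_cancel_right]
    have e2 : (if p = p' then q⁻¹ else 1) • mv₂ q p' p F b a (c :: u) =
      (if c = a then q⁻¹ else 1) • ((if c = b then q⁻¹ else 1) •
        ((if p = p' then q⁻¹ else 1) • mv₂ q p' p (fun v => F (c :: v)) b a u) +
          (if b < c then q⁻¹ - q else 0) •
            ((if p = p' then q⁻¹ else 1) • mv₂ q p' p (fun v => F (b :: v)) c a u)) +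
      (if a < c then q⁻¹ - q else 0) • ((if a = b then q⁻¹ else 1) •
        ((if p = p' then q⁻¹ else 1) • mv₂ q p' p (fun v => F (a :: v)) b c u) +
          (if b < a then q⁻¹ - q else 0) •
            ((if p = p' then q⁻¹ else 1) • mv₂ q p' p (fun v => F (b :: v)) a c u)) := by
      rw [mv₂_cons]; module
    rw [e2, e1, e1, e1, e1, mv₂_cons, mv₂_cons]
    -- The terms with κ cancel. What remains is a Yang–Baxter identity in the letters `a`, `b`, `c`,
    -- checked in each consistent order.
    generalize (if p' < p then q⁻¹ - q else 0) = κ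
    rcases lt_trichotomy a b with h | h | h <;> rcases lt_trichotomy b c with h' | h' | h' <;>
      rcases lt_trichotomy a c with h'' | h'' | h'' <;>
      first
      | (exfalso; order)
      | (try subst h
         try subst h'
         try subst h''
         simp only [lt_irrefl, if_true, if_false, *, ne_of_lt, ne_of_gt, not_lt_of_gt]
         match_scalars <;> field_simp <;> ring)

end Move

end REA

namespace REA

/-! ### The eigenvalue -q of the braid operator on two letters. -/

section TwoLetters

variable {ι A : Type*} [LinearOrder ι] [Ring A] [Algebra ℂ A] {q : ℂ}

/-- The action of `R` on two adjacent letters. -/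
noncomputable def act₂ (q : ℂ) (X : ι → ι → A) (b a : ι) : A :=
  (if a = b then q⁻¹ else 1) • X a b + (if b < a then q⁻¹ - q else 0) • X b a

/-- On equal letters R acts by q⁻¹, which differs from -q exactly because q² + 1 ≠ 0. For `a < b`
the eigenvalue equation at the position `(b, a)` has no (q⁻¹ - q)-term and is already the exchange
rule. -/
theorem anti_two (hq : q ≠ 0) (hq2 : q ^ 2 + 1 ≠ 0) {X : ι → ι → A}
    (h : ∀ b a, act₂ q X b a = -q • X b a) :
    (∀ a, X a a = 0) ∧ ∀ a b, a < b → X a b = -q • X b a := by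
  constructor
  · intro a
    have h1 := h a a
    simp only [act₂, if_true, lt_irrefl, if_false, zero_smul, add_zero] at h1
    have h2 : (q⁻¹ + q) • X a a = 0 := by rw [add_smul, h1, neg_smul, neg_add_cancel]
    have h3 : q⁻¹ + q ≠ 0 := by
      intro h0; apply hq2; field_simp at h0; linear_combination h0
    exact (smul_eq_zero_iff_right h3).1 h2
  · intro a b hab
    have h1 := h b a
    simpa only [act₂, if_neg hab.ne, if_neg hab.not_gt, one_smul, zero_smul, add_zero] using h1

end TwoLetters

/-- Compares the sign exponents when two columns are removed in either order. -/
theorem card_filter_erase_lt {ι : Type*} [LinearOrder ι] (J : Finset ι) {x y : ι} (hx : x ∈ J) :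
    ((J.erase x).filter (· < y)).card + (if x < y then 1 else 0) = (J.filter (· < y)).card := by
  rw [Finset.filter_erase]
  split_ifs with h
  · rw [Finset.card_erase_add_one (by simp [hx, h])]
  · rw [Finset.erase_eq_of_notMem (by simp [h]), add_zero]

/-! ### The entrywise reflection equation and fusion on q-exterior powers. -/

section Fusion

variable {ι A : Type*} [LinearOrder ι] [Fintype ι] [Ring A] [Algebra ℂ A] {q : ℂ}

/-- The entries of `Z₂₃ R Z₂₃`. -/
noncomputable def reY (q : ℂ) (Z : ι → ι → A) (a b c d : ι) : A :=
  (if a = c then q⁻¹ else 1) • (Z b c * Z a d) +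
    (if a = c then q⁻¹ - q else 0) • ∑ x with x < a, Z b x * Z x d

/-- The reflection equation for a matrix with entries in an algebra, entry by entry. -/
def IsRE (q : ℂ) (Z : ι → ι → A) : Prop :=
  ∀ a b c d, (if a = b then q⁻¹ else 1) • reY q Z b a c d +
      (if b < a then q⁻¹ - q else 0) • reY q Z a b c d =
    (if c = d then q⁻¹ else 1) • reY q Z a b d c + (if d < c then q⁻¹ - q else 0) • reY q Z a b c d

theorem IsRE.map {B : Type*} [Ring B] [Algebra ℂ B] {Z : ι → ι → A} (h : IsRE q Z)
    (f : A →ₐ[ℂ] B) : IsRE q fun i j => f (Z i j) := by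
  have hY (a b c d : ι) : reY q (fun i j => f (Z i j)) a b c d = f (reY q Z a b c d) := by
    simp only [reY, map_add, map_smul, map_sum, map_mul]
  intro a b c d
  rw [hY, hY, hY, ← map_smul, ← map_smul, ← map_smul, ← map_smul, ← map_add, ← map_add, h]

/-- The action of `Z₂₃ R Z₂₃` on two adjacent letters. -/
noncomputable def zrz (q : ℂ) (Z : ι → ι → A) (X : ι → ι → A) (b a : ι) : A :=
  ∑ x, Z b x * act₂ q (fun y z => ∑ d, Z y d * X d z) x a

/-- Identifies the matrix coefficients of Z₂₃ R Z₂₃, so that the entrywise equation `IsRE` can be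
applied under the sum. -/
theorem zrz_eq (Z X : ι → ι → A) (b a : ι) :
    zrz q Z X b a = ∑ c, ∑ d, reY q Z a b c d * X d c := by
  simp only [zrz, act₂, mul_add, Finset.sum_add_distrib, mul_smul_comm, reY, add_mul,
    smul_mul_assoc]
  congr 1
  · refine Finset.sum_congr rfl fun c _ => ?_
    rw [← Finset.smul_sum, Finset.mul_sum]
    simp only [mul_assoc]
  · have h1 : ∀ x, (if x < a then q⁻¹ - q else 0) • (Z b x * ∑ d, Z x d * X d a) =
        if x < a then (q⁻¹ - q) • ∑ d, Z b x * Z x d * X d a else 0 := by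
      intro x
      split_ifs
      · rw [Finset.mul_sum]; simp only [mul_assoc]
      · rw [zero_smul]
    have h2 : ∀ c, ∑ d, (if a = c then q⁻¹ - q else 0) • ((∑ x with x < a, Z b x * Z x d) * X d c) =
        if a = c then (q⁻¹ - q) • ∑ d, (∑ x with x < a, Z b x * Z x d) * X d c else 0 := by
      intro c
      split_ifs
      · rw [Finset.smul_sum]
      · simp
    rw [Finset.sum_congr rfl fun x _ => h1 x, Finset.sum_congr rfl fun c _ => h2 c,
      ← Finset.sum_filter, Finset.sum_ite_eq, if_pos (Finset.mem_univ _), ← Finset.smul_sum,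
      Finset.sum_comm]
    simp only [Finset.sum_mul]

/-- The reflection equation in operator form. -/
theorem IsRE.act₂_zrz {Z : ι → ι → A} (h : IsRE q Z) (X : ι → ι → A) (b a : ι) :
    act₂ q (zrz q Z X) b a = zrz q Z (act₂ q X) b a := by
  have h1 : act₂ q (zrz q Z X) b a = ∑ c, ∑ d, ((if a = b then q⁻¹ else 1) • reY q Z b a c d +
      (if b < a then q⁻¹ - q else 0) • reY q Z a b c d) * X d c := by
    simp only [act₂, zrz_eq, add_mul, Finset.sum_add_distrib, smul_mul_assoc, Finset.smul_sum]
  rw [h1, zrz_eq]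
  simp only [h a b, act₂, mul_add, add_mul, Finset.sum_add_distrib, smul_mul_assoc, mul_smul_comm]
  congr 1
  rw [Finset.sum_comm]
  refine Finset.sum_congr rfl fun c _ => Finset.sum_congr rfl fun d _ => ?_
  simp only [eq_comm]

/-- The columns of the fused matrix on the `q`-exterior powers, as functions on words. -/
noncomputable def phi (q : ℂ) (Z : ι → ι → A) : ℕ → Finset ι → List ι → A
  | 0, _, u => if u = [] then 1 else 0
  | _ + 1, _, [] => 0
  | k + 1, J, s :: u =>
    ((-q) ^ k)⁻¹ • ∑ p ∈ J, (-q) ^ (J.filter (· < p)).card •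
      ∑ t, Z s t * mv q p u (phi q Z k (J.erase p)) t

theorem phi_cons (Z : ι → ι → A) (k : ℕ) (J : Finset ι) (s : ι) (u : List ι) :
    phi q Z (k + 1) J (s :: u) = ((-q) ^ k)⁻¹ • ∑ p ∈ J, (-q) ^ (J.filter (· < p)).card •
      ∑ t, Z s t * mv q p u (phi q Z k (J.erase p)) t := by rw [phi]

theorem sum_mul_mv_phi (Z : ι → ι → A) (k : ℕ) (J : Finset ι) (p s : ι) (u : List ι) (x : ι) :
    mv q p u (fun v => phi q Z (k + 1) J (x :: v)) s =
      ((-q) ^ k)⁻¹ • ∑ p' ∈ J, (-q) ^ (J.filter (· < p')).card •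
        ∑ t, Z x t * mv₂ q p p' (phi q Z k (J.erase p')) t s u := by
  simp only [phi_cons, mv_smul, mv_sum, mv_mul_left, mv₂]

/-- The `q`-antisymmetry of a double Laplace expansion. -/
theorem act₂_double (hq : q ≠ 0) (J : Finset ι) (F : Finset ι → List ι → A) (b a : ι)
    (u : List ι) :
    act₂ q (fun y z => ∑ p ∈ J, (-q) ^ (J.filter (· < p)).card • ∑ p' ∈ J.erase p,
      (-q) ^ ((J.erase p).filter (· < p')).card • mv₂ q p p' (F ((J.erase p).erase p')) y z u) b a =
    -q • ∑ p ∈ J, (-q) ^ (J.filter (· < p)).card • ∑ p' ∈ J.erase p,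
      (-q) ^ ((J.erase p).filter (· < p')).card • mv₂ q p p' (F ((J.erase p).erase p')) b a u := by
  -- The signs are extended by zero to all pairs, so that the double sum may be reindexed by
  -- exchanging `p` and `p'`.
  set c : ι → ι → ℂ := fun p p' => if p ∈ J ∧ p' ∈ J ∧ p' ≠ p then
    (-q) ^ (J.filter (· < p)).card * (-q) ^ ((J.erase p).filter (· < p')).card else 0 with hc
  have hS : ∀ y z, (∑ p ∈ J, (-q) ^ (J.filter (· < p)).card • ∑ p' ∈ J.erase p,
      (-q) ^ ((J.erase p).filter (· < p')).card • mv₂ q p p' (F ((J.erase p).erase p')) y z u) =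
      ∑ p, ∑ p', c p p' • mv₂ q p p' (F ((J.erase p).erase p')) y z u := by
    intro y z
    rw [← Finset.sum_subset (Finset.subset_univ J)]
    · refine Finset.sum_congr rfl fun p hp => ?_
      rw [← Finset.sum_subset (Finset.subset_univ (J.erase p)), Finset.smul_sum]
      · refine Finset.sum_congr rfl fun p' hp' => ?_
        rw [Finset.mem_erase] at hp'
        rw [hc]; simp only [hp, hp', true_and, ne_eq, not_false_eq_true, if_true, mul_smul, and_self]
      · intro p' _ hp'
        rw [Finset.mem_erase] at hp'
        rw [hc]; beta_reduce; rw [if_neg (by tauto), zero_smul]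
    · intro p _ hp
      refine Finset.sum_eq_zero fun p' _ => ?_
      rw [hc]; beta_reduce; rw [if_neg (by tauto), zero_smul]
  simp only [hS, act₂]
  -- Naturality of the braiding moves R from the letters `b`, `a` to the removed columns `p`, `p'`.
  have h1 : (if a = b then q⁻¹ else 1) •
      ∑ p, ∑ p', c p p' • mv₂ q p p' (F ((J.erase p).erase p')) a b u +
      (if b < a then q⁻¹ - q else 0) •
        ∑ p, ∑ p', c p p' • mv₂ q p p' (F ((J.erase p).erase p')) b a u =
      ∑ p, ∑ p', c p p' • (if p = p' then q⁻¹ else 1) •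
          mv₂ q p' p (F ((J.erase p).erase p')) b a u +
      ∑ p, ∑ p', c p p' • (if p' < p then q⁻¹ - q else 0) •
          mv₂ q p p' (F ((J.erase p).erase p')) b a u := by
    rw [Finset.smul_sum, Finset.smul_sum, ← Finset.sum_add_distrib, ← Finset.sum_add_distrib]
    refine Finset.sum_congr rfl fun p _ => ?_
    rw [Finset.smul_sum, Finset.smul_sum, ← Finset.sum_add_distrib, ← Finset.sum_add_distrib]
    refine Finset.sum_congr rfl fun p' _ => ?_
    rw [smul_comm, smul_comm _ (c p p'), ← smul_add, ← smul_add, braid_mv₂ hq]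
  rw [h1, Finset.sum_comm (f := fun p p' => c p p' • (if p = p' then q⁻¹ else 1) •
          mv₂ q p' p (F ((J.erase p).erase p')) b a u), ← Finset.sum_add_distrib, Finset.smul_sum]
  refine Finset.sum_congr rfl fun p _ => ?_
  rw [← Finset.sum_add_distrib, Finset.smul_sum]
  refine Finset.sum_congr rfl fun p' _ => ?_
  rw [Finset.erase_right_comm (a := p')]
  simp only [← smul_assoc, ← add_smul, smul_eq_mul]
  congr 1
  rw [hc]
  beta_reduce
  by_cases hJ : p ∈ J ∧ p' ∈ J ∧ p' ≠ p
  · obtain ⟨hp, hp', hne⟩ := hJ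
    have c1 : p' ∈ J ∧ p ∈ J ∧ p ≠ p' := ⟨hp', hp, hne.symm⟩
    have c2 : p ∈ J ∧ p' ∈ J ∧ p' ≠ p := ⟨hp, hp', hne⟩
    rw [if_pos c1, if_pos c2, if_neg hne]
    have e1 := card_filter_erase_lt J (y := p') hp
    have e2 := card_filter_erase_lt J (y := p) hp'
    -- For `p < p'` the two orders of removal differ by -q. For `p' < p` they differ by -q⁻¹, and
    -- the term q⁻¹ - q corrects this to -q.
    rcases lt_or_gt_of_ne hne with h | h
    · rw [if_neg h.not_gt] at e1
      rw [if_pos h] at e2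
      rw [if_pos h, ← e1, ← e2, pow_succ]
      field_simp
      ring
    · rw [if_pos h] at e1
      rw [if_neg h.not_gt] at e2
      rw [if_neg h.not_gt, ← e1, ← e2, pow_succ]
      ring
  · rw [if_neg (by tauto), if_neg hJ]; simp

/-- Fusion: the columns of the fused matrix are `q`-antisymmetric. -/
theorem anti_phi (hq : q ≠ 0) (hq2 : q ^ 2 + 1 ≠ 0) {Z : ι → ι → A} (hZ : IsRE q Z) (k : ℕ)
    (J : Finset ι) : Anti q (phi q Z k J) := by
  induction k generalizing J with
  | zero =>
    refine ⟨fun l a u => ?_, fun l a b u _ => ?_⟩ <;> simp [phi]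
  | succ k ih =>
    -- Away from the first letter antisymmetry is inherited through the braiding; only the first two
    -- letters need the reflection equation.
    have htail : ∀ s, Anti q fun u => phi q Z (k + 1) J (s :: u) := by
      intro s
      simp only [phi_cons]
      exact (Anti.sum _ fun p _ => (Anti.sum _ fun t _ =>
        ((ih (J.erase p)).mv hq p t).mul_left _).smul _).smul _
    have hhead : ∀ u, (∀ a, phi q Z (k + 1) J (a :: a :: u) = 0) ∧
        ∀ a b, a < b → phi q Z (k + 1) J (a :: b :: u) = -q • phi q Z (k + 1) J (b :: a :: u) := by
      intro u
      cases k with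
      | zero =>
        -- Columns of size 1 vanish on words of length at least 2, so there is nothing to exchange.
        have h0 : ∀ a b, phi q Z 1 J (a :: b :: u) = 0 := by
          intro a b
          simp [phi, mv, mv_zero]
        exact ⟨fun a => h0 a a, fun a b _ => by rw [zero_add, h0, h0, smul_zero]⟩
      | succ k =>
        refine anti_two hq hq2 (X := fun b a => phi q Z (k + 2) J (b :: a :: u)) ?_
        -- `W` collects the two columns removed by expanding twice; on the first two letters the
        -- fused matrix is then Z₂₃ R Z₂₃ applied to `W`, up to a scalar.
        set W : ι → ι → A := fun y z => ∑ p ∈ J, (-q) ^ (J.filter (· < p)).card • ∑ p' ∈ J.erase p,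
          (-q) ^ ((J.erase p).filter (· < p')).card •
            mv₂ q p p' (phi q Z k ((J.erase p).erase p')) y z u with hW
        have hX : ∀ b a, phi q Z (k + 2) J (b :: a :: u) =
            (((-q) ^ (k + 1))⁻¹ * ((-q) ^ k)⁻¹) • zrz q Z W b a := by
          intro b a
          rw [phi_cons, mul_smul]
          congr 1
          have h1 : ∀ p x, mv q p (a :: u) (phi q Z (k + 1) (J.erase p)) x =
              act₂ q (fun y z => mv q p u (fun v => phi q Z (k + 1) (J.erase p) (y :: v)) z) x a :=
            fun p x => by rw [mv, act₂]
          have h2 : ((-q) ^ k)⁻¹ • zrz q Z W b a = ∑ x, Z b x * act₂ q (fun y z => ∑ p ∈ J,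
              (-q) ^ (J.filter (· < p)).card •
                mv q p u (fun v => phi q Z (k + 1) (J.erase p) (y :: v)) z) x a := by
            rw [zrz, Finset.smul_sum]
            refine Finset.sum_congr rfl fun x _ => ?_
            rw [← mul_smul_comm]
            congr 1
            have h3 : ∀ y z, ((-q) ^ k)⁻¹ • ∑ d, Z y d * W d z = ∑ p ∈ J,
              (-q) ^ (J.filter (· < p)).card •
                mv q p u (fun v => phi q Z (k + 1) (J.erase p) (y :: v)) z := by
              intro y z
              simp only [sum_mul_mv_phi, hW, Finset.mul_sum, mul_smul_comm, Finset.smul_sum]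
              rw [Finset.sum_comm]
              refine Finset.sum_congr rfl fun p _ => ?_
              rw [Finset.sum_comm]
              refine Finset.sum_congr rfl fun p' _ => Finset.sum_congr rfl fun d _ => ?_
              simp only [smul_smul]
              congr 1
              ring
            simp only [act₂, ← h3]
            module
          rw [h2]
          simp only [h1, act₂, mul_add, Finset.mul_sum, Finset.sum_add_distrib, mul_smul_comm,
            Finset.smul_sum, smul_add]
          congr 1
          · rw [Finset.sum_comm]
            refine Finset.sum_congr rfl fun x _ => Finset.sum_congr rfl fun p _ => ?_
            rw [smul_comm]
          · rw [Finset.sum_comm]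
            refine Finset.sum_congr rfl fun x _ => Finset.sum_congr rfl fun p _ => ?_
            rw [smul_comm]
        intro b a
        have hlin : act₂ q (fun b a => phi q Z (k + 2) J (b :: a :: u)) b a =
            (((-q) ^ (k + 1))⁻¹ * ((-q) ^ k)⁻¹) • act₂ q (zrz q Z W) b a := by
          simp only [act₂, hX]; module
        -- The reflection equation lets R pass through Z₂₃ R Z₂₃ and act on `W`, where it is -q by
        -- `act₂_double`.
        rw [hlin, hZ.act₂_zrz, hX]
        have hanti : act₂ q W = fun y z => -q • W y z := by
          funext y z
          exact act₂_double hq J (fun K => phi q Z k K) y z u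
        rw [hanti]
        have hsm : zrz q Z (fun y z => -q • W y z) b a = -q • zrz q Z W b a := by
          simp only [zrz_eq, mul_smul_comm, Finset.smul_sum]
        rw [hsm, smul_comm]
    refine ⟨fun l a u => ?_, fun l a b u hab => ?_⟩
    · cases l with
      | nil => exact (hhead u).1 a
      | cons s l => exact (htail s).1 l a u
    · cases l with
      | nil => exact (hhead u).2 a b hab
      | cons s l => exact (htail s).2 l a b u hab

end Fusion

end REA

namespace REA

/-! ### Minors indexed by sets, and their Laplace expansion along any row. -/

section SetForm

variable {ι A : Type*} [LinearOrder ι] [Ring A] [Algebra ℂ A] {q : ℂ}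

/-- Reading a decreasing word, the (q⁻¹ - q)-term can be taken at most once: after it the carried
letter exceeds all later letters. The carried letter must end as `p`, so either it was `p`
throughout or it was exchanged at the letter `p`. -/
theorem mv_of_pairwise (p : ι) (u : List ι) (hu : u.Pairwise (· > ·)) (F : List ι → A) (s : ι) :
    mv q p u F s = if s = p then (if p ∈ u then q⁻¹ else 1) • F u
      else if s < p ∧ p ∈ u then (q⁻¹ - q) • F (u.map fun x => if x = p then s else x) else 0 := by
  induction u generalizing F s with
  | nil => by_cases h : s = p <;> simp [mv, h]
  | cons a u ih =>
    obtain ⟨ha, hu⟩ := List.pairwise_cons.1 hu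
    have hmap : p ∉ u → (u.map fun x => if x = p then s else x) = u := by
      intro hp
      conv_rhs => rw [← List.map_id u]
      refine List.map_congr_left fun x hx => ?_
      rw [if_neg (fun h : x = p => hp (h ▸ hx)), id]
    rw [mv, ih hu, ih hu]
    by_cases hs : s = p
    · subst hs
      by_cases has : a = s
      · subst has
        have : a ∉ u := fun h => lt_irrefl _ (ha a h)
        simp [this]
      · have : ¬ (s < a ∧ a < s) := fun h => lt_asymm h.1 h.2
        have hsa : s ≠ a := fun h => has h.symm
        by_cases h1 : s < a
        · simp [has, hsa, h1, h1.not_gt]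
        · simp [has, hsa, h1]
    · by_cases hap : a = p
      · subst hap
        have hau : a ∉ u := fun h => lt_irrefl _ (ha a h)
        by_cases h1 : s < a
        · simp [hs, hau, h1, hmap hau]
        · simp [hs, hau, h1]
      · have hpa : p ≠ a := fun h => hap h.symm
        have h2 : ¬ (a < p ∧ p ∈ u) := fun h => lt_asymm h.1 (ha p h.2)
        by_cases h1 : s < p ∧ p ∈ u
        · have has : a ≠ s := fun h => h2 ⟨h ▸ h1.1, h1.2⟩
          have h4 : ¬ a < p := fun h => h2 ⟨h, h1.2⟩
          simp only [hs, hap, hpa, h1, h4, has, false_and, List.mem_cons, if_false, if_true, and_self, or_true,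
            smul_zero, add_zero, zero_add, one_smul, List.map_cons]
        · have h3 : ¬ (s < p ∧ p ∈ a :: u) := by simpa [hpa] using h1
          simp [hs, hap, hpa, h1, h2, h3]

theorem desc_eq_append_cons {T : Finset ι} {p : ι} (hp : p ∈ T) :
    desc T = desc (T.filter (p < ·)) ++ p :: desc (T.filter (· < p)) := by
  symm
  refine eq_desc (List.pairwise_append.2 ⟨desc_pairwise _, List.pairwise_cons.2
    ⟨?_, desc_pairwise _⟩, ?_⟩) ?_
  · intro a ha
    simp only [mem_desc, Finset.mem_filter] at ha
    exact ha.2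
  · intro a ha b hb
    simp only [mem_desc, Finset.mem_filter, List.mem_cons] at ha hb
    rcases hb with rfl | hb
    · exact ha.2
    · exact hb.2.trans ha.2
  · intro x
    simp only [List.mem_append, mem_desc, Finset.mem_filter, List.mem_cons]
    rcases lt_trichotomy x p with h | h | h
    · simp [h, h.ne, h.not_gt]
    · simp [h, hp]
    · simp [h, h.ne', h.not_gt]

/-- Replacing a letter in a decreasing word. -/
theorem Anti.map_desc {F : List ι → A} (hF : Anti q F) {T : Finset ι} {p s : ι} (hp : p ∈ T)
    (hs : s < p) : F ((desc T).map fun x => if x = p then s else x) =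
      if s ∈ T then 0 else (-q) ^ (T.filter fun x => s < x ∧ x < p).card •
        F (desc (insert s (T.erase p))) := by
  have h1 : ((desc T).map fun x => if x = p then s else x) =
      desc (T.filter (p < ·)) ++ s :: desc (T.filter (· < p)) := by
    rw [desc_eq_append_cons hp, List.map_append, List.map_cons, if_pos rfl]
    congr 1
    · conv_rhs => rw [← List.map_id (desc _)]
      refine List.map_congr_left fun x hx => ?_
      simp only [mem_desc, Finset.mem_filter] at hx
      rw [if_neg hx.2.ne', id]
    · congr 1
      conv_rhs => rw [← List.map_id (desc _)]
      refine List.map_congr_left fun x hx => ?_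
      simp only [mem_desc, Finset.mem_filter] at hx
      rw [if_neg hx.2.ne, id]
  rw [h1]
  split_ifs with hsT
  · exact (hF.append (desc (T.filter (p < ·)))).eq_zero_of_mem (by simp [hsT, hs]) (desc_pairwise _)
  · rw [(hF.append (desc (T.filter (p < ·)))).insert_desc (by simp [hsT])]
    congr 2
    · congr 1
      ext x; simp only [Finset.mem_filter]; tauto
    · refine eq_desc (List.pairwise_append.2 ⟨desc_pairwise _, desc_pairwise _, ?_⟩) ?_
      · intro a ha b hb
        simp only [mem_desc, Finset.mem_filter, Finset.mem_insert] at ha hb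
        rcases hb with rfl | hb
        · exact hs.trans ha.2
        · exact hb.2.trans ha.2
      · intro x
        simp only [List.mem_append, mem_desc, Finset.mem_filter, Finset.mem_insert,
          Finset.mem_erase]
        rcases lt_trichotomy x p with h | h | h
        · simp [h, h.ne, h.not_gt]
        · simp [h, hs.ne']
        · simp [h, h.ne', h.not_gt, (hs.trans h).ne']

variable [Fintype ι]

/-- The minors of a matrix with entries in an algebra, in the normalization of the fused matrices
of the reflection equation. -/
noncomputable def fminor (q : ℂ) (Z : ι → ι → A) (I J : Finset ι) : A :=
  phi q Z J.card J (desc I)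

/-- The coefficients of the braiding of a basis vector `p` past a column of minors. -/
noncomputable def lapTerm (q : ℂ) (f : Finset ι → A) (p t : ι) (T : Finset ι) : A :=
  if t = p then (if p ∈ T then q⁻¹ else 1) • f T
  else if t < p ∧ p ∈ T ∧ t ∉ T then
    ((q⁻¹ - q) * (-q) ^ (T.filter fun x => t < x ∧ x < p).card) • f (insert t (T.erase p)) else 0

/-- The Laplace expansion of a minor along the row `s`. -/
noncomputable def laplace (q : ℂ) (Z : ι → ι → A) (s : ι) (T J : Finset ι) : A :=
  ∑ p ∈ J, (-q) ^ (J.filter (· < p)).card •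
    ∑ t, Z s t * lapTerm q (fun S => fminor q Z S (J.erase p)) p t T

theorem fminor_empty (Z : ι → ι → A) (I : Finset ι) :
    fminor q Z I ∅ = if I = ∅ then 1 else 0 := by
  rw [fminor, Finset.card_empty, phi]
  congr 1
  rw [← List.length_eq_zero_iff, length_desc, Finset.card_eq_zero]

variable {Z : ι → ι → A}

/-- The letter that replaces `p` has to be moved back to its place in the decreasing word; this
accounts for the power of -q in `lapTerm`. -/
theorem mv_phi_desc (hq : q ≠ 0) (hq2 : q ^ 2 + 1 ≠ 0) (hZ : IsRE q Z) (p t : ι) (T J : Finset ι) :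
    mv q p (desc T) (phi q Z J.card J) t = lapTerm q (fun S => fminor q Z S J) p t T := by
  rw [mv_of_pairwise _ _ (desc_pairwise T), lapTerm]
  simp only [mem_desc]
  by_cases h1 : t = p
  · rw [if_pos h1, if_pos h1]; rfl
  · rw [if_neg h1, if_neg h1]
    by_cases h2 : t < p ∧ p ∈ T
    · rw [if_pos h2, (anti_phi hq hq2 hZ _ _).map_desc h2.2 h2.1]
      by_cases h3 : t ∈ T
      · simp [h3]
      · rw [if_neg h3, if_pos ⟨h2.1, h2.2, h3⟩, mul_smul]; rfl
    · rw [if_neg h2, if_neg (by tauto)]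

/-- Laplace expansion along an arbitrary row. -/
theorem laplace_eq (hq : q ≠ 0) (hq2 : q ^ 2 + 1 ≠ 0) (hZ : IsRE q Z) (s : ι) (T J : Finset ι)
    (hJ : J.card = T.card + 1) :
    laplace q Z s T J = if s ∈ T then 0 else
      ((-q) ^ T.card * (-q) ^ (T.filter (s < ·)).card) • fminor q Z (insert s T) J := by
  have h1 : laplace q Z s T J = (-q) ^ T.card • phi q Z J.card J (s :: desc T) := by
    rw [hJ, phi_cons, smul_smul, mul_inv_cancel₀ (pow_ne_zero _ (neg_ne_zero.2 hq)), one_smul,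
      laplace]
    refine Finset.sum_congr rfl fun p hp => ?_
    congr 1
    refine Finset.sum_congr rfl fun t _ => ?_
    rw [← mv_phi_desc hq hq2 hZ, Finset.card_erase_of_mem hp, hJ, Nat.add_sub_cancel]
  rw [h1]
  split_ifs with hs
  · rw [(anti_phi hq hq2 hZ _ _).eq_zero_of_mem (by simpa using hs) (desc_pairwise T), smul_zero]
  · rw [(anti_phi hq hq2 hZ _ _).insert_desc hs, smul_smul]; rfl

/-- This form is the basis of all inductions on minors below: the row may be chosen so that most of
its relevant entries vanish or behave well. -/
theorem fminor_eq_laplace (hq : q ≠ 0) (hq2 : q ^ 2 + 1 ≠ 0) (hZ : IsRE q Z) {I J : Finset ι}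
    (hIJ : I.card = J.card) {s : ι} (hs : s ∈ I) :
    fminor q Z I J =
      ((-q) ^ (I.card - 1) * (-q) ^ (I.filter (s < ·)).card)⁻¹ • laplace q Z s (I.erase s) J := by
  have h1 : (I.erase s).card = I.card - 1 := Finset.card_erase_of_mem hs
  have h2 : 0 < I.card := Finset.card_pos.2 ⟨s, hs⟩
  rw [laplace_eq hq hq2 hZ _ _ _ (by omega), if_neg (by simp), Finset.insert_erase hs, h1,
    Finset.filter_erase, Finset.erase_eq_of_notMem (by simp), smul_smul, inv_mul_cancel₀, one_smul]
  exact mul_ne_zero (pow_ne_zero _ (neg_ne_zero.2 hq)) (pow_ne_zero _ (neg_ne_zero.2 hq))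

theorem phi_map {B : Type*} [Ring B] [Algebra ℂ B] (f : A →ₐ[ℂ] B) (k : ℕ) (J : Finset ι)
    (u : List ι) : phi q (fun i j => f (Z i j)) k J u = f (phi q Z k J u) := by
  induction k generalizing J u with
  | zero => simp only [phi]; split_ifs <;> simp
  | succ k ih =>
    cases u with
    | nil => simp [phi]
    | cons s u =>
      simp only [phi_cons, map_smul, map_sum, map_mul]
      congr 1
      refine Finset.sum_congr rfl fun p _ => ?_
      congr 1
      refine Finset.sum_congr rfl fun t _ => ?_
      rw [← mv_map]
      congr 1
      exact congrArg (fun G => mv q p u G t) (funext fun v => ih _ v)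

theorem fminor_map {B : Type*} [Ring B] [Algebra ℂ B] (f : A →ₐ[ℂ] B) (I J : Finset ι) :
    fminor q (fun i j => f (Z i j)) I J = f (fminor q Z I J) := phi_map f _ _ _

end SetForm

end REA

open scoped Kronecker ComplexConjugate

namespace REA

/-! ### The matrix form of the reflection equation. -/

section Braid

variable {N : ℕ}

theorem braid_apply (q : ℝ) (a b c d : Fin N) :
    braid q N (a, b) (c, d) = (if b = c ∧ a = d then (if a = b then (q : ℂ)⁻¹ else 1) else 0) +
      if a = c ∧ b = d ∧ b < a then (q : ℂ)⁻¹ - q else 0 := by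
  have e1 : ∀ i j k l : Fin N, (Matrix.single j i (1 : ℂ) ⊗ₖ Matrix.single k l (1 : ℂ))
      (a, b) (c, d) = if j = a ∧ i = c ∧ k = b ∧ l = d then 1 else 0 := by
    intro i j k l
    simp only [Matrix.kronecker_apply, Matrix.single_apply]
    by_cases h1 : j = a <;> by_cases h2 : i = c <;> by_cases h3 : k = b <;>
      by_cases h4 : l = d <;> simp [h1, h2, h3, h4]
  have e2 : ∀ i j : Fin N, (if i < j then Matrix.single j j (1 : ℂ) ⊗ₖ Matrix.single i i (1 : ℂ)
      else 0) (a, b) (c, d) = if i < j ∧ j = a ∧ j = c ∧ i = b ∧ i = d then 1 else 0 := by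
    intro i j
    by_cases h : i < j
    · simp only [h, if_true, e1, true_and]
    · simp only [h, if_false, Matrix.zero_apply, false_and]
  simp only [braid, Matrix.add_apply, Matrix.sum_apply, Matrix.smul_apply, e1, e2, smul_eq_mul]
  congr 1
  · rw [Finset.sum_eq_single b, Finset.sum_eq_single a]
    · by_cases h1 : b = c <;> by_cases h2 : a = d <;> by_cases h3 : a = b <;>
        simp [h1, h2, h3, eq_comm]
    · intro j _ hj; simp [hj]
    · simp
    · intro i _ hi; simp [hi]
    · simp
  · rw [Finset.sum_eq_single b, Finset.sum_eq_single a]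
    · by_cases h1 : a = c <;> by_cases h2 : b = d <;> by_cases h3 : b < a <;>
        simp [h1, h2, h3]
    · intro j _ hj; simp [hj]
    · simp
    · intro i _ hi; simp [hi]
    · simp

variable {A : Type*} [Ring A] [Algebra ℂ A]

/-- The matrix `1 ⊗ Z`. -/
def secondLeg (Z : Fin N → Fin N → A) : Matrix (Fin N × Fin N) (Fin N × Fin N) A :=
  (1 : Matrix (Fin N) (Fin N) A) ⊗ₖ Matrix.of Z

theorem braid_mul_apply {κ : Type*} (q : ℝ) (M : Matrix (Fin N × Fin N) κ A) (a b : Fin N)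
    (y : κ) : ((braid q N).map (algebraMap ℂ A) * M) (a, b) y =
      (if a = b then (q : ℂ)⁻¹ else 1) • M (b, a) y +
        (if b < a then (q : ℂ)⁻¹ - q else 0) • M (a, b) y := by
  have h : ∀ x : Fin N × Fin N, (algebraMap ℂ A) (braid q N (a, b) x) * M x y =
      (if x = (b, a) then (if a = b then (q : ℂ)⁻¹ else 1) • M (b, a) y else 0) +
      (if x = (a, b) then (if b < a then (q : ℂ)⁻¹ - q else 0) • M (a, b) y else 0) := by
    rintro ⟨c, d⟩
    rw [braid_apply, ← Algebra.smul_def, add_smul]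
    simp only [Prod.mk.injEq]
    by_cases h1 : b = c <;> by_cases h2 : a = d <;> by_cases h3 : a = c <;> by_cases h4 : b = d <;>
      simp [h1, h2, h3, h4, eq_comm] <;> simp_all
  simp only [Matrix.mul_apply, Matrix.map_apply, h, Finset.sum_add_distrib, Finset.sum_ite_eq',
    Finset.mem_univ, if_true]

theorem mul_braid_apply {κ : Type*} (q : ℝ) (M : Matrix κ (Fin N × Fin N) A) (c d : Fin N)
    (y : κ) : (M * (braid q N).map (algebraMap ℂ A)) y (c, d) =
      (if c = d then (q : ℂ)⁻¹ else 1) • M y (d, c) +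
        (if d < c then (q : ℂ)⁻¹ - q else 0) • M y (c, d) := by
  have h : ∀ x : Fin N × Fin N, M y x * (algebraMap ℂ A) (braid q N x (c, d)) =
      (if x = (d, c) then (if c = d then (q : ℂ)⁻¹ else 1) • M y (d, c) else 0) +
      (if x = (c, d) then (if d < c then (q : ℂ)⁻¹ - q else 0) • M y (c, d) else 0) := by
    rintro ⟨a, b⟩
    rw [braid_apply, ← Algebra.commutes, ← Algebra.smul_def, add_smul]
    simp only [Prod.mk.injEq]
    by_cases h1 : b = c <;> by_cases h2 : a = d <;> by_cases h3 : a = c <;> by_cases h4 : b = d <;>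
      simp [h1, h2, h3, h4, eq_comm] <;> simp_all
  simp only [Matrix.mul_apply, Matrix.map_apply, h, Finset.sum_add_distrib, Finset.sum_ite_eq',
    Finset.mem_univ, if_true]

theorem secondLeg_mul_apply {κ : Type*} (Z : Fin N → Fin N → A)
    (M : Matrix (Fin N × Fin N) κ A) (a b : Fin N) (y : κ) :
    (secondLeg Z * M) (a, b) y = ∑ x, Z b x * M (a, x) y := by
  simp only [Matrix.mul_apply, secondLeg, Matrix.kronecker_apply, Fintype.sum_prod_type,
    Matrix.one_apply, Matrix.of_apply, ite_mul, one_mul, zero_mul]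
  rw [Finset.sum_eq_single a]
  · simp
  · intro c _ hc; simp [Ne.symm hc]
  · simp

theorem secondLeg_braid_secondLeg (q : ℝ) (Z : Fin N → Fin N → A) (a b c d : Fin N) :
    (secondLeg Z * (braid q N).map (algebraMap ℂ A) * secondLeg Z) (a, b) (c, d) =
      reY (q : ℂ) Z a b c d := by
  rw [Matrix.mul_assoc, secondLeg_mul_apply]
  simp only [braid_mul_apply, secondLeg, Matrix.kronecker_apply, Matrix.one_apply,
    Matrix.of_apply, ite_mul, one_mul, zero_mul, reY, mul_add, Finset.sum_add_distrib]
  congr 1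
  · rw [Finset.sum_eq_single c]
    · by_cases h : a = c <;> simp [h]
    · intro x _ hx; simp [hx]
    · simp
  · by_cases h : a = c
    · simp only [h, if_true, ite_smul, zero_smul, Finset.smul_sum, Finset.sum_filter,
        smul_ite, smul_zero, mul_ite, mul_zero, mul_smul_comm]
    · simp [h]

/-- Bracketing the equation as R (Z₂₃ R Z₂₃) = (Z₂₃ R Z₂₃) R, the inner factor has the entries
`reY`, and each outer R contributes only two terms. -/
theorem isRE_iff (q : ℝ) (Z : Fin N → Fin N → A) : IsRE (q : ℂ) Z ↔
    (braid q N).map (algebraMap ℂ A) * secondLeg Z * (braid q N).map (algebraMap ℂ A) *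
      secondLeg Z = secondLeg Z * (braid q N).map (algebraMap ℂ A) * secondLeg Z *
        (braid q N).map (algebraMap ℂ A) := by
  rw [show (braid q N).map (algebraMap ℂ A) * secondLeg Z * (braid q N).map (algebraMap ℂ A) *
      secondLeg Z = (braid q N).map (algebraMap ℂ A) *
        (secondLeg Z * (braid q N).map (algebraMap ℂ A) * secondLeg Z) by
    simp only [Matrix.mul_assoc]]
  constructor
  · intro h
    ext ⟨a, b⟩ ⟨c, d⟩
    rw [braid_mul_apply, mul_braid_apply]
    simp only [secondLeg_braid_secondLeg]
    exact h a b c d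
  · intro h a b c d
    have := congrFun (congrFun h (a, b)) (c, d)
    rw [braid_mul_apply, mul_braid_apply] at this
    simpa only [secondLeg_braid_secondLeg] using this

theorem map_braidZ (q : ℝ) (f : FreeZ N →ₐ[ℂ] A) :
    (braidZ q N).map f = (braid q N).map (algebraMap ℂ A) := by
  ext x y; simp [braidZ]

theorem map_matZ (f : FreeZ N →ₐ[ℂ] A) :
    (matZ N).map f = secondLeg fun i j => f (freeGen i j) := by
  ext x y
  simp only [matZ, secondLeg, Matrix.map_apply, Matrix.kroneckerMap_apply, map_mul, Matrix.of_apply,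
    Matrix.one_apply]
  split_ifs <;> simp

/-- An algebra homomorphism from the free algebra respects the defining relations exactly when it
maps the generators to a solution of the reflection equation. -/
theorem isRE_iff_forall (q : ℝ) (f : FreeZ N →ₐ[ℂ] A) :
    (IsRE (q : ℂ) fun i j => f (freeGen i j)) ↔ ∀ x y,
      f ((braidZ q N * matZ N * braidZ q N * matZ N) x y) =
        f ((matZ N * braidZ q N * matZ N * braidZ q N) x y) := by
  have hm : ∀ M M' : Matrix (Fin N × Fin N) (Fin N × Fin N) (FreeZ N),
      (M * M').map f = M.map f * M'.map f := fun M M' => Matrix.map_mul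
  rw [isRE_iff, ← map_braidZ q f, ← map_matZ f, ← hm, ← hm, ← hm, ← hm, ← hm, ← hm]
  exact ⟨fun h x y => congrFun (congrFun h x) y, fun h => Matrix.ext h⟩

theorem isRE_Z (q : ℝ) : IsRE (q : ℂ) (Z q : Fin N → Fin N → OqH q N) :=
  (isRE_iff_forall q (toOqH q N)).2 fun x y => toOqH_rel (ReflRel.fwd x y)

end Braid

/-! ### The coquasitriangular structure evaluated on words. -/

section Words

variable {N : ℕ} {A : Type*} [Ring A] [Algebra ℂ A] {q : ℝ}

/-- Contracting with the generator values of r gives the two-term recursion in `mv`; with q⁻¹ in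
place of q it also serves for r⁻¹. -/
theorem sum_rGen_smul (a c : Fin N) (f : Fin N → Fin N → A) :
    ∑ d, ∑ x, rGen q a x c d • f d x =
      (if c = a then (q : ℂ)⁻¹ else 1) • f c a +
        (if a < c then (q : ℂ)⁻¹ - q else 0) • f a c := by
  have h : ∀ d x, rGen q a x c d • f d x =
      (if d = c then if x = a then (if c = a then (q : ℂ)⁻¹ else 1) • f c a else 0 else 0) +
      (if d = a then if x = c then (if a < c then (q : ℂ)⁻¹ - q else 0) • f a c else 0 else 0) := by
    intro d x
    rw [rGen]
    by_cases h1 : d = c <;> by_cases h2 : x = a <;> by_cases h3 : d = a <;> by_cases h4 : x = c <;>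
      simp [h1, h2, h3, h4, eq_comm] <;> simp_all [eq_comm]
  have h' : ∀ (c a : Fin N) (y : A),
      ∑ d, ∑ x, (if d = c then if x = a then y else 0 else 0) = y := by
    intro c a y
    rw [Finset.sum_eq_single c]
    · simp
    · intro d _ hd; simp [hd]
    · simp
  simp only [h, Finset.sum_add_distrib, h']

/-- The definition of `rWord` peels off the first factor, whereas `mv` works on reversed words and
needs the last one. -/
theorem rWord_append_singleton (a b : Fin N) (w : List (Fin N × Fin N)) (cd : Fin N × Fin N) :
    rWord q a b (w ++ [cd]) = ∑ e, rGen q a e cd.1 cd.2 * rWord q e b w := by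
  induction w generalizing b with
  | nil => simp [rWord]
  | cons x w ih =>
    simp only [List.cons_append, rWord, ih, Finset.sum_mul, Finset.mul_sum]
    rw [Finset.sum_comm]
    simp only [mul_assoc]

theorem sum_snoc {κ M : Type*} [Fintype κ] [AddCommMonoid M] {k : ℕ} (f : (Fin (k + 1) → κ) → M) :
    ∑ v, f v = ∑ d, ∑ v : Fin k → κ, f (Fin.snoc v d) := by
  rw [← Fintype.sum_prod_type' (f := fun d (v : Fin k → κ) => f (Fin.snoc v d))]
  exact (Fintype.sum_equiv (Fin.snocEquiv fun _ => κ) _ _ fun _ => rfl).symm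

theorem sum_cons {κ M : Type*} [Fintype κ] [AddCommMonoid M] {k : ℕ} (f : (Fin (k + 1) → κ) → M) :
    ∑ v, f v = ∑ d, ∑ v : Fin k → κ, f (Fin.cons d v) := by
  rw [← Fintype.sum_prod_type' (f := fun d (v : Fin k → κ) => f (Fin.cons d v))]
  exact (Fintype.sum_equiv (Fin.consEquiv fun _ => κ) _ _ fun _ => rfl).symm

theorem ofFn_snoc {κ : Type*} {k : ℕ} (v : Fin k → κ) (d : κ) :
    List.ofFn (Fin.snoc v d : Fin (k + 1) → κ) = List.ofFn v ++ [d] := by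
  rw [List.ofFn_succ']; simp

/-- The braiding of a basis vector past a tensor, in terms of the coquasitriangular structure. -/
theorem mv_eq_sum_rWord {k : ℕ} (e : Fin k → Fin N) (F : List (Fin N) → A) (p s : Fin N) :
    mv (q : ℂ) p (List.ofFn e).reverse F s =
      ∑ v : Fin k → Fin N, rWord q s p (List.ofFn fun j => (e j, v j)) •
        F (List.ofFn v).reverse := by
  induction k generalizing F s with
  | zero => simp [mv, rWord]
  | succ k ih =>
    obtain ⟨e', c, rfl⟩ : ∃ e' c, e = Fin.snoc e' c :=
      ⟨Fin.init e, e (Fin.last k), (Fin.snoc_init_self e).symm⟩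
    have h0 := sum_rGen_smul (q := q) s c fun d x =>
        ∑ v : Fin k → Fin N, rWord q x p (List.ofFn fun j => (e' j, v j)) •
          F (d :: (List.ofFn v).reverse)
    rw [sum_snoc, ofFn_snoc, List.reverse_append, List.reverse_singleton, List.singleton_append, mv,
      ih, ih, ← h0]
    refine Finset.sum_congr rfl fun d _ => ?_
    have h1 : ∀ v : Fin k → Fin N, (List.ofFn fun j => ((Fin.snoc e' c : Fin (k + 1) → Fin N) j,
        (Fin.snoc v d : Fin (k + 1) → Fin N) j)) = (List.ofFn fun j => (e' j, v j)) ++ [(c, d)] := by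
      intro v
      rw [List.ofFn_succ']; simp
    simp only [h1, rWord_append_singleton, ofFn_snoc, List.reverse_append, List.reverse_singleton,
      List.singleton_append, Finset.sum_smul, Finset.smul_sum, mul_smul]
    rw [Finset.sum_comm]

theorem Anti.append_right {F : List (Fin N) → A} {q : ℂ} (h : Anti q F) (l' : List (Fin N)) :
    Anti q fun v => F (v ++ l') :=
  ⟨fun l a u => by simpa using h.1 l a (u ++ l'),
    fun l a b u hab => by simpa using h.2 l a b (u ++ l') hab⟩

/-- The inverse braiding on antisymmetric tensors, in terms of the coquasitriangular structure. -/
theorem Anti.sum_rInvWord (hq : (q : ℂ) ≠ 0) {k : ℕ} (e : Fin k → Fin N) {G : List (Fin N) → A}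
    (hG : Anti (q : ℂ) G) (a : Fin N) :
    ∑ s, ∑ v : Fin k → Fin N, rInvWord q a s (List.ofFn fun j => (e j, v j)) •
      G (s :: (List.ofFn v).reverse) = ((-(q : ℂ)) ^ k)⁻¹ • G ((List.ofFn e).reverse ++ [a]) := by
  induction k generalizing G a with
  | zero => simp [rInvWord]
  | succ k ih =>
    obtain ⟨c, e', rfl⟩ : ∃ c e', e = Fin.cons c e' :=
      ⟨e 0, Fin.tail e, (Fin.cons_self_tail e).symm⟩
    have h1 : ∀ (d : Fin N) (v : Fin k → Fin N),
        (List.ofFn fun j => ((Fin.cons c e' : Fin (k + 1) → Fin N) j,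
        (Fin.cons d v : Fin (k + 1) → Fin N) j)) = (c, d) :: (List.ofFn fun j => (e' j, v j)) := by
      intro d v
      rw [List.ofFn_succ]; simp
    have h2 : ∀ (d : Fin N) (v : Fin k → Fin N),
        (List.ofFn (Fin.cons d v : Fin (k + 1) → Fin N)).reverse =
          (List.ofFn v).reverse ++ [d] := by
      intro d v
      rw [List.ofFn_cons, List.reverse_cons]
    have h3 : (∑ s, ∑ v : Fin (k + 1) → Fin N,
        rInvWord q a s (List.ofFn fun j => ((Fin.cons c e' : Fin (k + 1) → Fin N) j, v j)) •
          G (s :: (List.ofFn v).reverse)) =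
        ∑ d, ∑ x, rGen q⁻¹ a x c d • ∑ s, ∑ v : Fin k → Fin N,
          rInvWord q x s (List.ofFn fun j => (e' j, v j)) • G ((s :: (List.ofFn v).reverse) ++ [d])
        := by
      simp only [sum_cons, h1, h2, rInvWord, rInvGen, Finset.sum_smul, Finset.smul_sum, mul_smul,
        List.cons_append]
      rw [Finset.sum_comm]
      refine Finset.sum_congr rfl fun d _ => ?_
      rw [Finset.sum_congr rfl fun s _ => Finset.sum_comm, Finset.sum_comm]
    rw [h3]
    have h4 : ∀ d x, ∑ s, ∑ v : Fin k → Fin N,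
          rInvWord q x s (List.ofFn fun j => (e' j, v j)) • G ((s :: (List.ofFn v).reverse) ++ [d])
        = ((-(q : ℂ)) ^ k)⁻¹ • G ((List.ofFn e').reverse ++ x :: d :: []) := by
      intro d x
      rw [ih e' (hG.append_right [d]) x]
      simp
    simp only [h4]
    rw [sum_rGen_smul, h2, List.append_assoc, List.singleton_append, pow_succ, mul_inv]
    generalize ((-(q : ℂ)) ^ k)⁻¹ = κ
    simp only [Complex.ofReal_inv, inv_inv]
    -- On an antisymmetric pair of letters the inverse braid operator is multiplication by -q⁻¹ in
    -- every order; each letter of the word contributes one such factor.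
    rcases lt_trichotomy a c with h | h | h
    · rw [hG.2 _ _ _ _ h]
      simp only [h.ne', h, if_true, if_false]
      match_scalars
      field_simp
      ring
    · subst h
      rw [hG.1]; simp
    · rw [hG.2 _ _ _ _ h]
      simp only [h.ne, h.not_gt, if_false]
      match_scalars
      field_simp
      ring

theorem inversions_eq_sum {α β : Type*} [Fintype α] [LinearOrder α] [LinearOrder β] (σ : α → β) :
    inversions σ = ∑ i, ∑ j, if i < j ∧ σ j < σ i then 1 else 0 := by
  rw [inversions, Finset.card_filter, Fintype.sum_prod_type]

theorem inversions_comp {α β γ δ : Type*} [Fintype α] [LinearOrder α] [Fintype β] [LinearOrder β]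
    [LinearOrder γ] [LinearOrder δ] (e : α ≃o β) (f : β → γ) {g : γ → δ} (hg : StrictMono g) :
    inversions (fun a => g (f (e a))) = inversions f := by
  rw [inversions_eq_sum, inversions_eq_sum, ← Equiv.sum_comp e.toEquiv]
  refine Finset.sum_congr rfl fun i _ => ?_
  rw [← Equiv.sum_comp e.toEquiv]
  refine Finset.sum_congr rfl fun j _ => ?_
  simp [hg.lt_iff_lt]

theorem inversions_snoc {β : Type*} [LinearOrder β] {k : ℕ} (v : Fin k → β) (d : β) :
    inversions (Fin.snoc v d : Fin (k + 1) → β) =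
      inversions v + (Finset.univ.filter fun j => d < v j).card := by
  simp only [inversions_eq_sum, Fin.sum_univ_castSucc, Fin.snoc_castSucc, Fin.snoc_last,
    Fin.castSucc_lt_castSucc_iff, Finset.sum_add_distrib, Fin.castSucc_lt_last, true_and,
    lt_irrefl, false_and, if_false, add_zero, Finset.card_filter]
  have h : ∀ i : Fin k, ¬ Fin.last k < i.castSucc := fun i => (Fin.castSucc_lt_last i).not_gt
  simp [h]

/-- Sorting the letters of a word. -/
theorem Anti.ofFn_reverse {q : ℂ} {k : ℕ} (v : Fin k → Fin N) {F : List (Fin N) → A}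
    (hF : Anti q F) : F (List.ofFn v).reverse =
      if Function.Injective v then (-q) ^ inversions v • F (desc (Finset.univ.image v)) else 0 := by
  induction k generalizing F with
  | zero =>
    rw [if_pos (Function.injective_of_subsingleton v)]
    simp [inversions]
  | succ k ih =>
    obtain ⟨v, d, rfl⟩ : ∃ e' c, v = Fin.snoc e' c :=
      ⟨Fin.init v, v (Fin.last k), (Fin.snoc_init_self v).symm⟩
    rw [ofFn_snoc, List.reverse_append, List.reverse_singleton, List.singleton_append,
      ih v (hF.cons d)]
    simp only [Fin.snoc_injective_iff]
    by_cases hv : Function.Injective v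
    · rw [if_pos hv]
      by_cases hd : d ∈ Set.range v
      · have : d ∈ Finset.univ.image v := by simpa using hd
        rw [if_neg (by tauto), hF.eq_zero_of_mem (by simpa using hd) (desc_pairwise _), smul_zero]
      · have hd' : d ∉ Finset.univ.image v := by simpa using hd
        have h1 : Finset.univ.image (Fin.snoc v d : Fin (k + 1) → Fin N) =
            insert d (Finset.univ.image v) := by
          ext x
          simp [Fin.exists_fin_succ', eq_comm, or_comm]
        have h2 : ((Finset.univ.image v).filter (d < ·)).card =
            (Finset.univ.filter fun j => d < v j).card := by
          rw [Finset.filter_image, Finset.card_image_of_injective _ hv]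
        rw [if_pos (by tauto), hF.insert_desc hd', h1, inversions_snoc, smul_smul, ← pow_add, h2]
    · rw [if_neg hv, if_neg (by tauto)]

end Words

end REA

namespace REA

/-! ### Identification of the quantum minors with the fused matrices. -/

section Link

variable {N : ℕ} {A : Type*} [Ring A] [Algebra ℂ A] {q : ℝ}

theorem sort_attach_eq {T : Finset (Fin N)} {k : ℕ} (hT : T.card = k) :
    T.attach.sort (· ≤ ·) = List.ofFn (T.orderIsoOfFin hT) := by
  have hp : (T.attach.sort (· ≤ ·)).Perm (List.ofFn (T.orderIsoOfFin hT)) := by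
    rw [List.perm_ext_iff_of_nodup (Finset.sort_nodup _ _)
      (List.nodup_ofFn.2 (T.orderIsoOfFin hT).injective)]
    intro x
    simp only [Finset.mem_sort, Finset.mem_attach, true_iff, List.mem_ofFn]
    exact ⟨(T.orderIsoOfFin hT).symm x, by simp⟩
  refine hp.eq_of_pairwise (le := (· ≤ ·)) (fun a b _ _ h1 h2 => le_antisymm h1 h2)
    (Finset.pairwise_sort _ _) ?_
  rw [List.pairwise_ofFn]
  intro i j hij
  exact (T.orderIsoOfFin hT).monotone hij.le

theorem minorWord_eq {T S : Finset (Fin N)} {k : ℕ} (hT : T.card = k)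
    (σ : {i // i ∈ T} ≃ {j // j ∈ S}) : minorWord T S σ =
      List.ofFn fun j => ((T.orderEmbOfFin hT) j, (σ (T.orderIsoOfFin hT j)).1) := by
  rw [minorWord, sort_attach_eq hT, List.map_ofFn]
  rfl

theorem desc_eq_ofFn {T : Finset (Fin N)} {k : ℕ} (hT : T.card = k) :
    desc T = (List.ofFn (T.orderEmbOfFin hT)).reverse := by
  symm
  refine eq_desc ?_ ?_
  · rw [List.pairwise_reverse, List.pairwise_ofFn]
    intro i j hij
    exact (T.orderEmbOfFin hT).strictMono hij
  · intro x
    rw [List.mem_reverse, List.mem_ofFn]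
    have := Finset.range_orderEmbOfFin T hT
    rw [← Finset.mem_coe, ← this]
    rfl

/-- Sums over sets and bijections are sums over words, for antisymmetric summands. -/
theorem Anti.sum_powersetCard {q : ℂ} {T : Finset (Fin N)} {k : ℕ} (hT : T.card = k)
    {F : List (Fin N) → A} (hF : Anti q F) (c : List (Fin N × Fin N) → ℂ) :
    ∑ S ∈ Finset.powersetCard k Finset.univ, (∑ σ : {i // i ∈ T} ≃ {j // j ∈ S},
      (-q) ^ inversions σ * c (minorWord T S σ)) • F (desc S) =
    ∑ v : Fin k → Fin N, c (List.ofFn fun j => (T.orderEmbOfFin hT j, v j)) •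
      F (List.ofFn v).reverse := by
  -- Words with a repeated letter drop out; an injective word is sorted at the cost of its
  -- inversions.
  have h1 : ∀ v : Fin k → Fin N, c (List.ofFn fun j => (T.orderEmbOfFin hT j, v j)) •
      F (List.ofFn v).reverse = if Function.Injective v then
        ((-q) ^ inversions v * c (List.ofFn fun j => (T.orderEmbOfFin hT j, v j))) •
          F (desc (Finset.univ.image v)) else 0 := by
    intro v
    rw [hF.ofFn_reverse]
    split_ifs
    · rw [smul_smul, mul_comm]
    · rw [smul_zero]
  rw [Finset.sum_congr rfl fun v _ => h1 v, ← Finset.sum_filter]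
  simp only [Finset.sum_smul]
  rw [Finset.sum_sigma']
  have himage : ∀ (S : Finset (Fin N)) (σ : {i // i ∈ T} ≃ {j // j ∈ S}),
      Finset.univ.image (fun j => (σ (T.orderIsoOfFin hT j)).1) = S := by
    intro S σ
    ext x
    simp only [Finset.mem_image, Finset.mem_univ, true_and]
    constructor
    · rintro ⟨j, rfl⟩; exact (σ _).2
    · intro hx
      exact ⟨(T.orderIsoOfFin hT).symm (σ.symm ⟨x, hx⟩), by simp⟩
  -- An injective word of length k is the same as its set of letters `S` together with a bijection
  -- from `T` to `S`.
  refine Finset.sum_nbij (fun x j => (x.2 (T.orderIsoOfFin hT j)).1) ?_ ?_ ?_ ?_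
  · rintro ⟨S, σ⟩ -
    simp only [Finset.mem_filter, Finset.mem_univ, true_and]
    intro i j hij
    exact (T.orderIsoOfFin hT).injective (σ.injective (Subtype.ext hij))
  · rintro ⟨S, σ⟩ - ⟨S', σ'⟩ - h
    beta_reduce at h
    have hS : S = S' := by rw [← himage S σ, ← himage S' σ', h]
    subst hS
    congr 1
    ext x
    obtain ⟨j, rfl⟩ := (T.orderIsoOfFin hT).surjective x
    exact congrArg Fin.val (congrFun h j)
  · intro v hv
    have hv : Function.Injective v := by simpa using hv
    refine ⟨⟨Finset.univ.image v, (T.orderIsoOfFin hT).symm.toEquiv.trans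
      (Equiv.ofBijective (fun j => ⟨v j, Finset.mem_image_of_mem v (Finset.mem_univ j)⟩)
        ⟨fun i j hij => hv (congrArg Subtype.val hij), ?_⟩)⟩, ?_, ?_⟩
    · rintro ⟨x, hx⟩
      obtain ⟨j, -, rfl⟩ := Finset.mem_image.1 hx
      exact ⟨j, rfl⟩
    · simp [Finset.card_image_of_injective _ hv]
    · funext j
      simp only [Equiv.trans_apply, OrderIso.toEquiv_symm, OrderIso.coe_toEquiv,
        OrderIso.symm_apply_apply]
      simp
      rfl
  · rintro ⟨S, σ⟩ -
    beta_reduce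
    rw [himage, minorWord_eq hT]
    congr 3
    exact (inversions_comp (T.orderIsoOfFin hT) σ (g := Subtype.val) (fun a b h => h)).symm

/-- The quantum minors of the reflection equation algebra are the entries of the fused matrices. -/
theorem qMinorAux_eq (hq : (q : ℂ) ≠ 0) (hq2 : (q : ℂ) ^ 2 + 1 ≠ 0) (k : ℕ)
    {I J : Finset (Fin N)} (hI : I.card = k) (hJ : J.card = k) :
    qMinorAux q k I J = phi (q : ℂ) (Z q) k J (desc I) := by
  induction k generalizing I J with
  | zero =>
    rw [Finset.card_eq_zero] at hI
    subst hI
    simp [qMinorAux, phi]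
  | succ k ih =>
    have hne : I.Nonempty := Finset.card_pos.1 (by omega)
    have hanti := anti_phi hq hq2 (isRE_Z (N := N) q)
    rw [qMinorAux, dif_pos hne]
    set i := I.min' hne with hi
    have hiI : i ∈ I := I.min'_mem hne
    have hI' : (I.erase i).card = k := by rw [Finset.card_erase_of_mem hiI, hI]; rfl
    -- The part of the definition with R̂ is, up to (-q)^k, the recursion that defines `phi` at the
    -- word `s :: desc T`.
    have h1 : ∀ s, ∀ T ∈ Finset.powersetCard k (Finset.univ : Finset (Fin N)),
        ∑ p ∈ J, ∑ t, ∑ S ∈ Finset.powersetCard k Finset.univ,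
          ((-(q : ℂ)) ^ (J.filter (· < p)).card * rHatInv q s i (I.erase i) T * rHat q p t T S) •
            (Z q s t * qMinorAux q k S (J.erase p)) =
        rHatInv q s i (I.erase i) T • ((-(q : ℂ)) ^ k • phi (q : ℂ) (Z q) (k + 1) J (s :: desc T))
        := by
      intro s T hT
      have hT : T.card = k := (Finset.mem_powersetCard.1 hT).2
      rw [phi_cons, smul_smul, smul_smul, mul_assoc,
        mul_inv_cancel₀ (pow_ne_zero _ (neg_ne_zero.2 hq)), mul_one, Finset.smul_sum]
      refine Finset.sum_congr rfl fun p hp => ?_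
      rw [smul_smul, Finset.smul_sum]
      refine Finset.sum_congr rfl fun t _ => ?_
      rw [desc_eq_ofFn hT, mv_eq_sum_rWord, ← (hanti k (J.erase p)).sum_powersetCard hT,
        Finset.mul_sum, Finset.smul_sum]
      refine Finset.sum_congr rfl fun S hS => ?_
      have hS : S.card = k := (Finset.mem_powersetCard.1 hS).2
      rw [ih hS (by rw [Finset.card_erase_of_mem hp, hJ]; rfl), mul_smul_comm, smul_smul, rHat,
        mul_comm ((-(q : ℂ)) ^ _)]
    calc _ = ∑ s, ∑ T ∈ Finset.powersetCard k (Finset.univ : Finset (Fin N)),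
        ∑ p ∈ J, ∑ t, ∑ S ∈ Finset.powersetCard k Finset.univ,
          ((-(q : ℂ)) ^ (J.filter (· < p)).card * rHatInv q s i (I.erase i) T * rHat q p t T S) •
            (Z q s t * qMinorAux q k S (J.erase p)) := by
          rw [Finset.sum_comm]
          refine Finset.sum_congr rfl fun s _ => ?_
          rw [Finset.sum_comm (s := Finset.powersetCard k Finset.univ)]
          refine Finset.sum_congr rfl fun p _ => ?_
          rw [Finset.sum_comm (s := Finset.powersetCard k Finset.univ)]
          refine Finset.sum_congr rfl fun t _ => ?_
          rw [Finset.sum_comm]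
      _ = ∑ s, (-(q : ℂ)) ^ k • ∑ v : Fin k → Fin N, rInvWord q i s
          (List.ofFn fun j => ((I.erase i).orderEmbOfFin hI' j, v j)) •
            phi (q : ℂ) (Z q) (k + 1) J (s :: (List.ofFn v).reverse) := by
          refine Finset.sum_congr rfl fun s _ => ?_
          rw [Finset.sum_congr rfl (h1 s), ← ((hanti (k + 1) J).cons s).sum_powersetCard hI'
            (rInvWord q i s), Finset.smul_sum]
          refine Finset.sum_congr rfl fun T _ => ?_
          rw [smul_comm]; rfl
      _ = phi (q : ℂ) (Z q) (k + 1) J (desc I) := by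
          -- The part with R̂⁻¹ brings the row `i` to the end of the word and cancels (-q)^k. As `i`
          -- is the smallest row, the resulting word is already decreasing.
          rw [← Finset.smul_sum, (hanti (k + 1) J).sum_rInvWord hq, smul_smul,
            mul_inv_cancel₀ (pow_ne_zero _ (neg_ne_zero.2 hq)), one_smul, ← desc_eq_ofFn hI']
          congr 1
          refine eq_desc (List.pairwise_append.2 ⟨desc_pairwise _, by simp, ?_⟩) ?_
          · intro a ha b hb
            simp only [mem_desc, Finset.mem_erase, List.mem_singleton] at ha hb
            subst hb
            exact lt_of_le_of_ne (I.min'_le a ha.2) (Ne.symm ha.1)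
          · intro x
            simp only [List.mem_append, mem_desc, Finset.mem_erase, List.mem_singleton]
            by_cases hx : x = i
            · simp [hx, hiI]
            · simp [hx]

theorem qMinor_eq_fminor (hq : (q : ℂ) ≠ 0) (hq2 : (q : ℂ) ^ 2 + 1 ≠ 0)
    {I J : Finset (Fin N)} (hIJ : I.card = J.card) :
    qMinor q I J = fminor (q : ℂ) (Z q) I J := by
  rw [qMinor, fminor, qMinorAux_eq hq hq2 _ rfl hIJ.symm, hIJ]

end Link

end REA

namespace REA

/-! ### Entries that q-commute with all entries and all minors. -/

section Weights

variable {ι A : Type*} [LinearOrder ι] [Fintype ι] [Ring A] [Algebra ℂ A] {q : ℂ}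
  {Z : ι → ι → A}

/-- The weight of the index `x` with respect to the entry `(b, d)`. -/
noncomputable def wt (q : ℂ) (b d x : ι) : ℂ := (if x = b then q else 1) * if x = d then q else 1

theorem wt_ne_zero (hq : q ≠ 0) (b d x : ι) : wt q b d x ≠ 0 := by
  unfold wt; split_ifs <;> simp [hq]

/-- An entry which comes first in its row and in its column `q`-commutes with all entries. -/
theorem IsRE.qcomm (hZ : IsRE q Z) (hq : q ≠ 0) {b d : ι} (hd : ∀ x < b, Z x d = 0)
    (hb : ∀ x < d, Z b x = 0) (a c : ι) :
    wt q b d a • (Z a c * Z b d) = wt q b d c • (Z b d * Z a c) := by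
  have E := hZ a b c d
  -- The zeros before the entry `(b, d)` remove the sum over smaller indices from the terms of the
  -- reflection equation at `(a, b, c, d)`.
  have H1 : reY q Z b a c d = (if b = c then q⁻¹ else 1) • (Z a c * Z b d) := by
    rw [reY, Finset.sum_eq_zero, smul_zero, add_zero]
    intro x hx
    rw [hd x (by simpa using hx), mul_zero]
  have H2 : reY q Z a b d c = (if a = d then q⁻¹ else 1) • (Z b d * Z a c) := by
    rw [reY]
    by_cases h : a = d
    · rw [Finset.sum_eq_zero, smul_zero, add_zero]
      intro x hx
      rw [hb x (by simpa [h] using hx), zero_mul]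
    · simp [h]
  have H3 : c < d → reY q Z a b c d = 0 := by
    intro h
    rw [reY, hb c h]
    by_cases hac : a = c
    · rw [Finset.sum_eq_zero]
      · simp
      · intro x hx
        have hx : x < a := by simpa using hx
        rw [hb x (hx.trans (hac ▸ h)), zero_mul]
    · simp [hac]
  have H4 : a < b → reY q Z a b c d = 0 := by
    intro h
    rw [reY, hd a h, Finset.sum_eq_zero]
    · simp
    · intro x hx
      have hx : x < a := by simpa using hx
      rw [hd x (hx.trans h), mul_zero]
  rw [H1, H2] at E
  have R : (if a = b then q else 1) • (if b = c then q⁻¹ else 1) • (Z a c * Z b d) =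
      (if c = d then q else 1) • (if a = d then q⁻¹ else 1) • (Z b d * Z a c) := by
    -- If `b < a` and `d < c`, the (q⁻¹ - q)-terms on both sides cancel; if only one of these holds
    -- and the other order is strictly reversed, `H3` or `H4` removes the term. In the cases with an
    -- equality the term combines with q⁻¹ to q, or both products vanish.
    rcases lt_trichotomy a b with hab | hab | hab <;>
      rcases lt_trichotomy c d with hcd | hcd | hcd
    · simpa [H3 hcd, hab.ne, hcd.ne] using E
    · subst hcd; simp [hd a hab]
    · simpa [H4 hab, hab.ne, hcd.ne'] using E
    · subst hab; simp [hb c hcd]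
    · subst hab; subst hcd; simp [eq_comm]
    · subst hab
      rw [H1] at E
      simp only [lt_irrefl, hcd, hcd.ne', if_true, if_false, zero_smul, add_zero, one_smul] at E ⊢
      rw [sub_smul, ← sub_eq_iff_eq_add] at E
      rw [← E, sub_sub_cancel]
    · simpa [H3 hcd, hab.ne', hcd.ne] using E
    · subst hcd
      rw [H2] at E
      simp only [lt_irrefl, hab, hab.ne', if_true, if_false, zero_smul, add_zero, one_smul] at E ⊢
      rw [sub_smul, ← eq_sub_iff_add_eq] at E
      rw [E, sub_sub_cancel]
    · simp only [hab, hcd, hab.ne', hcd.ne', if_true, if_false, one_smul] at E ⊢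
      exact add_right_cancel E
  have hinv : ∀ (P : Prop) [Decidable P], (if P then q else 1) * (if P then q⁻¹ else 1) = 1 := by
    intro P _; split_ifs <;> simp [hq]
  -- Multiplying by these factors clears the inverse powers and makes the weights symmetric in row
  -- and column.
  have h2 := congrArg (((if b = c then q else 1) * (if a = d then q else 1)) • ·) R
  simp only [smul_smul] at h2
  convert h2 using 2
  · rw [wt]
    linear_combination (-(if a = b then q else 1) * (if a = d then q else 1)) * hinv (b = c)
  · rw [wt]
    simp only [eq_comm (a := c) (b := b)]
    linear_combination (-(if c = d then q else 1) * (if b = c then q else 1)) * hinv (a = d)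

/-- An element which `q`-commutes with the entries of `Z` by weights does so with the minors. -/
theorem fminor_qcomm (hq : q ≠ 0) (hq2 : q ^ 2 + 1 ≠ 0) (hZ : IsRE q Z) {X : A} {f : ι → ℂ}
    (hf : ∀ i, f i ≠ 0) (hX : ∀ a c, f a • (Z a c * X) = f c • (X * Z a c))
    {I J : Finset ι} (hIJ : I.card = J.card) :
    (∏ i ∈ I, f i) • (fminor q Z I J * X) = (∏ j ∈ J, f j) • (X * fminor q Z I J) := by
  induction hk : I.card generalizing I J with
  | zero =>
    have hI0 : I = ∅ := Finset.card_eq_zero.1 hk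
    have hJ0 : J = ∅ := Finset.card_eq_zero.1 (by omega)
    subst hI0; subst hJ0
    simp [fminor_empty]
  | succ k ih =>
    obtain ⟨i, hi⟩ : I.Nonempty := Finset.card_pos.1 (by omega)
    rw [fminor_eq_laplace hq hq2 hZ hIJ hi, laplace]
    simp only [smul_mul_assoc, mul_smul_comm]
    rw [smul_comm, smul_comm (∏ j ∈ J, f j)]
    congr 1
    simp only [Finset.sum_mul, Finset.mul_sum, Finset.smul_sum, smul_mul_assoc, mul_smul_comm]
    refine Finset.sum_congr rfl fun p hp => Finset.sum_congr rfl fun t _ => ?_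
    rw [smul_comm, smul_comm (∏ j ∈ J, f j)]
    congr 1
    have hcard : (I.erase i).card = k := by rw [Finset.card_erase_of_mem hi, hk]; rfl
    have hcardJ : (J.erase p).card = k := by
      rw [Finset.card_erase_of_mem hp, ← hIJ, hk]; rfl
    have hJp : f p * ∏ j ∈ J.erase p, f j = ∏ j ∈ J, f j := Finset.mul_prod_erase J f hp
    have hIi : f i * ∏ j ∈ I.erase i, f j = ∏ j ∈ I, f j := Finset.mul_prod_erase I f hi
    -- A Laplace term exchanges `p` for `t` in the remaining rows, so the weight is balanced: the
    -- product over the remaining rows times `f t` equals the product over `S` times `f p`.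
    have key : ∀ S : Finset ι, S.card = k →
        f t * ∏ j ∈ I.erase i, f j = f p * ∏ j ∈ S, f j →
        (∏ j ∈ I, f j) • (Z i t * fminor q Z S (J.erase p) * X) =
          (∏ j ∈ J, f j) • (X * (Z i t * fminor q Z S (J.erase p))) := by
      intro S hS hw
      have h1 := ih (I := S) (J := J.erase p) (by rw [hS, hcardJ]) hS
      have hne : (∏ j ∈ S, f j) ≠ 0 := Finset.prod_ne_zero_iff.2 fun j _ => hf j
      have h2 : fminor q Z S (J.erase p) * X =
          ((∏ j ∈ S, f j)⁻¹ * ∏ j ∈ J.erase p, f j) • (X * fminor q Z S (J.erase p)) := by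
        rw [mul_smul, ← h1, smul_smul, inv_mul_cancel₀ hne, one_smul]
      have h3 : Z i t * X = ((f i)⁻¹ * f t) • (X * Z i t) := by
        rw [mul_smul, ← hX i t, smul_smul, inv_mul_cancel₀ (hf i), one_smul]
      rw [mul_assoc, h2, mul_smul_comm, ← mul_assoc, h3, smul_mul_assoc, smul_smul, smul_smul,
        mul_assoc X]
      congr 1
      rw [← hIi, ← hJp]
      have := hf i
      field_simp
      linear_combination (∏ j ∈ J.erase p, f j) * hw
    rw [lapTerm]
    split_ifs with h1 h2 h3
    · subst h1
      rw [mul_smul_comm, smul_mul_assoc, mul_smul_comm, smul_comm, smul_comm (∏ j ∈ J, f j),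
        key _ hcard rfl]
    · subst h1
      rw [mul_smul_comm, smul_mul_assoc, mul_smul_comm, smul_comm, smul_comm (∏ j ∈ J, f j),
        key _ hcard rfl]
    · rw [mul_smul_comm, smul_mul_assoc, mul_smul_comm, smul_comm, smul_comm (∏ j ∈ J, f j)]
      rw [key]
      · rw [Finset.card_insert_of_notMem (by simp [h3.2.2]), Finset.card_erase_of_mem h3.2.1,
          hcard]
        have : 0 < (I.erase i).card := Finset.card_pos.2 ⟨p, h3.2.1⟩
        omega
      · rw [Finset.prod_insert (by simp [h3.2.2]), ← Finset.mul_prod_erase _ f h3.2.1]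
        ring
    · simp

end Weights

end REA

namespace REA

/-! ### The Schur complement of the corner satisfies the reflection equation. -/

section Schur

variable {n : ℕ} {A : Type*} [Ring A] [Algebra ℂ A] {q : ℝ}

/-- The braid operator with entries in an algebra. -/
noncomputable def braidMat (A : Type*) [Ring A] [Algebra ℂ A] (q : ℝ) (n : ℕ) :
    Matrix (Fin n × Fin n) (Fin n × Fin n) A := (braid q n).map (algebraMap ℂ A)

/-- The Hecke relation. It makes R - (q⁻¹ - q) the inverse of R, which is how inverses of R are
handled below. -/
theorem braidMat_sq (hq : (q : ℂ) ≠ 0) :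
    braidMat A q n * braidMat A q n = ((q : ℂ)⁻¹ - q) • braidMat A q n + 1 := by
  ext ⟨a, b⟩ ⟨c, d⟩
  have h1 : braidMat A q n = braidMat A q n * 1 := (Matrix.mul_one _).symm
  rw [Matrix.add_apply, Matrix.smul_apply]
  conv_lhs => rw [h1]
  conv_rhs => rw [h1]
  rw [braidMat, Matrix.mul_one, braid_mul_apply, ← Matrix.mul_one ((braid q n).map _),
    braid_mul_apply, braid_mul_apply]
  rcases lt_trichotomy a b with h | h | h
  · simp only [h.ne, h.ne', h, h.not_gt, if_true, if_false]
    module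
  · subst h
    simp only [lt_irrefl, if_true, if_false]
    match_scalars
    field_simp
    ring
  · simp only [h.ne, h.ne', h, h.not_gt, if_true, if_false]
    module

/-- The column `w = (Z i 0)` acting on the second leg. -/
def colLeg (w : Fin n → A) : Matrix (Fin n × Fin n) (Fin n) A :=
  Matrix.of fun x c => if x.1 = c then w x.2 else 0

theorem colLeg_apply (w : Fin n → A) (a b c : Fin n) :
    colLeg w (a, b) c = if a = c then w b else 0 := rfl

/-- A row acting on the second leg. -/
def rowLeg (w : Fin n → A) : Matrix (Fin n) (Fin n × Fin n) A :=
  Matrix.of fun c x => if c = x.1 then w x.2 else 0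

theorem colLeg_mul_apply {κ : Type*} (w : Fin n → A) (M : Matrix (Fin n) κ A) (a b : Fin n)
    (y : κ) : (colLeg w * M) (a, b) y = w b * M a y := by
  simp [Matrix.mul_apply, colLeg]

theorem mul_rowLeg_apply {κ : Type*} (w : Fin n → A) (M : Matrix κ (Fin n) A) (c d : Fin n)
    (y : κ) : (M * rowLeg w) y (c, d) = M y c * w d := by
  simp [Matrix.mul_apply, rowLeg]

theorem rowLeg_mul_apply {κ : Type*} (w : Fin n → A) (M : Matrix (Fin n × Fin n) κ A) (a : Fin n)
    (y : κ) : (rowLeg w * M) a y = ∑ x, w x * M (a, x) y := by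
  simp only [Matrix.mul_apply, rowLeg, Fintype.sum_prod_type, Matrix.of_apply, ite_mul, zero_mul]
  rw [Finset.sum_eq_single a]
  · simp
  · intro c _ hc; simp [Ne.symm hc]
  · simp

theorem mul_colLeg_apply {κ : Type*} (w : Fin n → A) (M : Matrix κ (Fin n × Fin n) A) (c : Fin n)
    (y : κ) : (M * colLeg w) y c = ∑ x, M y (c, x) * w x := by
  simp only [Matrix.mul_apply, colLeg, Fintype.sum_prod_type, Matrix.of_apply, mul_ite, mul_zero]
  rw [Finset.sum_eq_single c]
  · simp
  · intro c _ hc; simp [hc]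
  · simp

/-- The Schur complement of the upper left entry, with `zi` the inverse of that entry. -/
def schur (Z : Fin (n + 1) → Fin (n + 1) → A) (zi : A) (i j : Fin n) : A :=
  Z i.succ j.succ - Z i.succ 0 * zi * Z 0 j.succ

/-- The rank one matrix with entries `w i * g y`. -/
def colOuter {κ : Type*} (w : Fin n → A) (g : κ → A) : Matrix (Fin n) κ A :=
  Matrix.of fun i y => w i * g y

/-- The rank one matrix with entries `g y * w i`. -/
def rowOuter {κ : Type*} (g : κ → A) (w : Fin n → A) : Matrix κ (Fin n) A :=
  Matrix.of fun y i => g y * w i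

/-- The lower right block of a matrix. -/
def lowerBlock (Z : Fin (n + 1) → Fin (n + 1) → A) : Matrix (Fin n) (Fin n) A :=
  Matrix.of fun i j => Z i.succ j.succ

theorem colOuter_apply {κ : Type*} (w : Fin n → A) (g : κ → A) (i : Fin n) (y : κ) :
    colOuter w g i y = w i * g y := rfl

theorem rowOuter_apply {κ : Type*} (g : κ → A) (w : Fin n → A) (i : Fin n) (y : κ) :
    rowOuter g w y i = g y * w i := rfl

theorem lowerBlock_apply (Z : Fin (n + 1) → Fin (n + 1) → A) (i j : Fin n) :
    lowerBlock Z i j = Z i.succ j.succ := rfl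

variable {Z : Fin (n + 1) → Fin (n + 1) → A} {zi : A}

/-- Separates the contribution of the corner index from the sums in `reY`. -/
theorem sum_lt_succ (a : Fin n) (f : Fin (n + 1) → A) :
    ∑ x with x < a.succ, f x = f 0 + ∑ x with x < a, f x.succ := by
  rw [Finset.sum_filter, Finset.sum_filter, Fin.sum_univ_succ]
  simp

/-- No index precedes 0, so the corner satisfies the hypotheses of `IsRE.qcomm` without any
vanishing. -/
theorem corner_comm (hZ : IsRE (q : ℂ) Z) (hq : (q : ℂ) ≠ 0) (a c : Fin (n + 1)) :
    wt (q : ℂ) 0 0 a • (Z a c * Z 0 0) = wt (q : ℂ) 0 0 c • (Z 0 0 * Z a c) :=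
  hZ.qcomm hq (fun x hx => absurd hx (Fin.not_lt_zero x))
    (fun x hx => absurd hx (Fin.not_lt_zero x)) a c

theorem corner_col (hZ : IsRE (q : ℂ) Z) (hq : (q : ℂ) ≠ 0) (i : Fin n) :
    Z i.succ 0 * Z 0 0 = (q : ℂ) ^ 2 • (Z 0 0 * Z i.succ 0) := by
  simpa [wt, Fin.succ_ne_zero, sq] using corner_comm hZ hq i.succ 0

theorem corner_row (hZ : IsRE (q : ℂ) Z) (hq : (q : ℂ) ≠ 0) (i : Fin n) :
    Z 0 0 * Z 0 i.succ = (q : ℂ) ^ 2 • (Z 0 i.succ * Z 0 0) := by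
  simpa [wt, Fin.succ_ne_zero, sq] using (corner_comm hZ hq 0 i.succ).symm

theorem corner_block (hZ : IsRE (q : ℂ) Z) (hq : (q : ℂ) ≠ 0) (i j : Fin n) :
    Z i.succ j.succ * Z 0 0 = Z 0 0 * Z i.succ j.succ := by
  simpa [wt, Fin.succ_ne_zero] using corner_comm hZ hq i.succ j.succ

theorem inv_corner_col (hZ : IsRE (q : ℂ) Z) (hq : (q : ℂ) ≠ 0) (hz : Z 0 0 * zi = 1)
    (hz' : zi * Z 0 0 = 1) (i : Fin n) :
    zi * Z i.succ 0 = (q : ℂ) ^ 2 • (Z i.succ 0 * zi) := by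
  calc zi * Z i.succ 0 = zi * (Z i.succ 0 * Z 0 0) * zi := by rw [mul_assoc, mul_assoc, hz, mul_one]
    _ = _ := by rw [corner_col hZ hq, mul_smul_comm, smul_mul_assoc, ← mul_assoc, hz', one_mul]

theorem inv_corner_row (hZ : IsRE (q : ℂ) Z) (hq : (q : ℂ) ≠ 0) (hz : Z 0 0 * zi = 1)
    (hz' : zi * Z 0 0 = 1) (i : Fin n) :
    Z 0 i.succ * zi = (q : ℂ) ^ 2 • (zi * Z 0 i.succ) := by
  calc Z 0 i.succ * zi = zi * (Z 0 0 * Z 0 i.succ) * zi := by rw [← mul_assoc, hz', one_mul]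
    _ = _ := by
      rw [corner_row hZ hq, mul_smul_comm, smul_mul_assoc, mul_assoc, mul_assoc, hz, mul_one]

theorem inv_corner_block (hZ : IsRE (q : ℂ) Z) (hq : (q : ℂ) ≠ 0) (hz : Z 0 0 * zi = 1)
    (hz' : zi * Z 0 0 = 1) (i j : Fin n) :
    Z i.succ j.succ * zi = zi * Z i.succ j.succ := by
  calc Z i.succ j.succ * zi = zi * (Z 0 0 * Z i.succ j.succ) * zi := by
        rw [← mul_assoc, hz', one_mul]
    _ = _ := by rw [← corner_block hZ hq, mul_assoc, mul_assoc, hz, mul_one]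

/-- The Schur complement commutes with the upper left entry. -/
theorem schur_comm (hZ : IsRE (q : ℂ) Z) (hq : (q : ℂ) ≠ 0) (hz : Z 0 0 * zi = 1)
    (hz' : zi * Z 0 0 = 1) (i j : Fin n) :
    schur Z zi i j * Z 0 0 = Z 0 0 * schur Z zi i j := by
  have h1 : Z i.succ 0 * zi * Z 0 j.succ * Z 0 0 = Z 0 0 * (Z i.succ 0 * zi * Z 0 j.succ) := by
    have e1 : (q : ℂ) ^ 2 • (Z i.succ 0 * zi * Z 0 j.succ * Z 0 0) =
        Z i.succ 0 * Z 0 j.succ := by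
      rw [mul_assoc, ← mul_smul_comm, ← corner_row hZ hq, mul_assoc, ← mul_assoc zi, hz', one_mul]
    have e2 : (q : ℂ) ^ 2 • (Z 0 0 * (Z i.succ 0 * zi * Z 0 j.succ)) =
        Z i.succ 0 * Z 0 j.succ := by
      rw [← mul_assoc, ← mul_assoc, ← smul_mul_assoc, ← smul_mul_assoc, ← corner_col hZ hq,
        mul_assoc (Z i.succ 0), hz, mul_one]
    exact smul_right_injective _ (pow_ne_zero 2 hq) (e1.trans e2.symm)
  rw [schur, sub_mul, mul_sub, corner_block hZ hq, h1]

/-- The reflection equation with both columns equal to 0: the tensor square of the first column is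
an eigenvector of R for q⁻¹. -/
theorem braid_col_col (hZ : IsRE (q : ℂ) Z) {κ : Type*} (g : κ → A) :
    braidMat A q n * (colLeg (fun i => Z i.succ 0) * colOuter (fun i => Z i.succ 0) g) =
      (q : ℂ)⁻¹ • (colLeg (fun i => Z i.succ 0) * colOuter (fun i => Z i.succ 0) g) := by
  ext ⟨a, b⟩ y
  have h := hZ a.succ b.succ 0 0
  simp only [reY, Fin.succ_ne_zero, if_false, if_true, one_smul, zero_smul, add_zero, lt_irrefl,
    Fin.succ_inj, Fin.succ_lt_succ_iff] at h
  rw [Matrix.smul_apply, braidMat, braid_mul_apply]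
  simpa only [colLeg_mul_apply, colOuter, Matrix.of_apply, add_mul, smul_mul_assoc, mul_assoc]
    using congrArg (· * g y) h

/-- The counterpart of `braid_col_col` for the first row, from the reflection equation with both
rows equal to 0. -/
theorem row_row_braid (hZ : IsRE (q : ℂ) Z) {κ : Type*} (g : κ → A) :
    rowOuter g (fun i => Z 0 i.succ) * rowLeg (fun i => Z 0 i.succ) * braidMat A q n =
      (q : ℂ)⁻¹ • (rowOuter g (fun i => Z 0 i.succ) * rowLeg (fun i => Z 0 i.succ)) := by
  ext y ⟨c, d⟩
  have h := (hZ 0 0 c.succ d.succ).symm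
  simp only [reY, (Fin.succ_ne_zero _).symm, if_false, if_true, one_smul, zero_smul, add_zero,
    lt_irrefl, Fin.succ_inj, Fin.succ_lt_succ_iff] at h
  rw [Matrix.smul_apply, braidMat, mul_braid_apply]
  simpa only [mul_rowLeg_apply, rowOuter, Matrix.of_apply, mul_add, mul_smul_comm, mul_assoc]
    using congrArg (g y * ·) h

theorem row_braid_apply {κ : Type*} (w : Fin n → A) (M : Matrix (Fin n × Fin n) κ A) (a : Fin n)
    (y : κ) : (rowLeg w * (braidMat A q n * M)) a y =
      ∑ x, ((if a = x then (q : ℂ)⁻¹ else 1) • (w x * M (x, a) y) +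
        (if x < a then (q : ℂ)⁻¹ - q else 0) • (w x * M (a, x) y)) := by
  rw [rowLeg_mul_apply]
  simp only [braidMat, braid_mul_apply, mul_add, mul_smul_comm]

/-- The relation between the row and the column through the corner. -/
theorem row_braid_col (hZ : IsRE (q : ℂ) Z) :
    rowLeg (fun i => Z 0 i.succ) * (braidMat A q n * colLeg (fun i => Z i.succ 0)) =
      (q : ℂ)⁻¹ • colOuter (fun i => Z i.succ 0) (fun j => Z 0 j.succ) +
        ((q : ℂ)⁻¹ - q) • (Matrix.diagonal (fun _ : Fin n => Z 0 0) *
          lowerBlock Z) -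
        ((q : ℂ)⁻¹ - q) • Matrix.diagonal fun _ : Fin n => Z 0 0 * Z 0 0 := by
  ext i j
  have h := hZ i.succ 0 0 j.succ
  simp only [reY, Fin.succ_ne_zero, (Fin.succ_ne_zero _).symm, if_false, if_true, one_smul,
    zero_smul, add_zero, lt_irrefl, Fin.succ_inj, Fin.succ_lt_succ_iff, Fin.succ_pos,
    Fin.not_lt_zero, Finset.filter_false, Finset.sum_empty, smul_zero, zero_add, sum_lt_succ] at h
  rw [row_braid_apply, Matrix.sub_apply, Matrix.add_apply, Matrix.smul_apply, Matrix.smul_apply,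
    Matrix.smul_apply, Matrix.diagonal_mul, colOuter_apply, lowerBlock_apply, h]
  simp only [colLeg_apply]
  rw [Finset.sum_add_distrib, Finset.sum_eq_single j, Matrix.diagonal_apply]
  · by_cases hij : i = j
    · subst hij
      simp only [if_true, smul_add, Finset.smul_sum, Finset.sum_filter]
      rw [add_sub_assoc, add_sub_cancel_left]
      congr 1
      refine Finset.sum_congr rfl fun x _ => ?_
      split_ifs <;> simp
    · simp [hij]
  · intro x _ hx
    simp [hx]
  · simp

/-- Let `X` be the part of Z₂₃ R Z₂₃ with one column equal to 0. The reflection equation gives (R -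
(q⁻¹ - q)) X as the column times the block, and multiplying by R recovers `X` by the Hecke relation.
The extra summand on the left is the corner's share of the sum in `reY`. -/
theorem block_braid_col (hZ : IsRE (q : ℂ) Z) (hq : (q : ℂ) ≠ 0) :
    secondLeg (fun i j => Z i.succ j.succ) * (braidMat A q n * colLeg (fun i => Z i.succ 0)) +
      ((q : ℂ)⁻¹ - q) • (colLeg (fun i => Z i.succ 0) * Matrix.diagonal fun _ : Fin n => Z 0 0) =
    braidMat A q n * (colLeg (fun i => Z i.succ 0) * lowerBlock Z) := by
  set X : Matrix (Fin n × Fin n) (Fin n) A := Matrix.of fun x c => reY (q : ℂ) Z x.1.succ x.2.succ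
    c.succ 0 with hX
  have h1 : secondLeg (fun i j => Z i.succ j.succ) *
      (braidMat A q n * colLeg (fun i => Z i.succ 0)) +
      ((q : ℂ)⁻¹ - q) • (colLeg (fun i => Z i.succ 0) * Matrix.diagonal fun _ : Fin n => Z 0 0) = X := by
    ext ⟨a, b⟩ c
    rw [Matrix.add_apply, Matrix.smul_apply, colLeg_mul_apply, ← Matrix.mul_assoc,
      mul_colLeg_apply]
    simp only [braidMat, mul_braid_apply, secondLeg, Matrix.kronecker_apply, Matrix.one_apply,
      Matrix.of_apply, ite_mul, one_mul, zero_mul, hX, reY, Fin.succ_inj, sum_lt_succ, add_mul,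
      Finset.sum_add_distrib, smul_mul_assoc]
    rw [Finset.sum_eq_single a]
    · by_cases h : a = c
      · subst h
        simp only [if_true, Matrix.diagonal_apply, smul_add, Finset.smul_sum, Finset.sum_filter,
          ite_smul, smul_ite, smul_zero, zero_smul]
        rw [add_comm (((q : ℂ)⁻¹ - q) • _), add_assoc]
      · simp [h, Ne.symm h]
    · intro x _ hx
      simp [Ne.symm hx]
    · simp
  have h2 : braidMat A q n * X - ((q : ℂ)⁻¹ - q) • X =
      colLeg (fun i => Z i.succ 0) * lowerBlock Z := by
    ext ⟨a, b⟩ c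
    have h := hZ a.succ b.succ c.succ 0
    rw [Matrix.sub_apply, Matrix.smul_apply, colLeg_mul_apply, braidMat, braid_mul_apply]
    simp only [Fin.succ_inj, Fin.succ_lt_succ_iff, Fin.succ_ne_zero, if_false, one_smul,
      Fin.succ_pos, if_true] at h
    simp only [hX, Matrix.of_apply]
    rw [h, add_sub_cancel_right]
    simp [lowerBlock_apply, reY, Fin.succ_ne_zero]
  rw [h1, ← h2, Matrix.mul_sub, ← Matrix.mul_assoc, braidMat_sq hq, Matrix.add_mul, Matrix.one_mul,
    Matrix.smul_mul, Matrix.mul_smul, add_sub_cancel_left]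

/-- The same argument as for `block_braid_col`, with one row equal to 0 and R acting from the right.
-/
theorem row_braid_block (hZ : IsRE (q : ℂ) Z) (hq : (q : ℂ) ≠ 0) :
    rowLeg (fun i => Z 0 i.succ) * braidMat A q n * secondLeg (fun i j => Z i.succ j.succ) +
      ((q : ℂ)⁻¹ - q) • (Matrix.diagonal (fun _ : Fin n => Z 0 0) * rowLeg (fun i => Z 0 i.succ)) =
    lowerBlock Z * rowLeg (fun i => Z 0 i.succ) * braidMat A q n := by
  set X : Matrix (Fin n) (Fin n × Fin n) A := Matrix.of fun a x => reY (q : ℂ) Z a.succ 0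
    x.1.succ x.2.succ with hX
  have h1 : rowLeg (fun i => Z 0 i.succ) * braidMat A q n *
      secondLeg (fun i j => Z i.succ j.succ) +
      ((q : ℂ)⁻¹ - q) • (Matrix.diagonal (fun _ : Fin n => Z 0 0) * rowLeg (fun i => Z 0 i.succ)) = X := by
    ext a ⟨c, d⟩
    rw [Matrix.add_apply, Matrix.smul_apply, mul_rowLeg_apply, Matrix.mul_assoc, row_braid_apply]
    simp only [secondLeg, Matrix.kronecker_apply, Matrix.one_apply,
      Matrix.of_apply, ite_mul, one_mul, zero_mul, hX, reY, Fin.succ_inj, sum_lt_succ,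
      Finset.sum_add_distrib, mul_ite, mul_zero, smul_ite, smul_zero]
    rw [Finset.sum_eq_single c]
    · by_cases h : a = c
      · subst h
        simp only [if_true, Matrix.diagonal_apply, smul_add, Finset.smul_sum, Finset.sum_filter,
          ite_smul, smul_ite, smul_zero, zero_smul]
        rw [add_comm (((q : ℂ)⁻¹ - q) • _), add_assoc]
      · simp [h, Ne.symm h]
    · intro x _ hx
      simp [hx]
    · simp
  have h2 : X * braidMat A q n - ((q : ℂ)⁻¹ - q) • X =
      lowerBlock Z * rowLeg (fun i => Z 0 i.succ) := by
    ext a ⟨c, d⟩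
    have h := (hZ a.succ 0 c.succ d.succ).symm
    rw [Matrix.sub_apply, Matrix.smul_apply, mul_rowLeg_apply, braidMat, mul_braid_apply]
    simp only [Fin.succ_inj, Fin.succ_lt_succ_iff, Fin.succ_ne_zero, if_false, one_smul,
      Fin.succ_pos, if_true] at h
    simp only [hX, Matrix.of_apply]
    rw [h, add_sub_cancel_right]
    simp [lowerBlock_apply, reY, (Fin.succ_ne_zero _).symm]
  rw [h1, ← h2, Matrix.sub_mul, Matrix.mul_assoc, braidMat_sq hq, Matrix.mul_add, Matrix.mul_one,
    Matrix.smul_mul, Matrix.mul_smul, add_sub_cancel_left]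

/-- The second leg of the Schur complement. -/
theorem secondLeg_schur (Z : Fin (n + 1) → Fin (n + 1) → A) (zi : A) :
    secondLeg (schur Z zi) = secondLeg (fun i j => Z i.succ j.succ) -
      colLeg (fun i => Z i.succ 0) * (Matrix.diagonal (fun _ : Fin n => zi) *
        rowLeg (fun i => Z 0 i.succ)) := by
  ext ⟨a, b⟩ ⟨c, d⟩
  rw [Matrix.sub_apply, colLeg_mul_apply, Matrix.diagonal_mul]
  by_cases h : a = c
  · simp [secondLeg, schur, rowLeg, h, mul_assoc]
  · simp [secondLeg, schur, rowLeg, h, mul_assoc]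

theorem inv_mul_row_braid_col (hZ : IsRE (q : ℂ) Z) (hq : (q : ℂ) ≠ 0) (hz : Z 0 0 * zi = 1)
    (hz' : zi * Z 0 0 = 1) :
    Matrix.diagonal (fun _ : Fin n => zi) * (rowLeg (fun i => Z 0 i.succ) *
      (braidMat A q n * colLeg (fun i => Z i.succ 0))) =
      (q : ℂ) • colOuter (fun i => Z i.succ 0) (fun j => zi * Z 0 j.succ) +
        ((q : ℂ)⁻¹ - q) • lowerBlock Z -
        ((q : ℂ)⁻¹ - q) • Matrix.diagonal fun _ : Fin n => Z 0 0 := by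
  rw [row_braid_col hZ, Matrix.mul_sub, Matrix.mul_add, Matrix.mul_smul, Matrix.mul_smul,
    Matrix.mul_smul, ← Matrix.mul_assoc, Matrix.diagonal_mul_diagonal, Matrix.diagonal_mul_diagonal]
  simp only [← mul_assoc, hz', one_mul, Matrix.diagonal_one, Matrix.one_mul]
  congr 2
  ext i j
  rw [Matrix.smul_apply, Matrix.smul_apply, Matrix.diagonal_mul, colOuter_apply, colOuter_apply,
    ← mul_assoc, inv_corner_col hZ hq hz hz', smul_mul_assoc, smul_smul, mul_assoc]
  congr 1
  field_simp

/-- The Schur complement braids with the first column. -/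
theorem schur_braid_col (hZ : IsRE (q : ℂ) Z) (hq : (q : ℂ) ≠ 0) (hz : Z 0 0 * zi = 1)
    (hz' : zi * Z 0 0 = 1) :
    secondLeg (schur Z zi) * (braidMat A q n * colLeg (fun i => Z i.succ 0)) =
      (braidMat A q n - ((q : ℂ)⁻¹ - q) • (1 : Matrix (Fin n × Fin n) (Fin n × Fin n) A)) *
        (colLeg (fun i => Z i.succ 0) * Matrix.of (schur Z zi)) := by
  have h1 : (Matrix.of (schur Z zi) : Matrix (Fin n) (Fin n) A) = lowerBlock Z -
      colOuter (fun i => Z i.succ 0) (fun j => zi * Z 0 j.succ) := by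
    ext i j
    simp [schur, lowerBlock_apply, colOuter_apply, mul_assoc]
  rw [h1, secondLeg_schur, Matrix.sub_mul, Matrix.mul_sub, Matrix.mul_sub, Matrix.sub_mul,
    Matrix.sub_mul, Matrix.smul_mul, Matrix.smul_mul, Matrix.one_mul, Matrix.one_mul,
    Matrix.mul_assoc, Matrix.mul_assoc, inv_mul_row_braid_col hZ hq hz hz', Matrix.mul_sub,
    Matrix.mul_add, Matrix.mul_smul, Matrix.mul_smul, Matrix.mul_smul, braid_col_col hZ,
    ← block_braid_col hZ hq]
  module

/-- The first entry of `schur_braid_col`: on a pair of equal indices R is q⁻¹ and R - (q⁻¹ - q) is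
q. -/
theorem schur_corner_col {Z : Fin (n + 2) → Fin (n + 2) → A} (hZ : IsRE (q : ℂ) Z)
    (hq : (q : ℂ) ≠ 0) (hz : Z 0 0 * zi = 1) (hz' : zi * Z 0 0 = 1) :
    schur Z zi 0 0 * Z 1 0 = (q : ℂ) ^ 2 • (Z 1 0 * schur Z zi 0 0) := by
  have h := congrFun (congrFun (schur_braid_col hZ hq hz hz') (0, 0)) 0
  rw [secondLeg_mul_apply, Matrix.sub_mul, Matrix.sub_apply, Matrix.smul_mul, Matrix.smul_apply,
    Matrix.one_mul, braidMat, braid_mul_apply, colLeg_mul_apply, Finset.sum_eq_single 0,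
    braid_mul_apply] at h
  · simp only [colLeg_apply, if_true, lt_irrefl, if_false, zero_smul, add_zero,
      Matrix.of_apply, Fin.succ_zero_eq_one, ← sub_smul, sub_sub_cancel, mul_smul_comm] at h
    have := congrArg ((q : ℂ) • ·) h
    simpa only [smul_smul, mul_inv_cancel₀ hq, one_smul, ← sq] using this
  · intro x _ hx
    rw [braid_mul_apply]
    simp [colLeg_apply, hx]
  · simp

/-- The Schur complement of the upper left entry satisfies the reflection equation. -/
theorem isRE_schur (hZ : IsRE (q : ℂ) Z) (hq : (q : ℂ) ≠ 0) (hz : Z 0 0 * zi = 1)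
    (hz' : zi * Z 0 0 = 1) : IsRE (q : ℂ) (schur Z zi) := by
  set R := braidMat A q n with hR
  set w := colLeg (fun i : Fin n => Z i.succ 0) with hw
  set r := rowLeg (fun i : Fin n => Z 0 i.succ) with hr
  set B := secondLeg (fun i j : Fin n => Z i.succ j.succ) with hB
  set D := Matrix.diagonal (fun _ : Fin n => Z 0 0) with hD
  set Di := Matrix.diagonal (fun _ : Fin n => zi) with hDi
  set ν : ℂ := (q : ℂ)⁻¹ - q with hν
  set M := w * (Di * (lowerBlock Z * r)) with hM
  set O := colOuter (fun i : Fin n => Z i.succ 0) (fun j : Fin n => zi * Z 0 j.succ) with hO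
  set P := w * (O * (Di * r)) with hP
  set Y := B * (R * B) + ν • (w * r) with hY
  have hBDi : lowerBlock Z * Di = Di * lowerBlock Z := by
    ext i j
    rw [hDi, Matrix.mul_diagonal, Matrix.diagonal_mul]
    exact inv_corner_block hZ hq hz hz' i j
  have hDD : Di * D = 1 := by
    rw [hDi, hD, Matrix.diagonal_mul_diagonal, ← Matrix.diagonal_one]
    simp [hz']
  have hDD' : D * Di = 1 := by
    rw [hDi, hD, Matrix.diagonal_mul_diagonal, ← Matrix.diagonal_one]
    simp [hz]
  -- `Y` is Z₂₃ R Z₂₃ of the large matrix, restricted to nonzero indices; the summand with `w * r`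
  -- comes from the index 0 in the inner sum.
  have hRY : R * Y = Y * R := by
    have hYe : Y = Matrix.of fun x y => reY (q : ℂ) Z x.1.succ x.2.succ y.1.succ y.2.succ := by
      ext ⟨a, b⟩ ⟨c, d⟩
      have e := secondLeg_braid_secondLeg q (fun i j : Fin n => Z i.succ j.succ) a b c d
      rw [hY, Matrix.add_apply, Matrix.smul_apply, ← Matrix.mul_assoc]
      rw [Matrix.of_apply, hw, hr, mul_rowLeg_apply]
      refine (congrArg₂ (· + ·) e rfl).trans ?_
      simp only [reY, Fin.succ_inj, sum_lt_succ, colLeg_apply]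
      split_ifs with h <;> simp [smul_add, ← hν] <;> abel
    ext ⟨a, b⟩ ⟨c, d⟩
    rw [hYe, hR, braidMat, braid_mul_apply, mul_braid_apply]
    have h := hZ a.succ b.succ c.succ d.succ
    simpa only [Fin.succ_inj, Fin.succ_lt_succ_iff, Matrix.of_apply] using h
  have hRR : R * R = ν • R + 1 := braidMat_sq hq
  -- `P` starts with two copies of the first column, on which R acts by q⁻¹.
  have hRP : R * P = (q : ℂ)⁻¹ • P := by
    have e : P = w * colOuter (fun i : Fin n => Z i.succ 0)
        (fun y => ∑ j, (zi * Z 0 j.succ) * (Di * r) j y) := by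
      rw [hP]
      congr 1
      ext i y
      rw [colOuter_apply, Matrix.mul_apply, Finset.mul_sum]
      simp only [hO, colOuter_apply, mul_assoc]
    rw [e]
    exact braid_col_col hZ _
  -- Moving the inverse of the corner to the left costs q² and shows that `P` ends with two copies
  -- of the first row.
  have hPR : P * R = (q : ℂ)⁻¹ • P := by
    have e : P = ((q : ℂ) ^ 2) • (rowOuter (fun y => ∑ i, w y i * (Z i.succ 0 * zi * zi))
        (fun i : Fin n => Z 0 i.succ) * r) := by
      rw [hP, ← Matrix.mul_assoc, ← Matrix.mul_assoc, ← Matrix.smul_mul]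
      congr 1
      ext y j
      rw [Matrix.smul_apply, rowOuter_apply, hDi, Matrix.mul_diagonal, Matrix.mul_apply,
        Finset.sum_mul, Finset.sum_mul, Finset.smul_sum]
      refine Finset.sum_congr rfl fun i _ => ?_
      rw [hO, colOuter_apply, mul_assoc, mul_assoc, mul_assoc zi, inv_corner_row hZ hq hz hz']
      simp only [mul_smul_comm, mul_assoc]
    rw [e, Matrix.smul_mul, row_row_braid hZ, smul_comm]
  -- Here Z₂₃ R Z₂₃ of the Schur complement is expanded; the relations of row, column and block with
  -- R reduce everything to `Y`, `M` and `P`.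
  have hY'' : secondLeg (schur Z zi) * (R * secondLeg (schur Z zi)) =
      Y - M * R - R * M + ν • M + (q : ℂ) • P := by
    have e1 : R * w = R * colLeg (fun i : Fin n => Z i.succ 0) := rfl
    have e2 : Di * (r * (R * w)) = (q : ℂ) • O + ν • lowerBlock Z - ν • D :=
      inv_mul_row_braid_col hZ hq hz hz'
    have e3 : B * (R * w) = R * (w * lowerBlock Z) - ν • (w * D) :=
      eq_sub_of_add_eq (block_braid_col hZ hq)
    have e4 : r * (R * B) = lowerBlock Z * (r * R) - ν • (D * r) := by
      rw [← Matrix.mul_assoc, ← Matrix.mul_assoc]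
      exact eq_sub_of_add_eq (row_braid_block hZ hq)
    rw [secondLeg_schur]
    have e5 : (B - w * (Di * r)) * (R * (B - w * (Di * r))) =
        B * (R * B) - (B * (R * w)) * (Di * r) - w * (Di * (r * (R * B))) +
          w * ((Di * (r * (R * w))) * (Di * r)) := by
      simp only [Matrix.sub_mul, Matrix.mul_sub, Matrix.mul_assoc]
      abel
    rw [e5, e2, e3, e4, hM, hP, hY]
    have e6 : D * (Di * r) = r := by rw [← Matrix.mul_assoc, hDD', Matrix.one_mul]
    have e7 : Di * (D * r) = r := by rw [← Matrix.mul_assoc, hDD, Matrix.one_mul]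
    have e8 : lowerBlock Z * (Di * r) = Di * (lowerBlock Z * r) := by
      rw [← Matrix.mul_assoc, hBDi, Matrix.mul_assoc]
    simp only [Matrix.sub_mul, Matrix.mul_sub, Matrix.add_mul, Matrix.mul_add, Matrix.smul_mul,
      Matrix.mul_smul, Matrix.mul_assoc, e6, e7, e8]
    module
  -- R commutes with `Y` and `P`. It commutes with M R + R M - ν M because, by the Hecke relation,
  -- both products are R M R + M.
  have hcomm : R * (secondLeg (schur Z zi) * (R * secondLeg (schur Z zi))) =
      secondLeg (schur Z zi) * (R * secondLeg (schur Z zi)) * R := by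
    rw [hY'']
    simp only [Matrix.mul_add, Matrix.mul_sub, Matrix.add_mul, Matrix.sub_mul, Matrix.mul_smul,
      Matrix.smul_mul, hRP, hPR, hRY, ← Matrix.mul_assoc, hRR, Matrix.one_mul]
    simp only [Matrix.mul_assoc, hRR, Matrix.mul_add, Matrix.mul_smul, Matrix.mul_one]
    module
  intro a b c d
  have h := congrFun (congrFun hcomm (a, b)) (c, d)
  rw [hR, braidMat, braid_mul_apply, mul_braid_apply, ← Matrix.mul_assoc] at h
  simpa only [secondLeg_braid_secondLeg] using h

end Schur

end REA

namespace REA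

/-! ### Restriction to a block of indices, and factorization of minors. -/

section Transport

variable {ι κ A : Type*} [LinearOrder ι] [LinearOrder κ] [Ring A] [Algebra ℂ A] {q : ℂ}

theorem lapTerm_congr {F G : Finset ι → A} (p t : ι) (T : Finset ι)
    (h : ∀ S : Finset ι, S.card = T.card → F S = G S) : lapTerm q F p t T = lapTerm q G p t T := by
  unfold lapTerm
  split_ifs with h1 h2 h3
  · rw [h T rfl]
  · rw [h T rfl]
  · rw [h]
    rw [Finset.card_insert_of_notMem (by simp [h3.2.2]), Finset.card_erase_of_mem h3.2.1]
    have := Finset.card_pos.2 ⟨p, h3.2.1⟩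
    omega
  · rfl

/-- The braiding is triangular: in an expansion, the column `p` meets only entries in columns `t ≤
p`. Zeros to the left of a column therefore remove whole terms. -/
theorem lapTerm_of_lt (F : Finset ι → A) {p t : ι} (T : Finset ι) (h : p < t) :
    lapTerm q F p t T = 0 := by
  rw [lapTerm, if_neg h.ne', if_neg fun h' => lt_asymm h h'.1]

theorem lapTerm_zero (p t : ι) (T : Finset ι) : lapTerm q (fun _ => (0 : A)) p t T = 0 := by
  simp [lapTerm]

theorem lapTerm_mul_left (x : A) (F : Finset ι → A) (p t : ι) (T : Finset ι) :
    lapTerm q (fun S => x * F S) p t T = x * lapTerm q F p t T := by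
  unfold lapTerm
  split_ifs <;> simp

theorem lapTerm_mul_right (x : A) (F : Finset ι → A) (p t : ι) (T : Finset ι) :
    lapTerm q (fun S => F S * x) p t T = lapTerm q F p t T * x := by
  unfold lapTerm
  split_ifs <;> simp

theorem lapTerm_smul (c : ℂ) (F : Finset ι → A) (p t : ι) (T : Finset ι) :
    lapTerm q (fun S => c • F S) p t T = c • lapTerm q F p t T := by
  unfold lapTerm
  split_ifs <;> simp [smul_comm c]

/-- Rows of `L` do not lie between the exchanged rows, so they are neither exchanged nor counted. -/
theorem lapTerm_map (e : κ ↪o ι) {L : Finset ι} {p t : κ} (hL : ∀ x ∈ L, ¬ (e t < x ∧ x < e p))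
    (hp : e p ∉ L) (ht : e t ∉ L) (F : Finset ι → A) (T : Finset κ) :
    lapTerm q F (e p) (e t) (L ∪ T.map e.toEmbedding) =
      lapTerm q (fun S => F (L ∪ S.map e.toEmbedding)) p t T := by
  have hm : ∀ x : κ, e x ∉ L → (e x ∈ L ∪ T.map e.toEmbedding ↔ x ∈ T) := by
    intro x hx
    simp [hx]
  unfold lapTerm
  simp only [hm p hp, hm t ht, e.lt_iff_lt, e.injective.eq_iff]
  split_ifs with h1 h2 h3
  · rfl
  · rfl
  · congr 2
    · congr 2
      rw [Finset.filter_union, Finset.filter_false_of_mem hL, Finset.empty_union,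
        Finset.filter_map, Finset.card_map]
      congr 1
      ext x
      simp
    · ext x
      simp only [Finset.mem_insert, Finset.mem_erase, Finset.mem_union, Finset.mem_map]
      constructor
      · rintro (rfl | ⟨h, h' | ⟨y, hy, rfl⟩⟩)
        · exact Or.inr ⟨t, Or.inl rfl, rfl⟩
        · exact Or.inl h'
        · exact Or.inr ⟨y, Or.inr ⟨fun h' => h (by rw [h']; rfl), hy⟩, rfl⟩
      · rintro (h | ⟨y, rfl | ⟨hy, hy'⟩, rfl⟩)
        · exact Or.inr ⟨fun h' => hp (h' ▸ h), Or.inl h⟩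
        · exact Or.inl rfl
        · exact Or.inr ⟨fun h => hy (e.injective h), Or.inr ⟨y, hy', rfl⟩⟩
  · rfl

theorem erase_union_map (e : κ ↪o ι) {L : Finset ι} {p : κ} (hp : e p ∉ L) (J : Finset κ) :
    (L ∪ J.map e.toEmbedding).erase (e p) = L ∪ (J.erase p).map e.toEmbedding := by
  rw [Finset.erase_union_distrib, Finset.erase_eq_of_notMem hp, Finset.map_erase]
  rfl

theorem card_union_map (e : κ ↪o ι) {L : Finset ι} (hL : ∀ x, e x ∉ L) (J : Finset κ) :
    (L ∪ J.map e.toEmbedding).card = L.card + J.card := by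
  rw [Finset.card_union_of_disjoint, Finset.card_map]
  rw [Finset.disjoint_left]
  intro x hx hx'
  obtain ⟨y, _, rfl⟩ := Finset.mem_map.1 hx'
  exact hL y hx

variable [Fintype ι] [Fintype κ]

theorem sum_embedding (e : κ ↪o ι) (f : ι → A) (h : ∀ t, t ∉ Set.range e → f t = 0) :
    ∑ t, f t = ∑ t, f (e t) := by
  symm
  refine Finset.sum_of_injOn e e.injective.injOn (by simp) ?_ (by simp)
  intro t _ ht
  exact h t (by simpa using ht)

variable {Z : ι → ι → A}

/-- A matrix satisfying the reflection equation may be restricted to an interval of indices if the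
entries to the left of it vanish. -/
theorem IsRE.restrict (hZ : IsRE q Z) (e : κ ↪o ι)
    (h0 : ∀ s t, t ∉ Set.range e → (∃ p, t < e p) → Z (e s) t = 0) :
    IsRE q fun i j => Z (e i) (e j) := by
  have hY : ∀ a b c d, reY q (fun i j => Z (e i) (e j)) a b c d = reY q Z (e a) (e b) (e c) (e d) := by
    intro a b c d
    have : ∑ x with x < e a, Z (e b) x * Z x (e d) = ∑ x with x < a, Z (e b) (e x) * Z (e x) (e d) := by
      rw [Finset.sum_filter, Finset.sum_filter, sum_embedding e]
      · simp only [e.lt_iff_lt]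
      · intro t ht
        split_ifs with h
        · rw [h0 b t ht ⟨a, h⟩, zero_mul]
        · rfl
    simp only [reY, e.injective.eq_iff, this]
  intro a b c d
  have h := hZ (e a) (e b) (e c) (e d)
  simpa only [hY, e.injective.eq_iff, e.lt_iff_lt] using h

/-- A minor whose block form is triangular factors. -/
theorem fminor_union (hq : q ≠ 0) (hq2 : q ^ 2 + 1 ≠ 0) (hZ : IsRE q Z) (e : κ ↪o ι)
    (h0 : ∀ s t, t ∉ Set.range e → (∃ p, t < e p) → Z (e s) t = 0) {L L' : Finset ι}
    (hL : ∀ x ∈ L, ∀ p, e p < x) (hL' : ∀ x ∈ L', ∀ p, x < e p) (hc : L.card = L'.card)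
    {I J : Finset κ} (hIJ : I.card = J.card) :
    fminor q Z (L ∪ I.map e.toEmbedding) (L' ∪ J.map e.toEmbedding) =
      ((-q) ^ (L.card * I.card))⁻¹ •
        (fminor q (fun i j => Z (e i) (e j)) I J * fminor q Z L L') := by
  have hnq : -q ≠ 0 := neg_ne_zero.2 hq
  have hLe : ∀ x, e x ∉ L := fun x hx => lt_irrefl _ (hL _ hx x)
  have hLe' : ∀ x, e x ∉ L' := fun x hx => lt_irrefl _ (hL' _ hx x)
  obtain ⟨r, hr⟩ : ∃ r, I.card = r := ⟨_, rfl⟩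
  induction r generalizing I J with
  | zero =>
    have hJ : J = ∅ := Finset.card_eq_zero.1 (hIJ ▸ hr)
    have hI : I = ∅ := Finset.card_eq_zero.1 hr
    subst hI hJ
    simp [fminor_empty]
  | succ r ih =>
    obtain ⟨s, hs⟩ : I.Nonempty := Finset.card_pos.1 (by omega)
    have hT : (I.erase s).card = r := by rw [Finset.card_erase_of_mem hs, hr]; rfl
    have hin : ∀ p ∈ J, ∑ t, Z (e s) t * lapTerm q (fun S => fminor q Z S
        ((L' ∪ J.map e.toEmbedding).erase (e p))) (e p) t (L ∪ (I.erase s).map e.toEmbedding) =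
        ((-q) ^ (L.card * r))⁻¹ • ((∑ t, Z (e s) (e t) * lapTerm q (fun S => fminor q
          (fun i j => Z (e i) (e j)) S (J.erase p)) p t (I.erase s)) * fminor q Z L L') := by
      intro p hp
      rw [Finset.sum_mul, Finset.smul_sum]
      refine (sum_embedding e _ fun t ht => ?_).trans (Finset.sum_congr rfl fun t _ => ?_)
      · rcases lt_trichotomy t (e p) with h | h | h
        · rw [h0 s t ht ⟨p, h⟩, zero_mul]
        · exact absurd ⟨p, h.symm⟩ ht
        · rw [lapTerm_of_lt _ _ h, mul_zero]
      · rw [lapTerm_map e (fun x hx h => lt_asymm h.2 (hL x hx p)) (hLe p) (hLe t),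
          erase_union_map e (hLe' p), lapTerm_congr p t (I.erase s) (fun S hS => ih (I := S)
            (J := J.erase p) (by rw [hS, hT, Finset.card_erase_of_mem hp, ← hIJ, hr]; rfl)
            (by rw [hS, hT]))]
        rw [lapTerm_congr (G := fun S => ((-q) ^ (L.card * r))⁻¹ • (fminor q
          (fun i j => Z (e i) (e j)) S (J.erase p) * fminor q Z L L')) p t (I.erase s)
          (fun S hS => by rw [hS, hT]), lapTerm_smul, lapTerm_mul_right, mul_smul_comm, mul_assoc]
    have h1 : laplace q Z (e s) (L ∪ (I.erase s).map e.toEmbedding) (L' ∪ J.map e.toEmbedding) =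
        ((-q) ^ L.card * ((-q) ^ (L.card * r))⁻¹) •
          (laplace q (fun i j => Z (e i) (e j)) s (I.erase s) J * fminor q Z L L') := by
      have hdis : Disjoint L' (J.map e.toEmbedding) := by
        rw [Finset.disjoint_left]
        intro x hx hx'
        obtain ⟨y, _, rfl⟩ := Finset.mem_map.1 hx'
        exact hLe' y hx
      -- Along a row of the block, a column of `L'` meets only columns to the left of the block,
      -- where the entries vanish.
      have hzero : ∀ x ∈ L', (-q) ^ ((L' ∪ J.map e.toEmbedding).filter (· < x)).card •
          ∑ t, Z (e s) t * lapTerm q (fun S => fminor q Z S ((L' ∪ J.map e.toEmbedding).erase x))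
            x t (L ∪ (I.erase s).map e.toEmbedding) = 0 := by
        intro x hx
        rw [Finset.sum_eq_zero, smul_zero]
        intro t _
        rcases le_or_gt t x with h | h
        · rw [h0 s t, zero_mul]
          · rintro ⟨y, rfl⟩
            exact absurd (hL' x hx y) h.not_gt
          · exact ⟨s, h.trans_lt (hL' x hx s)⟩
        · rw [lapTerm_of_lt _ _ h, mul_zero]
      rw [laplace, laplace, Finset.sum_union hdis, Finset.sum_eq_zero hzero, zero_add,
        Finset.sum_map, Finset.sum_mul, Finset.smul_sum]
      refine Finset.sum_congr rfl fun p hp => ?_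
      -- All columns of `L'` precede the block; each adds one factor -q.
      have hcnt : ((L' ∪ J.map e.toEmbedding).filter (· < e p)).card =
          L.card + (J.filter (· < p)).card := by
        rw [hc, ← card_union_map e hLe', Finset.filter_union]
        congr 2
        · exact Finset.filter_true_of_mem fun x hx => hL' x hx p
        · rw [Finset.filter_map]
          congr 1
          ext x
          simp
      rw [RelEmbedding.coe_toEmbedding, hcnt, hin p hp, pow_add, smul_mul_assoc, smul_smul,
        smul_smul]
      congr 1
      ring
    rw [fminor_eq_laplace hq hq2 hZ (s := e s) (by
        rw [card_union_map e hLe, card_union_map e hLe', hc, hIJ]) (by simp [hs]),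
      fminor_eq_laplace hq hq2 (hZ.restrict e h0) hIJ hs, erase_union_map e (hLe s), h1,
      smul_mul_assoc, smul_smul, smul_smul, card_union_map e hLe]
    congr 1
    have hcnt : ((L ∪ I.map e.toEmbedding).filter (e s < ·)).card =
        L.card + (I.filter (s < ·)).card := by
      rw [← card_union_map e hLe, Finset.filter_union]
      congr 2
      · exact Finset.filter_true_of_mem fun x hx => hL x hx s
      · rw [Finset.filter_map]
        congr 1
        ext x
        simp
    rw [hcnt, hr, show L.card + (r + 1) - 1 = L.card + r by omega, Nat.add_sub_cancel, mul_add,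
      mul_one]
    simp only [pow_add]
    field_simp

end Transport

end REA

namespace REA

/-! ### Minors of matrices with many zeros. -/

section Vanishing

variable {ι A : Type*} [LinearOrder ι] [Fintype ι] [Ring A] [Algebra ℂ A] {q : ℂ} {Z : ι → ι → A}

/-- Expansion along a row whose entries vanish to the left of the last column. -/
theorem fminor_last (hq : q ≠ 0) (hq2 : q ^ 2 + 1 ≠ 0) (hZ : IsRE q Z) {I J : Finset ι}
    (hIJ : I.card = J.card) {s p : ι} (hs : s ∈ I) (hp : p ∈ J) (hJ : ∀ x ∈ J, x ≤ p)
    (h0 : ∀ t < p, Z s t = 0) :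
    fminor q Z I J = (((-q) ^ (I.filter (s < ·)).card)⁻¹ * if p ∈ I.erase s then q⁻¹ else 1) •
      (Z s p * fminor q Z (I.erase s) (J.erase p)) := by
  have hnq : -q ≠ 0 := neg_ne_zero.2 hq
  have hcnt : (J.filter (· < p)).card = I.card - 1 := by
    rw [hIJ, ← Finset.card_erase_of_mem hp]
    congr 1
    ext x
    simp only [Finset.mem_filter, Finset.mem_erase]
    exact ⟨fun h => ⟨h.2.ne, h.1⟩, fun h => ⟨h.2, lt_of_le_of_ne (hJ x h.2) h.1⟩⟩
  rw [fminor_eq_laplace hq hq2 hZ hIJ hs, laplace, Finset.sum_eq_single p, hcnt,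
    Finset.sum_eq_single p]
  · rw [lapTerm, if_pos rfl, mul_smul_comm, smul_smul, smul_smul]
    congr 1
    field_simp
  · intro t _ ht
    rcases lt_or_gt_of_ne ht with h | h
    · rw [h0 t h, zero_mul]
    · rw [lapTerm_of_lt _ _ h, mul_zero]
  · simp
  · intro x hx hxp
    rw [Finset.sum_eq_zero, smul_zero]
    intro t _
    rcases le_or_gt t x with h | h
    · rw [h0 t (h.trans_lt (lt_of_le_of_ne (hJ x hx) hxp)), zero_mul]
    · rw [lapTerm_of_lt _ _ h, mul_zero]
  · exact fun h => absurd hp h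

/-- The expansion along the row `s` involves only entries in columns up to some column of `J`. -/
theorem fminor_eq_zero_of_row (hq : q ≠ 0) (hq2 : q ^ 2 + 1 ≠ 0) (hZ : IsRE q Z) {I J : Finset ι}
    (hIJ : I.card = J.card) {s : ι} (hs : s ∈ I) (h0 : ∀ p ∈ J, ∀ t ≤ p, Z s t = 0) :
    fminor q Z I J = 0 := by
  rw [fminor_eq_laplace hq hq2 hZ hIJ hs, laplace, Finset.sum_eq_zero, smul_zero]
  intro p hp
  rw [Finset.sum_eq_zero, smul_zero]
  intro t _
  rcases le_or_gt t p with h | h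
  · rw [h0 p hp t h, zero_mul]
  · rw [lapTerm_of_lt _ _ h, mul_zero]

/-- Expanding, a column `p ≤ x` meets only zero entries, while a column `p > x` leaves `x` among the
remaining columns. One vanishing column would not do, since a column also meets the entries to its
left. -/
theorem fminor_eq_zero_of_col (hq : q ≠ 0) (hq2 : q ^ 2 + 1 ≠ 0) (hZ : IsRE q Z) {x : ι}
    (h0 : ∀ i, ∀ j ≤ x, Z i j = 0) {I J : Finset ι} (hIJ : I.card = J.card) (hx : x ∈ J) :
    fminor q Z I J = 0 := by
  obtain ⟨r, hr⟩ : ∃ r, I.card = r := ⟨_, rfl⟩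
  induction r generalizing I J with
  | zero =>
    rw [hIJ, Finset.card_eq_zero] at hr
    simp [hr] at hx
  | succ r ih =>
    obtain ⟨s, hs⟩ : I.Nonempty := Finset.card_pos.1 (by omega)
    have hT : (I.erase s).card = r := by rw [Finset.card_erase_of_mem hs, hr]; rfl
    rw [fminor_eq_laplace hq hq2 hZ hIJ hs, laplace, Finset.sum_eq_zero, smul_zero]
    intro p hp
    rw [Finset.sum_eq_zero, smul_zero]
    intro t _
    rcases le_or_gt p x with h | h
    · rcases le_or_gt t p with h' | h'
      · rw [h0 s t (h'.trans h), zero_mul]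
      · rw [lapTerm_of_lt _ _ h', mul_zero]
    · rw [lapTerm_congr (G := fun _ => 0) p t (I.erase s) (fun S hS => ?_), lapTerm_zero, mul_zero]
      exact ih (by rw [hS, hT, Finset.card_erase_of_mem hp, ← hIJ, hr]; rfl)
        (Finset.mem_erase.2 ⟨h.ne, hx⟩) (hS.trans hT)

/-- A minor vanishes if its columns contain a set `L` on which only few of its rows are nonzero. -/
theorem fminor_eq_zero_of_card_lt (hq : q ≠ 0) (hq2 : q ^ 2 + 1 ≠ 0) (hZ : IsRE q Z)
    {L : Finset ι} {U : ι → Prop} [DecidablePred U] (hU : ∀ x y, x ≤ y → U x → U y)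
    (h0 : ∀ s, ¬ U s → ∀ x ∈ L, ∀ t ≤ x, Z s t = 0) {I J : Finset ι} (hIJ : I.card = J.card)
    (hL : L ⊆ J) (hc : (I.filter U).card < L.card) : fminor q Z I J = 0 := by
  obtain ⟨r, hr⟩ : ∃ r, I.card = r := ⟨_, rfl⟩
  induction r generalizing I J with
  | zero =>
    have := Finset.card_le_card hL
    omega
  | succ r ih =>
    -- Otherwise I has fewer elements than `L`, which is contained in `J`.
    obtain ⟨s, hs, hsU⟩ : ∃ s ∈ I, ¬ U s := by
      by_contra! h
      rw [Finset.filter_true_of_mem h] at hc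
      have := Finset.card_le_card hL
      omega
    have hT : (I.erase s).card = r := by rw [Finset.card_erase_of_mem hs, hr]; rfl
    have hTU : ((I.erase s).filter U).card < L.card := by
      rw [Finset.filter_erase, Finset.erase_eq_of_notMem (by simp [hsU])]
      exact hc
    rw [fminor_eq_laplace hq hq2 hZ hIJ hs, laplace, Finset.sum_eq_zero, smul_zero]
    intro p hp
    rw [Finset.sum_eq_zero, smul_zero]
    intro t _
    by_cases hst : ∃ x ∈ L, t ≤ x
    · obtain ⟨x, hx, htx⟩ := hst
      rw [h0 s hsU x hx t htx, zero_mul]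
    -- The entry may be nonzero only if `t` is beyond all of `L`; then `p` is not in `L`, and `L`
    -- survives in the smaller minor.
    · rcases le_or_gt t p with h | h
      · have hpL : p ∉ L := fun h' => hst ⟨p, h', h⟩
        have hsub : L ⊆ J.erase p := fun x hx =>
          Finset.mem_erase.2 ⟨fun h' => hpL (h' ▸ hx), hL hx⟩
        have hcard : (J.erase p).card = r := by
          rw [Finset.card_erase_of_mem hp, ← hIJ, hr]; rfl
        rw [lapTerm]
        split_ifs with h1 h2 h3
        · rw [ih (hT.trans hcard.symm) hsub hTU hT, smul_zero, mul_zero]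
        · rw [ih (hT.trans hcard.symm) hsub hTU hT, smul_zero, mul_zero]
        · have hS : (insert t ((I.erase s).erase p)).card = r := by
            rw [Finset.card_insert_of_notMem fun h => h3.2.2 (Finset.mem_of_mem_erase h),
              Finset.card_erase_of_mem h3.2.1, hT]
            have := Finset.card_pos.2 ⟨p, h3.2.1⟩
            omega
          rw [ih (hS.trans hcard.symm) hsub _ hS, smul_zero, mul_zero]
          -- The exchange replaces `p` by the smaller `t`. Since `U` is upward closed, the number of
          -- rows in `U` does not grow.
          refine lt_of_le_of_lt ?_ hTU
          rw [Finset.filter_insert]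
          split_ifs with htU
          · rw [Finset.filter_erase]
            refine (Finset.card_insert_le _ _).trans ?_
            rw [Finset.card_erase_of_mem (Finset.mem_filter.2 ⟨h3.2.1, hU t p h htU⟩)]
            have := Finset.card_pos.2 ⟨p, Finset.mem_filter.2 ⟨h3.2.1, hU t p h htU⟩⟩
            omega
          · exact Finset.card_le_card (Finset.filter_subset_filter _ (Finset.erase_subset _ _))
        · rw [mul_zero]
      · rw [lapTerm_of_lt _ _ h, mul_zero]

end Vanishing

/-! ### Minors containing the corner. -/

section SchurMinor

variable {n : ℕ} {A : Type*} [Ring A] [Algebra ℂ A] {q : ℝ}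
  {Z : Fin (n + 1) → Fin (n + 1) → A} {zi : A}

/-- Minors that contain the corner are minors of the Schur complement. -/
theorem fminor_schur (hq : (q : ℂ) ≠ 0) (hq2 : (q : ℂ) ^ 2 + 1 ≠ 0) (hZ : IsRE (q : ℂ) Z)
    (hz : Z 0 0 * zi = 1) (hz' : zi * Z 0 0 = 1) {I J : Finset (Fin n)} (hIJ : I.card = J.card) :
    fminor (q : ℂ) Z ({0} ∪ I.map (Fin.succOrderEmb n).toEmbedding)
      ({0} ∪ J.map (Fin.succOrderEmb n).toEmbedding) =
      Z 0 0 * fminor (q : ℂ) (schur Z zi) I J := by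
  set e := Fin.succOrderEmb n with he
  have hnq : -(q : ℂ) ≠ 0 := neg_ne_zero.2 hq
  have hes : ∀ x, e x = x.succ := fun x => rfl
  have h0 : ∀ x, e x ∉ ({0} : Finset (Fin (n + 1))) := fun x => by simp [hes, Fin.succ_ne_zero]
  obtain ⟨r, hr⟩ : ∃ r, I.card = r := ⟨_, rfl⟩
  induction r generalizing I J with
  | zero =>
    have hJ : J = ∅ := Finset.card_eq_zero.1 (hIJ ▸ hr)
    have hI : I = ∅ := Finset.card_eq_zero.1 hr
    subst hI hJ
    rw [Finset.map_empty, Finset.union_empty, fminor_last hq hq2 hZ rfl (s := 0) (p := 0)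
      (by simp) (by simp) (by simp) (by simp [Fin.not_lt_zero])]
    simp [fminor_empty, Finset.filter_singleton]
  | succ r ih =>
    obtain ⟨s, hs⟩ : I.Nonempty := Finset.card_pos.1 (by omega)
    have hT : (I.erase s).card = r := by rw [Finset.card_erase_of_mem hs, hr]; rfl
    have hcT := card_union_map e h0 (I.erase s)
    have hcJ := card_union_map e h0 J
    rw [hT, Finset.card_singleton] at hcT
    rw [← hIJ, hr, Finset.card_singleton] at hcJ
    -- An expansion with the row 0 repeated vanishes.
    have hrow : laplace (q : ℂ) Z 0 ({0} ∪ (I.erase s).map e.toEmbedding)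
        ({0} ∪ J.map e.toEmbedding) = 0 := by
      rw [laplace_eq hq hq2 hZ _ _ _ (by omega), if_pos (by simp)]
    have hdis : Disjoint ({0} : Finset (Fin (n + 1))) (J.map e.toEmbedding) := by
      rw [Finset.disjoint_singleton_left, Finset.mem_map]
      rintro ⟨y, _, hy⟩
      exact Fin.succ_ne_zero y hy
    have h1 : laplace (q : ℂ) Z (e s) ({0} ∪ (I.erase s).map e.toEmbedding)
        ({0} ∪ J.map e.toEmbedding) =
        (-(q : ℂ)) • (Z 0 0 * laplace (q : ℂ) (schur Z zi) s (I.erase s) J) := by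
      -- A row operation: subtracting z_{s0} z_{00}⁻¹ times the vanishing expansion replaces the
      -- entries of the row by those of the Schur complement and clears the column 0.
      rw [← sub_zero (laplace _ _ (e s) _ _), ← mul_zero (Z (e s) 0 * zi), ← hrow, laplace, laplace,
        Finset.mul_sum, ← Finset.sum_sub_distrib, Finset.sum_union hdis, Finset.sum_singleton,
        Finset.sum_map]
      have hz0 : ∀ p : Fin (n + 1), ∀ G : Finset (Fin (n + 1)) → A,
          ∑ t, Z (e s) t * lapTerm (q : ℂ) G p t ({0} ∪ (I.erase s).map e.toEmbedding) -
          Z (e s) 0 * zi * ∑ t, Z 0 t *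
            lapTerm (q : ℂ) G p t ({0} ∪ (I.erase s).map e.toEmbedding) =
          ∑ t, schur Z zi s t *
            lapTerm (q : ℂ) G p (e t) ({0} ∪ (I.erase s).map e.toEmbedding) := by
        intro p G
        rw [Finset.mul_sum, ← Finset.sum_sub_distrib, Fin.sum_univ_succ]
        simp only [← mul_assoc, ← sub_mul]
        rw [mul_assoc (Z (e s) 0) zi, hz', mul_one, sub_self, zero_mul, zero_add]
        rfl
      simp only [mul_smul_comm, ← smul_sub, hz0]
      rw [Finset.sum_eq_zero, smul_zero, zero_add, laplace, Finset.mul_sum, Finset.smul_sum]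
      · refine Finset.sum_congr rfl fun p hp => ?_
        have hcnt : (({0} ∪ J.map e.toEmbedding).filter (· < e p)).card =
            1 + (J.filter (· < p)).card := by
          refine Eq.trans ?_ (card_union_map e h0 (J.filter (· < p)))
          have hs0 : ({0} : Finset (Fin (n + 1))).filter (· < e p) = {0} := by
            rw [Finset.filter_singleton, if_pos (show (0 : Fin (n + 1)) < e p from Fin.succ_pos p)]
          rw [Finset.filter_union, hs0]
          congr 2
          · rw [Finset.filter_map]
            congr 1
            ext x
            simp
        rw [RelEmbedding.coe_toEmbedding, hcnt, pow_add, pow_one, mul_smul, mul_smul_comm,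
          Finset.mul_sum]
        congr 2
        refine Finset.sum_congr rfl fun t _ => ?_
        rw [lapTerm_map e (fun x hx h => by
            rw [Finset.mem_singleton.1 hx] at h; exact Fin.not_lt_zero _ h.1) (h0 p) (h0 t),
          erase_union_map e (h0 p), lapTerm_congr p t (I.erase s) (fun S hS => ih (I := S)
            (J := J.erase p) (by rw [hS, hT, Finset.card_erase_of_mem hp, ← hIJ, hr]; rfl)
            (by rw [hS, hT])), lapTerm_mul_left, ← mul_assoc, ← mul_assoc,
          schur_comm hZ hq hz hz']
      · intro t _
        rw [lapTerm_of_lt _ _ (show (0 : Fin (n + 1)) < e t from Fin.succ_pos t), mul_zero]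
    rw [fminor_eq_laplace hq hq2 hZ (s := e s) (by
        rw [card_union_map e h0, card_union_map e h0, hIJ]) (by simp [hs]),
      fminor_eq_laplace hq hq2 (isRE_schur hZ hq hz hz') hIJ hs, erase_union_map e (h0 s), h1,
      smul_smul, card_union_map e h0, mul_smul_comm]
    congr 1
    have hcnt : (({0} ∪ I.map e.toEmbedding).filter (e s < ·)).card =
        (I.filter (s < ·)).card := by
      rw [Finset.filter_union, Finset.filter_false_of_mem, Finset.empty_union, Finset.filter_map,
        Finset.card_map]
      · congr 1
        ext x
        simp
      · intro x hx
        rw [Finset.mem_singleton.1 hx]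
        exact Fin.not_lt_zero _
    rw [hcnt, hr, Finset.card_singleton, show 1 + (r + 1) - 1 = r + 1 by omega, Nat.add_sub_cancel,
      pow_succ]
    field_simp

end SchurMinor

end REA

namespace REA

/-! ### Positive injective operators in finite dimension. -/

section Positive

variable {V : Type*} [NormedAddCommGroup V] [InnerProductSpace ℂ V]

/-- Positive operators with trivial kernel. -/
def PosInj (T : V →L[ℂ] V) : Prop := T.IsPositive ∧ Function.Injective T

open scoped ComplexOrder InnerProductSpace ComplexConjugate

theorem PosInj.one : PosInj (1 : V →L[ℂ] V) :=
  ⟨ContinuousLinearMap.isPositive_one, fun _ _ h => h⟩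

theorem PosInj.eigenvalue_pos {T : V →L[ℂ] V} (hT : PosInj T) {μ : ℂ} {v : V} (hv : v ≠ 0)
    (h : T v = μ • v) : 0 < μ := by
  have h1 : 0 ≤ ⟪v, T v⟫_ℂ := hT.1.inner_nonneg_right v
  rw [h, inner_smul_right] at h1
  have h2 : 0 < ⟪v, v⟫_ℂ := by
    rw [inner_self_eq_norm_sq_to_K]
    have : (0 : ℝ) < ‖v‖ ^ 2 := pow_pos (norm_pos_iff.2 hv) 2
    have h2 : (0 : ℂ) < ((‖v‖ ^ 2 : ℝ) : ℂ) := Complex.zero_lt_real.2 this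
    simpa using h2
  have h3 : μ ≠ 0 := by
    rintro rfl
    rw [zero_smul] at h
    exact hv (hT.2 (h.trans (map_zero T).symm))
  refine lt_of_le_of_ne ?_ h3.symm
  by_contra hneg
  apply hneg
  have := mul_nonneg h1 (inv_nonneg.2 h2.le)
  rwa [mul_assoc, mul_inv_cancel₀ h2.ne', mul_one] at this

theorem PosInj.smul {T : V →L[ℂ] V} (hT : PosInj T) {c : ℂ} (hc : 0 < c) : PosInj (c • T) :=
  ⟨hT.1.smul_of_nonneg hc.le, fun _ _ h => hT.2 (smul_right_injective V hc.ne' h)⟩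

variable [FiniteDimensional ℂ V] [CompleteSpace V]

theorem injective_iff_isUnit {T : V →L[ℂ] V} : Function.Injective T ↔ IsUnit T := by
  rw [ContinuousLinearMap.isUnit_iff_bijective]
  exact ⟨fun h => ⟨h, (LinearMap.injective_iff_surjective (f := (T : V →ₗ[ℂ] V))).1 h⟩,
    fun h => h.1⟩

theorem PosInj.exists_inv {T : V →L[ℂ] V} (hT : PosInj T) : ∃ S, T * S = 1 ∧ S * T = 1 := by
  obtain ⟨u, rfl⟩ := injective_iff_isUnit.1 hT.2
  exact ⟨_, u.mul_inv, u.inv_mul⟩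

theorem exists_eigenvector_of_mem_spectrum {T : V →L[ℂ] V} {μ : ℂ} (h : μ ∈ spectrum ℂ T) :
    ∃ v, v ≠ 0 ∧ T v = μ • v := by
  rw [ContinuousLinearMap.spectrum_eq, ← Module.End.hasEigenvalue_iff_mem_spectrum] at h
  obtain ⟨v, hv⟩ := h.exists_hasEigenvector
  exact ⟨v, hv.2, hv.apply_eq_smul⟩

/-- A normal operator with positive eigenvalues is positive. -/
theorem posInj_of_eigenvalues {T : V →L[ℂ] V} (hT : IsStarNormal T)
    (h : ∀ (μ : ℂ) (v : V), v ≠ 0 → T v = μ • v → 0 < μ) : PosInj T := by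
  refine ⟨?_, ?_⟩
  · rw [← ContinuousLinearMap.nonneg_iff_isPositive]
    have hsa : IsSelfAdjoint T := by
      rw [isSelfAdjoint_iff_isStarNormal_and_quasispectrumRestricts]
      refine ⟨hT, SpectrumRestricts.real_iff.2 fun μ hμ => ?_⟩
      obtain ⟨v, hv, hv'⟩ := exists_eigenvector_of_mem_spectrum hμ
      have := h μ v hv hv'
      exact Complex.ext rfl (Complex.lt_def.1 this).2.symm
    rw [nonneg_iff_isSelfAdjoint_and_quasispectrumRestricts]
    refine ⟨hsa, SpectrumRestricts.nnreal_iff.2 fun r hr => ?_⟩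
    have hr' : (r : ℂ) ∈ spectrum ℂ T := by
      have := hsa.spectrumRestricts.algebraMap_image
      rw [← this]
      exact ⟨r, hr, rfl⟩
    obtain ⟨v, hv, hv'⟩ := exists_eigenvector_of_mem_spectrum hr'
    exact_mod_cast (h _ v hv hv').le
  · intro v w hvw
    by_contra hne
    have := h 0 (v - w) (sub_ne_zero.2 hne) (by rw [map_sub, hvw, sub_self, zero_smul])
    exact lt_irrefl _ this

/-- Positive operators which commute up to a scalar commute, and their product is positive. -/
theorem PosInj.mul {S T : V →L[ℂ] V} (hS : PosInj S) (hT : PosInj T) {c : ℂ}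
    (h : S * T = c • (T * S)) : PosInj (S * T) := by
  rcases subsingleton_or_nontrivial V with hV | hV
  · have : S * T = 1 := by ext v; exact Subsingleton.elim _ _
    rw [this]
    exact PosInj.one
  have hinj : Function.Injective (S * T) := hS.2.comp hT.2
  -- Taking adjoints of the commutation relation gives its inverse with the conjugate scalar.
  have hc : c * conj c = 1 := by
    have h1 : T * S = (conj c) • (S * T) := by
      have := congrArg star h
      rwa [star_smul, star_mul, star_mul, hS.1.isSelfAdjoint.star_eq, hT.1.isSelfAdjoint.star_eq]
        at this
    rw [h1, smul_smul] at h
    by_contra hne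
    have h2 : (c * conj c - 1) • (S * T) = 0 := by rw [sub_smul, ← h, one_smul, sub_self]
    rcases smul_eq_zero.1 h2 with h3 | h3
    · exact hne (sub_eq_zero.1 h3)
    · obtain ⟨v, hv⟩ := exists_ne (0 : V)
      exact hv (hinj (by rw [h3]; rfl))
  have hc0 : c ≠ 0 := left_ne_zero_of_mul_eq_one hc
  obtain ⟨β, hβ⟩ := Module.End.exists_eigenvalue (T : V →ₗ[ℂ] V)
  obtain ⟨v, hv⟩ := hβ.exists_hasEigenvector
  have hTv : T v = β • v := hv.apply_eq_smul
  have hSv : S v ≠ 0 := fun h0 => hv.2 (hS.2 (h0.trans (map_zero S).symm))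
  -- `S` carries an eigenvector of `T` to another one; both eigenvalues are positive, so c is
  -- positive and therefore 1.
  have h1 : T (S v) = (β / c) • S v := by
    have : S (T v) = c • T (S v) := DFunLike.congr_fun h v
    rw [hTv, map_smul] at this
    rw [div_eq_inv_mul, mul_smul, this, smul_smul, inv_mul_cancel₀ hc0, one_smul]
  have h2 := hT.eigenvalue_pos hv.2 hTv
  have h3 := hT.eigenvalue_pos hSv h1
  have h4 : 0 < c := by
    have := mul_pos h2 (inv_pos.2 h3)
    rwa [div_eq_mul_inv, mul_inv, inv_inv, ← mul_assoc, mul_inv_cancel₀ h2.ne', one_mul] at this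
  have h5 : c = 1 := by
    have h6 : conj c = c := Complex.conj_eq_iff_im.2 (Complex.lt_def.1 h4).2.symm
    rw [h6] at hc
    rcases mul_self_eq_one_iff.1 hc with h7 | h7
    · exact h7
    · rw [h7] at h4
      norm_num at h4
  rw [h5, one_smul] at h
  refine ⟨?_, hinj⟩
  rw [← ContinuousLinearMap.nonneg_iff_isPositive]
  exact Commute.mul_nonneg ((ContinuousLinearMap.nonneg_iff_isPositive _).2 hS.1)
    ((ContinuousLinearMap.nonneg_iff_isPositive _).2 hT.1) h

end Positive

end REA

namespace REA

/-! ### The sign of the corner propagates to all leading minors. -/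

section SchurPositive

variable {V : Type*} [NormedAddCommGroup V] [InnerProductSpace ℂ V] [FiniteDimensional ℂ V]
  [CompleteSpace V] {q : ℝ} {n : ℕ}

open scoped ComplexOrder InnerProductSpace ComplexConjugate

/-- The relation between the first column and the first row in terms of the Schur complement. -/
theorem schur_quadratic {A : Type*} [Ring A] [Algebra ℂ A] {Z : Fin (n + 2) → Fin (n + 2) → A}
    {zi : A} (hZ : IsRE (q : ℂ) Z) (hq : (q : ℂ) ≠ 0) (hz : Z 0 0 * zi = 1) :
    (q : ℂ) ^ 2 • (Z 0 1 * Z 1 0) = Z 1 0 * Z 0 1 +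
      ((1 - (q : ℂ) ^ 2) * (q : ℂ) ^ 2) • (Z 0 0 * schur Z zi 0 0 - Z 0 0 * Z 0 0) := by
  have h := congrFun (congrFun (row_braid_col hZ) (0 : Fin (n + 1))) 0
  rw [row_braid_apply, Matrix.sub_apply, Matrix.add_apply, Matrix.smul_apply, Matrix.smul_apply,
    Matrix.smul_apply, Matrix.diagonal_mul, colOuter_apply, lowerBlock_apply,
    Matrix.diagonal_apply_eq, Finset.sum_eq_single 0] at h
  · simp only [colLeg_apply, if_true, lt_irrefl, if_false, zero_smul, add_zero,
      Fin.succ_zero_eq_one] at h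
    have h2 : Z 0 0 * Z 1 1 = Z 0 0 * schur Z zi 0 0 + ((q : ℂ) ^ 2)⁻¹ • (Z 1 0 * Z 0 1) := by
      have h3 : (q : ℂ) ^ 2 • (Z 0 0 * (Z 1 0 * zi * Z 0 1)) = Z 1 0 * Z 0 1 := by
        have := corner_col hZ hq 0
        rw [Fin.succ_zero_eq_one] at this
        rw [← mul_assoc, ← mul_assoc, ← smul_mul_assoc, ← smul_mul_assoc, ← this,
          mul_assoc (Z 1 0), hz, mul_one]
      rw [schur, Fin.succ_zero_eq_one, mul_sub, ← h3, smul_smul,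
        inv_mul_cancel₀ (pow_ne_zero 2 hq), one_smul, sub_add_cancel]
    rw [h2] at h
    have h3 := congrArg ((q : ℂ) ^ 3 • ·) h
    simp only [smul_add, smul_sub, smul_smul] at h3
    have e1 : (q : ℂ) ^ 3 * (q : ℂ)⁻¹ = (q : ℂ) ^ 2 := by field_simp
    have e2 : (q : ℂ) ^ 3 * ((q : ℂ)⁻¹ - q) = (1 - (q : ℂ) ^ 2) * (q : ℂ) ^ 2 := by
      field_simp
    have e3 : (1 - (q : ℂ) ^ 2) * (q : ℂ) ^ 2 * ((q : ℂ) ^ 2)⁻¹ = 1 - (q : ℂ) ^ 2 := by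
      field_simp
    rw [← mul_assoc, e1, e2, e3] at h3
    rw [h3]
    module
  · intro x _ hx
    simp [colLeg_apply, hx, Fin.not_lt_zero]
  · simp

/-- Let z be the corner and y the corner of the Schur complement. The self-adjoint product z y
commutes with z and z_01, so both act on each of its eigenspaces. There z is invertible and z z_01 =
q² z_01 z; comparing determinants, z_01 has a kernel vector ξ. At ξ the relation `schur_quadratic`
expresses the eigenvalue μ by squares: μ‖ξ‖² = ‖zξ‖² + ‖z_10 ξ‖²/(1 - q²) > 0. Hence z y is positive
and y has the sign of z. -/
theorem posInj_schur (hq0 : 0 < q) (hq1 : q < 1) {Z : Fin (n + 2) → Fin (n + 2) → V →L[ℂ] V}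
    {zi : V →L[ℂ] V} (hZ : IsRE (q : ℂ) Z) (hs : ∀ i j, star (Z i j) = Z j i) {ε : ℝ} (hε : ε ≠ 0)
    (hP : PosInj ((ε : ℂ) • Z 0 0)) (hz : Z 0 0 * zi = 1) (hz' : zi * Z 0 0 = 1) :
    PosInj ((ε : ℂ) • schur Z zi 0 0) := by
  have hq : (q : ℂ) ≠ 0 := by exact_mod_cast hq0.ne'
  have hzs : star zi = zi := by
    have h1 : star zi * Z 0 0 = 1 := by
      have := congrArg star hz
      rwa [star_mul, hs, star_one] at this
    calc star zi = star zi * (Z 0 0 * zi) := by rw [hz, mul_one]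
      _ = zi := by rw [← mul_assoc, h1, one_mul]
  have hys : star (schur Z zi 0 0) = schur Z zi 0 0 := by
    rw [schur, star_sub, star_mul, star_mul, hs, hs, hs, hzs, mul_assoc]
  have hyz := schur_comm hZ hq hz hz' 0 0
  set y := schur Z zi 0 0 with hy
  set z := Z 0 0 with hzd
  have hxs : star (z * y) = z * y := by rw [star_mul, hys, hs, hyz]
  have hxw : (z * y) * Z 1 0 = Z 1 0 * (z * y) := by
    have h1 := corner_col hZ hq 0
    rw [Fin.succ_zero_eq_one] at h1
    rw [mul_assoc, schur_corner_col hZ hq hz hz', mul_smul_comm, ← mul_assoc, ← smul_mul_assoc,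
      ← h1, mul_assoc]
  have hxw' : (z * y) * Z 0 1 = Z 0 1 * (z * y) := by
    have := congrArg star hxw
    rw [star_mul, star_mul (Z 1 0), hxs, hs] at this
    exact this.symm
  have hzw : z * Z 0 1 = (q : ℂ) ^ 2 • (Z 0 1 * z) := by
    have := corner_row hZ hq 0
    rwa [Fin.succ_zero_eq_one] at this
  have hxz : (z * y) * z = z * (z * y) := by rw [mul_assoc, hyz]
  have hzinj : Function.Injective z := fun v w h => by
    have := congrArg zi h
    have e : ∀ v, zi (z v) = v := fun v => DFunLike.congr_fun hz' v
    rwa [e, e] at this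
  have hx : PosInj (z * y) := by
    refine posInj_of_eigenvalues (IsSelfAdjoint.isStarNormal hxs) fun μ v hv hμ => ?_
    obtain ⟨ξ, hξ, hξμ, hξ0⟩ : ∃ ξ, ξ ≠ 0 ∧ (z * y) ξ = μ • ξ ∧ Z 0 1 ξ = 0 := by
      by_contra! hno
      set E := Module.End.eigenspace ((z * y : V →L[ℂ] V) : V →ₗ[ℂ] V) μ with hE
      have hmem : ∀ ξ, ξ ∈ E ↔ (z * y) ξ = μ • ξ := fun ξ => Module.End.mem_eigenspace_iff
      have hEz : ∀ ξ ∈ E, (z : V →ₗ[ℂ] V) ξ ∈ E := by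
        intro ξ h
        rw [hmem] at h ⊢
        have : (z * y) (z ξ) = z ((z * y) ξ) := DFunLike.congr_fun hxz ξ
        exact this.trans (by rw [h, map_smul]; rfl)
      have hEw : ∀ ξ ∈ E, (Z 0 1 : V →ₗ[ℂ] V) ξ ∈ E := by
        intro ξ h
        rw [hmem] at h ⊢
        have : (z * y) (Z 0 1 ξ) = Z 0 1 ((z * y) ξ) := DFunLike.congr_fun hxw' ξ
        exact this.trans (by rw [h, map_smul]; rfl)
      set zE := (z : V →ₗ[ℂ] V).restrict hEz
      set wE := (Z 0 1 : V →ₗ[ℂ] V).restrict hEw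
      have hcomm : zE * wE = (q : ℂ) ^ 2 • (wE * zE) := by
        ext ξ
        exact DFunLike.congr_fun hzw ξ.1
      have hzE : LinearMap.det zE ≠ 0 := by
        rw [← isUnit_iff_ne_zero, ← LinearMap.isUnit_iff_isUnit_det, LinearMap.isUnit_iff_ker_eq_bot, LinearMap.ker_eq_bot]
        intro a b h
        exact Subtype.ext (hzinj (congrArg Subtype.val h))
      have hwE : LinearMap.det wE ≠ 0 := by
        rw [← isUnit_iff_ne_zero, ← LinearMap.isUnit_iff_isUnit_det, LinearMap.isUnit_iff_ker_eq_bot, LinearMap.ker_eq_bot']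
        intro a h
        by_contra hne
        exact hno a.1 (fun h0 => hne (Subtype.ext h0)) ((hmem _).1 a.2) (congrArg Subtype.val h)
      have hdet := congrArg LinearMap.det hcomm
      -- If both determinants were nonzero, q to twice the dimension of the eigenspace would be 1,
      -- contradicting 0 < q < 1.
      rw [LinearMap.det_smul, map_mul, map_mul, mul_comm (LinearMap.det wE), ← pow_mul] at hdet
      have hone := mul_right_cancel₀ (mul_ne_zero hzE hwE) ((one_mul _).trans hdet)
      have hd : Module.finrank ℂ E ≠ 0 := by
        have : Nontrivial E := ⟨⟨⟨v, (hmem v).2 hμ⟩, 0, fun h => hv (congrArg Subtype.val h)⟩⟩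
        exact Module.finrank_pos.ne'
      have hlt : q ^ (2 * Module.finrank ℂ E) < 1 := pow_lt_one₀ hq0.le hq1 (by omega)
      have hone' : (1 : ℝ) = q ^ (2 * Module.finrank ℂ E) := by exact_mod_cast hone
      linarith
    have hquad := DFunLike.congr_fun (schur_quadratic hZ hq hz) ξ
    have hq2 : (q : ℂ) ^ 2 • (Z 0 1 (Z 1 0 ξ)) = Z 1 0 (Z 0 1 ξ) +
        ((1 - (q : ℂ) ^ 2) * (q : ℂ) ^ 2) • ((z * y) ξ - z (z ξ)) := hquad
    rw [hξ0, map_zero, zero_add, hξμ] at hq2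
    have hin := congrArg (fun v => ⟪ξ, v⟫_ℂ) hq2
    simp only [inner_smul_right, inner_sub_right] at hin
    have e1 : ⟪ξ, Z 0 1 (Z 1 0 ξ)⟫_ℂ = ((‖Z 1 0 ξ‖ ^ 2 : ℝ) : ℂ) := by
      rw [← hs 1 0, ContinuousLinearMap.star_eq_adjoint, ContinuousLinearMap.adjoint_inner_right,
        inner_self_eq_norm_sq_to_K]
      simp
    have e2 : ⟪ξ, z (z ξ)⟫_ℂ = ((‖z ξ‖ ^ 2 : ℝ) : ℂ) := by
      conv_lhs => rw [hzd, ← hs 0 0, ContinuousLinearMap.star_eq_adjoint]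
      rw [ContinuousLinearMap.adjoint_inner_right, ← ContinuousLinearMap.star_eq_adjoint, hs,
        inner_self_eq_norm_sq_to_K]
      simp [hzd]
    have e3 : ⟪ξ, ξ⟫_ℂ = ((‖ξ‖ ^ 2 : ℝ) : ℂ) := by
      rw [inner_self_eq_norm_sq_to_K]
      simp
    rw [e1, e2, e3] at hin
    have h1 : (0 : ℝ) < ‖ξ‖ ^ 2 := pow_pos (norm_pos_iff.2 hξ) 2
    have h2 : (0 : ℝ) < ‖z ξ‖ ^ 2 := pow_pos (norm_pos_iff.2 fun h0 =>
      hξ (hzinj (h0.trans (map_zero z).symm))) 2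
    have h3 : 0 < 1 - q ^ 2 := by nlinarith
    have h4 : μ = (((‖z ξ‖ ^ 2 + ‖Z 1 0 ξ‖ ^ 2 / (1 - q ^ 2)) / ‖ξ‖ ^ 2 : ℝ) : ℂ) := by
      have h1' : ((‖ξ‖ : ℝ) : ℂ) ≠ 0 := by exact_mod_cast (norm_pos_iff.2 hξ).ne'
      have h3' : (1 - (q : ℂ) ^ 2) ≠ 0 := by exact_mod_cast h3.ne'
      push_cast at hin ⊢
      field_simp
      have := mul_left_cancel₀ (pow_ne_zero 2 hq) (hin.trans (show _ = (q : ℂ) ^ 2 *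
        ((1 - (q : ℂ) ^ 2) * (μ * (‖ξ‖ : ℂ) ^ 2 - (‖z ξ‖ : ℂ) ^ 2)) by ring))
      rw [this]
      ring
    rw [h4, Complex.zero_lt_real]
    positivity
  -- The inverse has the same sign, as it is the conjugate of ε z by the self-adjoint `zi`.
  have hzi : PosInj ((ε : ℂ) • zi) := by
    have h1 := hP.1.conj_adjoint zi
    have h2 : zi * ((ε : ℂ) • z) * star zi = (ε : ℂ) • zi := by
      rw [hzs, mul_smul_comm, smul_mul_assoc, hz', one_mul]
    refine ⟨?_, ?_⟩
    · rw [← h2, mul_assoc]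
      exact h1
    · intro v w h
      have h3 : zi v = zi w := smul_right_injective V (Complex.ofReal_ne_zero.2 hε) h
      have := congrArg z h3
      have e : ∀ v, z (zi v) = v := fun v => DFunLike.congr_fun hz v
      rwa [e, e] at this
  have hfin : (ε : ℂ) • y = ((ε : ℂ) • zi) * (z * y) := by
    rw [smul_mul_assoc, ← mul_assoc, hz', one_mul]
  have hyzi : y * zi = zi * y := by
    calc y * zi = zi * (z * y) * zi := by rw [← mul_assoc, hz', one_mul]
      _ = zi * y := by rw [← hyz, mul_assoc, mul_assoc, hz, mul_one]
  rw [hfin]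
  refine hzi.mul hx (c := 1) ?_
  rw [one_smul, ← hfin, mul_smul_comm, mul_assoc, hyzi, ← mul_assoc, hz, one_mul]

theorem initialSet_succ (n r : ℕ) : initialSet (n + 1) (r + 1) =
    {0} ∪ (initialSet n r).map (Fin.succOrderEmb n).toEmbedding := by
  ext x
  refine Fin.cases ?_ (fun i => ?_) x
  · simp [initialSet]
  · simp [initialSet, Fin.succ_ne_zero]

theorem star_schur {m : ℕ} {Z : Fin (m + 1) → Fin (m + 1) → V →L[ℂ] V} {zi : V →L[ℂ] V}
    (hs : ∀ i j, star (Z i j) = Z j i) (hz : Z 0 0 * zi = 1) (i j : Fin m) :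
    star (schur Z zi i j) = schur Z zi j i := by
  have hzs : star zi = zi := by
    have h1 : star zi * Z 0 0 = 1 := by
      have := congrArg star hz
      rwa [star_mul, hs, star_one] at this
    calc star zi = star zi * (Z 0 0 * zi) := by rw [hz, mul_one]
      _ = zi := by rw [← mul_assoc, h1, one_mul]
  rw [schur, schur, star_sub, star_mul, star_mul, hs, hs, hs, hzs, mul_assoc]

/-- If the upper left entry is definite, then the signs of all leading minors are determined. -/
theorem posInj_leading (hq0 : 0 < q) (hq1 : q < 1) {ε : ℝ} (hε : ε ≠ 0) (m : ℕ)
    {Z : Fin m → Fin m → V →L[ℂ] V} (hZ : IsRE (q : ℂ) Z) (hs : ∀ i j, star (Z i j) = Z j i)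
    (hP : ∀ h : 0 < m, PosInj ((ε : ℂ) • Z ⟨0, h⟩ ⟨0, h⟩)) (r : ℕ) (hr : r ≤ m) :
    PosInj ((ε : ℂ) ^ r • fminor (q : ℂ) Z (initialSet m r) (initialSet m r)) := by
  have hq : (q : ℂ) ≠ 0 := by exact_mod_cast hq0.ne'
  have hq2 : (q : ℂ) ^ 2 + 1 ≠ 0 := by exact_mod_cast (by positivity : q ^ 2 + 1 ≠ 0)
  have hεc : (ε : ℂ) ≠ 0 := Complex.ofReal_ne_zero.2 hε
  induction m generalizing r with
  | zero =>
    obtain rfl : r = 0 := by omega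
    have : initialSet 0 0 = ∅ := by ext x; exact x.elim0
    rw [this, fminor_empty, if_pos rfl, pow_zero, one_smul]
    exact PosInj.one
  | succ m ih =>
    cases r with
    | zero =>
      have : initialSet (m + 1) 0 = ∅ := by ext x; simp [initialSet]
      rw [this, fminor_empty, if_pos rfl, pow_zero, one_smul]
      exact PosInj.one
    | succ r =>
      have hP0 := hP (Nat.succ_pos m)
      change PosInj ((ε : ℂ) • Z 0 0) at hP0
      obtain ⟨S, hS, hS'⟩ := hP0.exists_inv
      set zi := (ε : ℂ) • S with hzi
      have hz : Z 0 0 * zi = 1 := by rw [hzi, mul_smul_comm, ← smul_mul_assoc, hS]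
      have hz' : zi * Z 0 0 = 1 := by rw [hzi, smul_mul_assoc, ← mul_smul_comm, hS']
      have hRE := isRE_schur hZ hq hz hz'
      -- The Schur complement meets all hypotheses of the statement in size m, with the same ε by
      -- `posInj_schur`.
      have h1 := ih hRE (star_schur hs hz) (fun h => by
        obtain ⟨k, rfl⟩ := Nat.exists_eq_succ_of_ne_zero h.ne'
        exact posInj_schur hq0 hq1 hZ hs hε hP0 hz hz') r (by omega)
      rw [initialSet_succ, fminor_schur hq hq2 hZ hz hz' rfl, pow_succ']
      have h2 : ((ε : ℂ) * (ε : ℂ) ^ r) • (Z 0 0 * fminor (q : ℂ) (schur Z zi) (initialSet m r)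
          (initialSet m r)) = ((ε : ℂ) • Z 0 0) * ((ε : ℂ) ^ r • fminor (q : ℂ) (schur Z zi)
          (initialSet m r) (initialSet m r)) := by
        rw [smul_mul_smul_comm]
      rw [h2]
      refine hP0.mul h1 (c := 1) ?_
      -- The corner commutes with the entries of the Schur complement, hence, with all weights 1,
      -- with their minors.
      have h3 := fminor_qcomm hq hq2 hRE (f := fun _ => 1) (X := Z 0 0) (fun _ => one_ne_zero)
        (fun a c => by rw [schur_comm hZ hq hz hz']) (I := initialSet m r) (J := initialSet m r) rfl
      simp only [Finset.prod_const_one, one_smul] at h3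
      rw [one_smul, smul_mul_smul_comm, smul_mul_smul_comm, h3, mul_comm]

end SchurPositive

end REA

namespace REA

/-! ### Trace relations and the arc pattern of zeros. -/

section Trace

variable {V : Type*} [NormedAddCommGroup V] [InnerProductSpace ℂ V] [FiniteDimensional ℂ V]
  [CompleteSpace V]

open scoped ComplexOrder InnerProductSpace ComplexConjugate

/-- The trace of a continuous operator. -/
noncomputable def opTrace (V : Type*) [NormedAddCommGroup V] [InnerProductSpace ℂ V] :
    (V →L[ℂ] V) →ₗ[ℂ] ℂ := LinearMap.trace ℂ V ∘ₗ ContinuousLinearMap.coeLM ℂ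

theorem opTrace_mul_comm (X Y : V →L[ℂ] V) : opTrace V (X * Y) = opTrace V (Y * X) :=
  LinearMap.trace_mul_comm ℂ (X : V →ₗ[ℂ] V) Y

/-- The squared Hilbert–Schmidt norm. Since z_xa = z_ax*, the sums in the trace relation are sums of
such squares. -/
theorem opTrace_mul_star (X : V →L[ℂ] V) : opTrace V (X * star X) =
    ((∑ i, ‖star X (stdOrthonormalBasis ℂ V i)‖ ^ 2 : ℝ) : ℂ) := by
  refine (LinearMap.trace_eq_sum_inner _ (stdOrthonormalBasis ℂ V)).trans ?_
  push_cast
  refine Finset.sum_congr rfl fun i _ => ?_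
  have : ⟪stdOrthonormalBasis ℂ V i, X (star X (stdOrthonormalBasis ℂ V i))⟫_ℂ =
      (‖star X (stdOrthonormalBasis ℂ V i)‖ : ℂ) ^ 2 := by
    rw [ContinuousLinearMap.star_eq_adjoint, ← ContinuousLinearMap.adjoint_inner_left,
      inner_self_eq_norm_sq_to_K]
    rfl
  exact this

theorem opTrace_mul_star_nonneg (X : V →L[ℂ] V) : 0 ≤ opTrace V (X * star X) := by
  rw [opTrace_mul_star]
  exact Complex.zero_le_real.2 (Finset.sum_nonneg fun i _ => sq_nonneg _)

theorem opTrace_mul_star_eq_zero {X : V →L[ℂ] V} : opTrace V (X * star X) = 0 ↔ X = 0 := by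
  refine ⟨fun h => ?_, fun h => by rw [h, zero_mul, map_zero]⟩
  rw [opTrace_mul_star, Complex.ofReal_eq_zero,
    Finset.sum_eq_zero_iff_of_nonneg fun i _ => sq_nonneg _] at h
  have h1 : (star X : V →L[ℂ] V) = 0 := by
    ext v
    have : (star X : V →L[ℂ] V).toLinearMap = 0 := by
      refine (stdOrthonormalBasis ℂ V).toBasis.ext fun i => ?_
      simpa using h i (Finset.mem_univ i)
    exact LinearMap.congr_fun this v
  rw [← star_star X, h1, star_zero]

variable {N : ℕ} {q : ℝ} {z : Fin N → Fin N → V →L[ℂ] V}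

/-- The reflection equation at `(a, b, b, a)`: under the trace the terms q⁻¹ z_ab z_ba and q⁻¹ z_ba
z_ab cancel, and the rest carries the common factor q⁻¹ - q, which is nonzero. -/
theorem opTrace_relation (hq0 : 0 < q) (hq1 : q < 1) (hZ : IsRE (q : ℂ) z) {a b : Fin N}
    (hba : b < a) :
    ∑ x with x < b, opTrace V (z a x * z x a) + opTrace V (z b b * z a a) =
      ∑ x with x < a, opTrace V (z b x * z x b) := by
  have h := congrArg (opTrace V) (hZ a b b a)
  simp only [reY, hba, hba.ne, hba.ne', hba.not_gt, if_true, if_false, one_smul, zero_smul,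
    add_zero, map_add, map_smul, map_sum, opTrace_mul_comm (z a b)] at h
  have hν : (q : ℂ)⁻¹ - q ≠ 0 := by
    have : q⁻¹ - q ≠ 0 := by
      have := one_lt_inv₀ hq0 |>.2 hq1
      linarith
    exact_mod_cast this
  rw [add_assoc, add_left_cancel_iff, ← smul_add] at h
  exact smul_right_injective _ hν h

/-- The entries vanish above the antidiagonal of the block starting at `m`, in the rows and columns
before `m + l`. -/
def ArcPattern {A : Type*} [Zero A] {N : ℕ} (z : Fin N → Fin N → A) (m l : ℕ) : Prop :=
  ∀ i j : Fin N, (i.val < m + l ∨ j.val < m + l) → i.val + j.val + 1 < N + m → z i j = 0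

/-- In the trace relation between `b` and the last index N - 1 - l of the block, the left side
vanishes: the row of that index has zeros before `b`, and z_bb = 0. The right side is the sum of the
squared norms of z_bx with x before that index. -/
theorem arcPattern_succ (hq0 : 0 < q) (hq1 : q < 1) (hZ : IsRE (q : ℂ) z)
    (hs : ∀ i j, star (z i j) = z j i) {m l : ℕ} (hN : m + 2 * l < N) (hp : ArcPattern z m l)
    {b : Fin N} (hb : b.val = m + l) (hbb : z b b = 0) : ArcPattern z m (l + 1) := by
  have hrow : ∀ x : Fin N, b.val + x.val + 1 < N + m → z b x = 0 := by
    intro x hx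
    by_cases hxl : x.val < m + l
    · exact hp _ _ (Or.inr hxl) hx
    have hab : b < (⟨N - 1 - l, by omega⟩ : Fin N) := by
      rw [Fin.lt_def]
      change b.val < N - 1 - l
      by_contra hlt
      omega
    have h := opTrace_relation hq0 hq1 hZ hab
    rw [hbb, zero_mul, map_zero, add_zero, Finset.sum_eq_zero] at h
    · have h2 := (Finset.sum_eq_zero_iff_of_nonneg (fun x _ => by
        rw [← hs b x]; exact opTrace_mul_star_nonneg _)).1 h.symm x (by
          simp only [Finset.mem_filter, Finset.mem_univ, true_and, Fin.lt_def]
          omega)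
      rw [← hs b x, opTrace_mul_star_eq_zero] at h2
      exact h2
    · intro y hy
      simp only [Finset.mem_filter, Finset.mem_univ, true_and, Fin.lt_def] at hy
      rw [hp ⟨N - 1 - l, by omega⟩ y (Or.inr (by omega)) (by
        change N - 1 - l + y.val + 1 < N + m; omega), zero_mul, map_zero]
  intro i j hij hlt
  by_cases h1 : i.val < m + l ∨ j.val < m + l
  · exact hp i j h1 hlt
  · rcases hij with h2 | h2
    · obtain rfl : i = b := Fin.ext (by omega)
      exact hrow j hlt
    · obtain rfl : j = b := Fin.ext (by omega)
      rw [← hs, hrow i (by omega), star_zero]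

/-- The first entry that is allowed to be nonzero by the extended pattern is nonzero. -/
theorem arc_ne_zero (hq0 : 0 < q) (hq1 : q < 1) (hZ : IsRE (q : ℂ) z)
    (hs : ∀ i j, star (z i j) = z j i) {m l : ℕ} (hN : m + 2 * l < N)
    (hp : ArcPattern z m (l + 1)) {b c : Fin N} (hb : b.val = m + l) (hc : c.val = N - 1 - l)
    (h0 : l = 0 → ∃ x, z b x ≠ 0)
    (h1 : ∀ i j : Fin N, i.val + 1 = m + l → j.val = N - l → z i j ≠ 0) : z b c ≠ 0 := by
  intro hbc
  have hbb : z b b = 0 := by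
    by_cases h : b = c
    · rw [← h] at hbc; exact hbc
    · have : b.val ≠ c.val := fun h' => h (Fin.ext h')
      exact hp b b (Or.inl (by omega)) (by omega)
  rcases Nat.eq_zero_or_pos l with hl | hl
  · subst hl
    obtain ⟨x, hx⟩ := h0 rfl
    by_cases hxc : x = c
    · exact hx (hxc ▸ hbc)
    · have : x.val ≠ c.val := fun h' => hxc (Fin.ext h')
      exact hx (hp b x (Or.inl (by omega)) (by omega))
  -- For l > 0 the relation between `b` and N - l, the right end of the previous arc, is used: if
  -- z_bc vanished, so would its right side, and with it the previous arc entry.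
  · have hab : b < (⟨N - l, by omega⟩ : Fin N) := by
      rw [Fin.lt_def]; change b.val < N - l; omega
    have h := opTrace_relation hq0 hq1 hZ hab
    rw [hbb, zero_mul, map_zero, add_zero] at h
    have h2 : ∑ x with x < (⟨N - l, by omega⟩ : Fin N), opTrace V (z b x * z x b) = 0 := by
      refine Finset.sum_eq_zero fun x hx => ?_
      simp only [Finset.mem_filter, Finset.mem_univ, true_and, Fin.lt_def] at hx
      by_cases hxc : x = c
      · rw [hxc, hbc, zero_mul, map_zero]
      · have : x.val ≠ c.val := fun h' => hxc (Fin.ext h')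
        rw [hp b x (Or.inl (by omega)) (by omega), zero_mul, map_zero]
    rw [h2] at h
    have h3 := (Finset.sum_eq_zero_iff_of_nonneg (fun x _ => by
      rw [← hs _ x]; exact opTrace_mul_star_nonneg _)).1 h ⟨m + l - 1, by omega⟩ (by
        simp only [Finset.mem_filter, Finset.mem_univ, true_and, Fin.lt_def]
        omega)
    rw [← hs ⟨N - l, by omega⟩ ⟨m + l - 1, by omega⟩, opTrace_mul_star_eq_zero] at h3
    refine h1 ⟨m + l - 1, by omega⟩ ⟨N - l, by omega⟩ (by
      change m + l - 1 + 1 = m + l; omega) rfl ?_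
    rw [← hs, h3, star_zero]

/-- Here m is the number of initial zero rows and l is the largest number of nested nonzero arcs. If
the first diagonal entry of the remaining block vanished, another arc could be added. -/
theorem exists_arcPattern (hq0 : 0 < q) (hq1 : q < 1) (hZ : IsRE (q : ℂ) z)
    (hs : ∀ i j, star (z i j) = z j i) : ∃ m l, m + 2 * l ≤ N ∧ ArcPattern z m l ∧
      (∀ i j : Fin N, m ≤ i.val → i.val < m + l → i.val + j.val + 1 = N + m → z i j ≠ 0) ∧
      ∀ b : Fin N, b.val = m + l → m + 2 * l < N → z b b ≠ 0 := by
  classical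
  obtain ⟨m, hm, hmrow, hmne⟩ : ∃ m, m ≤ N ∧ (∀ i j : Fin N, i.val < m → z i j = 0) ∧
      ∀ b : Fin N, b.val = m → ∃ x, z b x ≠ 0 := by
    by_cases h : ∃ i : ℕ, ∃ hi : i < N, ∃ x, z ⟨i, hi⟩ x ≠ 0
    · refine ⟨Nat.find h, (Nat.find_spec h).1.le, fun i j hi => ?_, fun b hb => ?_⟩
      · by_contra hne
        exact Nat.find_min h hi ⟨i.2, j, hne⟩
      · obtain ⟨hi, x, hx⟩ := Nat.find_spec h
        exact ⟨x, by rwa [show b = ⟨_, hi⟩ from Fin.ext hb]⟩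
    · push Not at h
      exact ⟨N, le_rfl, fun i j _ => h i i.2 j, fun b hb => absurd b.2 (by omega)⟩
  have hQ0 : ArcPattern z m 0 := by
    intro i j hij _
    rcases hij with h | h
    · exact hmrow i j (by omega)
    · rw [← hs, hmrow j i (by omega), star_zero]
  let Q : ℕ → Prop := fun l => m + 2 * l ≤ N ∧ ArcPattern z m l ∧
    ∀ i j : Fin N, m ≤ i.val → i.val < m + l → i.val + j.val + 1 = N + m → z i j ≠ 0
  have hQ : Q 0 := ⟨by omega, hQ0, fun i j h1 h2 => by omega⟩
  set l := Nat.findGreatest Q N with hl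
  obtain ⟨h1, h2, h3⟩ : Q l := Nat.findGreatest_spec (Nat.zero_le N) hQ
  refine ⟨m, l, h1, h2, h3, fun b hb hlt hbb => ?_⟩
  have hp := arcPattern_succ hq0 hq1 hZ hs hlt h2 hb hbb
  have hne : ∀ c : Fin N, c.val = N - 1 - l → z b c ≠ 0 := fun c hc =>
    arc_ne_zero hq0 hq1 hZ hs hlt hp hb hc (fun h => hmne b (by omega))
      (fun i j hi hj => h3 i j (by omega) (by omega) (by omega))
  -- In a block with a single index the new arc entry would be z_bb itself.
  have hbig : m + 2 * (l + 1) ≤ N := by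
    by_contra hcon
    exact hne b (by omega) hbb
  have hQs : Q (l + 1) := by
    refine ⟨hbig, hp, fun i j hi1 hi2 hij => ?_⟩
    by_cases h : i.val < m + l
    · exact h3 i j hi1 h hij
    · obtain rfl : i = b := Fin.ext (by omega)
      exact hne j (by omega)
  have := Nat.le_findGreatest (show l + 1 ≤ N by omega) hQs
  omega

end Trace

end REA

namespace REA

/-! ### Operators that q-commute with an irreducible representation. -/

section Irreducible

variable {V : Type*} [NormedAddCommGroup V] [InnerProductSpace ℂ V] [CompleteSpace V]
  {N : ℕ} {q : ℝ} {π : OqH q N →⋆ₐ[ℂ] (V →L[ℂ] V)}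

open scoped ComplexOrder InnerProductSpace ComplexConjugate

theorem invariant_of_generators {W : Submodule ℂ V}
    (h : ∀ i j : Fin N, ∀ v ∈ W, π (Z q i j) v ∈ W) (a : OqH q N) : ∀ v ∈ W, π a v ∈ W := by
  obtain ⟨x, rfl⟩ := toOqH_surjective a
  have hmul : ∀ (x y : FreeZ N) (v : V), π (toOqH q N (x * y)) v =
      π (toOqH q N x) (π (toOqH q N y) v) := fun x y v => by
    rw [map_mul, map_mul]; rfl
  have hadd : ∀ (x y : FreeZ N) (v : V), π (toOqH q N (x + y)) v =
      π (toOqH q N x) v + π (toOqH q N y) v := fun x y v => by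
    rw [map_add, map_add]; rfl
  refine FreeAlgebra.induction ℂ (Fin N × Fin N)
    (motive := fun x => ∀ v ∈ W, π (toOqH q N x) v ∈ W) ?_ ?_ ?_ ?_ x
  · intro c v hv
    have : π (toOqH q N (algebraMap ℂ (FreeZ N) c)) = algebraMap ℂ (V →L[ℂ] V) c := by
      rw [AlgHom.commutes, AlgHomClass.commutes]
    have h2 : π (toOqH q N (algebraMap ℂ (FreeZ N) c)) v = c • v := by
      rw [this, Algebra.algebraMap_eq_smul_one]
      rfl
    exact h2 ▸ W.smul_mem c hv
  · intro p v hv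
    exact h p.1 p.2 v hv
  · intro x y hx hy v hv
    exact (congrArg (· ∈ W) (hmul x y v)).mpr (hx _ (hy v hv))
  · intro x y hx hy v hv
    exact (congrArg (· ∈ W) (hadd x y v)).mpr (W.add_mem (hx v hv) (hy v hv))

variable [FiniteDimensional ℂ V]

theorem IsIrreducible.eq_top (hπ : IsIrreducible π) {W : Submodule ℂ V} (hW : W ≠ ⊥)
    (h : ∀ i j : Fin N, ∀ v ∈ W, π (Z q i j) v ∈ W) : W = ⊤ :=
  (hπ.2 W W.closed_of_finiteDimensional (invariant_of_generators h)).resolve_left hW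

/-- In an irreducible representation an operator which commutes with the generators up to positive
scalars has trivial kernel, unless it vanishes. -/
theorem IsIrreducible.injective (hπ : IsIrreducible π) {X : V →L[ℂ] V} (hX : X ≠ 0)
    {w : Fin N → Fin N → ℂ} (h : ∀ i j, X * π (Z q i j) = w i j • (π (Z q i j) * X)) :
    Function.Injective X := by
  have hker : LinearMap.ker (X : V →ₗ[ℂ] V) = ⊥ := by
    by_contra hne
    have := hπ.eq_top hne fun i j v hv => by
      have h1 : X (π (Z q i j) v) = w i j • π (Z q i j) (X v) := DFunLike.congr_fun (h i j) v
      have h2 : X v = 0 := hv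
      rw [h2, map_zero, smul_zero] at h1
      exact h1
    apply hX
    ext v
    have h3 : v ∈ LinearMap.ker (X : V →ₗ[ℂ] V) := this ▸ Submodule.mem_top
    exact h3
  exact LinearMap.ker_eq_bot.1 hker

/-- A generator maps the eigenspace of `X` for μ into that for a positive multiple of μ. Hence the
eigenspaces along the ray through μ span an invariant subspace, which is everything, and a normal
operator with eigenvalues on one ray is a phase times a positive one. -/
theorem IsIrreducible.exists_phase (hπ : IsIrreducible π) {X : V →L[ℂ] V}
    (hinj : Function.Injective X) (hn : IsStarNormal X) {w : Fin N → Fin N → ℝ}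
    (hw : ∀ i j, 0 < w i j)
    (h : ∀ i j, X * π (Z q i j) = (w i j : ℂ) • (π (Z q i j) * X)) :
    ∃ u : ℂ, ‖u‖ = 1 ∧ PosInj (conj u • X) := by
  have hnt := hπ.1
  obtain ⟨μ, hμ⟩ := Module.End.exists_eigenvalue (X : V →ₗ[ℂ] V)
  obtain ⟨v₀, hv₀⟩ := hμ.exists_hasEigenvector
  have hXv : X v₀ = μ • v₀ := hv₀.apply_eq_smul
  have hμ0 : μ ≠ 0 := by
    rintro rfl
    rw [zero_smul] at hXv
    exact hv₀.2 (hinj (hXv.trans (map_zero X).symm))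
  set E : ℂ → Submodule ℂ V := Module.End.eigenspace (X : V →ₗ[ℂ] V) with hE
  set W : Submodule ℂ V := ⨆ r : {r : ℝ // 0 < r}, E (r.1 * μ) with hW
  have hWtop : W = ⊤ := by
    refine hπ.eq_top ?_ ?_
    · intro hbot
      have h1 : v₀ ∈ E (((⟨1, one_pos⟩ : {r : ℝ // 0 < r}).1 : ℝ) * μ) := by
        rw [hE, Module.End.mem_eigenspace_iff]
        simpa using hXv
      have h2 : v₀ ∈ W := Submodule.mem_iSup_of_mem _ h1
      rw [hbot] at h2
      exact hv₀.2 h2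
    · intro i j v hv
      refine Submodule.iSup_induction (motive := fun v => π (Z q i j) v ∈ W) _ hv ?_ ?_ ?_
      · intro r x hx
        have hx' : X x = ((r.1 : ℂ) * μ) • x := Module.End.mem_eigenspace_iff.1 hx
        refine Submodule.mem_iSup_of_mem ⟨w i j * r.1, mul_pos (hw i j) r.2⟩ ?_
        rw [hE, Module.End.mem_eigenspace_iff]
        have h1 : X (π (Z q i j) x) = (w i j : ℂ) • π (Z q i j) (X x) := DFunLike.congr_fun (h i j) x
        rw [hx', map_smul, smul_smul] at h1
        refine h1.trans ?_
        push_cast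
        rw [mul_assoc]
      · rw [map_zero]; exact W.zero_mem
      · intro x y hx hy
        rw [map_add]; exact W.add_mem hx hy
  have hray : ∀ (ν : ℂ) (v : V), v ≠ 0 → X v = ν • v → ∃ r : ℝ, 0 < r ∧ ν = r * μ := by
    intro ν v hv hXv
    by_contra! hno
    have hdis := Module.End.eigenspaces_iSupIndep (X : V →ₗ[ℂ] V) ν
    -- An eigenvalue ν off the ray would have an eigenspace independent of the whole space.
    have hle : W ≤ ⨆ (j : ℂ) (_ : j ≠ ν), E j := by
      refine iSup_le fun r => ?_
      exact le_iSup₂_of_le (r.1 * μ) (fun h => hno r.1 r.2 h.symm) le_rfl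
    rw [hWtop, top_le_iff] at hle
    have hle' : (⨆ (j : ℂ) (_ : j ≠ ν), Module.End.eigenspace (X : V →ₗ[ℂ] V) j) = ⊤ := hle
    rw [hle', disjoint_top] at hdis
    have : v ∈ Module.End.eigenspace (X : V →ₗ[ℂ] V) ν := Module.End.mem_eigenspace_iff.2 hXv
    rw [hdis] at this
    exact hv this
  have hnorm : (‖μ‖ : ℂ) ≠ 0 := by exact_mod_cast norm_ne_zero_iff.2 hμ0
  refine ⟨μ / ‖μ‖, by rw [norm_div, Complex.norm_real, norm_norm, div_self (norm_ne_zero_iff.2 hμ0)],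
    posInj_of_eigenvalues ⟨?_⟩ fun ν v hv hν => ?_⟩
  · rw [star_smul]
    exact ((hn.star_comm_self.smul_left _).smul_right _)
  · have hu : (μ / ‖μ‖) * conj (μ / ‖μ‖) = 1 := by
      rw [Complex.mul_conj, Complex.normSq_eq_norm_sq, norm_div, Complex.norm_real, norm_norm,
        div_self (norm_ne_zero_iff.2 hμ0)]
      simp
    have h1 : X v = (μ / ‖μ‖ * ν) • v := by
      have h2 : conj (μ / ‖μ‖) • X v = ν • v := hν
      rw [mul_smul, ← h2, smul_smul, hu, one_smul]
    obtain ⟨r, hr, hr'⟩ := hray _ v hv h1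
    have h3 : ν = ((r * ‖μ‖ : ℝ) : ℂ) := by
      push_cast
      field_simp at hr'
      have : μ * ν = μ * (r * ‖μ‖) := by rw [hr']; ring
      exact mul_left_cancel₀ hμ0 this
    rw [h3, Complex.zero_lt_real]
    exact mul_pos hr (norm_pos_iff.2 hμ0)

theorem isRE_rep (π : OqH q N →⋆ₐ[ℂ] (V →L[ℂ] V)) : IsRE (q : ℂ) fun i j => π (Z q i j) :=
  (isRE_Z q).map π.toAlgHom

theorem star_rep (π : OqH q N →⋆ₐ[ℂ] (V →L[ℂ] V)) (i j : Fin N) :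
    star (π (Z q i j)) = π (Z q j i) := by
  rw [← map_star, star_Z]

/-- An entry which comes first in its row and column is definite, up to a phase. -/
theorem IsIrreducible.exists_phase_entry (hπ : IsIrreducible π) (hq0 : 0 < q) {b d : Fin N}
    (hd : ∀ x < b, π (Z q x d) = 0) (hb : ∀ x < d, π (Z q b x) = 0) (hne : π (Z q b d) ≠ 0) :
    ∃ u : ℂ, ‖u‖ = 1 ∧ PosInj (conj u • π (Z q b d)) := by
  have hnt := hπ.1
  have hq : (q : ℂ) ≠ 0 := by exact_mod_cast hq0.ne'
  obtain ⟨f, hf, hfw⟩ : ∃ f : Fin N → ℝ, (∀ i, 0 < f i) ∧ ∀ i, (f i : ℂ) = wt (q : ℂ) b d i := by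
    refine ⟨fun x => (if x = b then q else 1) * if x = d then q else 1, fun x => ?_, fun x => ?_⟩
    · beta_reduce
      split_ifs <;> positivity
    · beta_reduce
      rw [wt, Complex.ofReal_mul, apply_ite Complex.ofReal, apply_ite Complex.ofReal,
        Complex.ofReal_one]
  have hX : ∀ i j, π (Z q b d) * π (Z q i j) =
      ((f i / f j : ℝ) : ℂ) • (π (Z q i j) * π (Z q b d)) := by
    intro i j
    have h := (isRE_rep π).qcomm hq hd hb i j
    rw [← hfw, ← hfw] at h
    have hj : (f j : ℂ) ≠ 0 := by exact_mod_cast (hf j).ne'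
    push_cast
    rw [div_eq_inv_mul, mul_smul, h, smul_smul, inv_mul_cancel₀ hj, one_smul]
  refine hπ.exists_phase (hπ.injective hne hX) ⟨?_⟩ (fun i j => div_pos (hf i) (hf j)) hX
  -- This is the commutation of the entry with its own adjoint. Its trace is a nonzero squared norm
  -- on both sides, so the scalar is 1 and the entry is normal.
  have h1 := hX d b
  rw [← star_rep π b d] at h1
  have h2 := congrArg (opTrace V) h1
  rw [map_smul, opTrace_mul_comm (star _), smul_eq_mul] at h2
  have h3 : opTrace V (π (Z q b d) * star (π (Z q b d))) ≠ 0 := fun h0 =>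
    hne (opTrace_mul_star_eq_zero.1 h0)
  have h4 := mul_right_cancel₀ h3 ((one_mul _).trans h2)
  rw [← h4, one_smul] at h1
  exact h1.symm

end Irreducible

end REA

namespace REA

/-! ### Lexicographic order, inversions and the sets attached to a shape. -/

section Lex

variable {N : ℕ}

/-- The witness is the letter of `a` at the first place where the two lists differ. -/
theorem exists_of_list_lt {α : Type*} [LinearOrder α] (a b : List α) (ha : a.Pairwise (· < ·))
    (hb : b.Pairwise (· < ·)) (hl : a.length = b.length) (h : a < b) :
    ∃ x ∈ a, x ∉ b ∧ (∃ y ∈ b, x < y) ∧ ∀ y ∈ b, y < x → y ∈ a := by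
  induction a generalizing b with
  | nil =>
    rw [List.length_nil, eq_comm, List.length_eq_zero_iff] at hl
    subst hl
    exact absurd h (lt_irrefl _)
  | cons x a ih =>
    cases b with
    | nil => simp at hl
    | cons y b =>
      obtain ⟨ha1, ha2⟩ := List.pairwise_cons.1 ha
      obtain ⟨hb1, hb2⟩ := List.pairwise_cons.1 hb
      rcases List.cons_lt_cons_iff.1 h with h | ⟨rfl, h2⟩
      · refine ⟨x, List.mem_cons_self, ?_, ⟨y, List.mem_cons_self, h⟩, ?_⟩
        · intro hx
          rcases List.mem_cons.1 hx with h' | h'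
          · exact absurd h (h' ▸ lt_irrefl _)
          · exact lt_asymm h (hb1 x h')
        · intro z hz hzx
          rcases List.mem_cons.1 hz with rfl | h'
          · exact absurd h hzx.not_gt
          · exact absurd (h.trans (hb1 z h')) hzx.not_gt
      · obtain ⟨z, hz, hzb, ⟨y, hy, hzy⟩, hall⟩ := ih b ha2 hb2 (by simpa using hl) h2
        refine ⟨z, List.mem_cons_of_mem _ hz, ?_, ⟨y, List.mem_cons_of_mem _ hy, hzy⟩, ?_⟩
        · intro h'
          rcases List.mem_cons.1 h' with rfl | h'
          · exact lt_irrefl _ (ha1 z hz)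
          · exact hzb h'
        · intro w hw hwz
          rcases List.mem_cons.1 hw with rfl | h'
          · exact List.mem_cons_self
          · exact List.mem_cons_of_mem _ (hall w h' hwz)

theorem exists_of_setLT {I J : Finset (Fin N)} (hc : I.card = J.card) (h : setLT I J) :
    ∃ x ∈ I, x ∉ J ∧ (∃ y ∈ J, x < y) ∧ ∀ y ∈ J, y < x → y ∈ I := by
  have := exists_of_list_lt (I.sort (· ≤ ·)) (J.sort (· ≤ ·)) (Finset.sortedLT_sort I).pairwise
    (Finset.sortedLT_sort J).pairwise (by simp [hc]) h
  simpa using this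

theorem setLT_trichotomy (I J : Finset (Fin N)) : setLT I J ∨ I = J ∨ setLT J I := by
  rcases lt_trichotomy (I.sort (· ≤ ·)) (J.sort (· ≤ ·)) with h | h | h
  · exact Or.inl h
  · refine Or.inr (Or.inl ?_)
    have := congrArg List.toFinset h
    simpa using this
  · exact Or.inr (Or.inr h)

theorem inversions_subtype {α β : Type*} [LinearOrder α] [LinearOrder β] (J : Finset α)
    (f : α → β) : inversions (fun p : {p // p ∈ J} => f p) =
      ((J ×ˢ J).filter fun x => x.1 < x.2 ∧ f x.2 < f x.1).card := by
  unfold inversions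
  refine Finset.card_bij (fun x _ => (x.1.1, x.2.1)) ?_ ?_ ?_
  · rintro ⟨x, y⟩ h
    simpa using h
  · rintro ⟨x, y⟩ _ ⟨x', y'⟩ _ h
    simp only [Prod.mk.injEq] at h
    exact Prod.ext (Subtype.ext h.1) (Subtype.ext h.2)
  · rintro ⟨x, y⟩ h
    simp only [Finset.mem_filter, Finset.mem_product] at h
    exact ⟨(⟨x, h.1.1⟩, ⟨y, h.1.2⟩), by simpa using h.2, rfl⟩

theorem inversions_insert {α β : Type*} [LinearOrder α] [LinearOrder β] {J : Finset α} {p : α}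
    (hp : ∀ x ∈ J, x < p) (f : α → β) :
    inversions (fun x : {x // x ∈ insert p J} => f x) =
      inversions (fun x : {x // x ∈ J} => f x) + (J.filter fun x => f p < f x).card := by
  have hpJ : p ∉ J := fun h => lt_irrefl _ (hp p h)
  rw [inversions_subtype, inversions_subtype]
  have : ((insert p J) ×ˢ (insert p J)).filter (fun x => x.1 < x.2 ∧ f x.2 < f x.1) =
      (J ×ˢ J).filter (fun x => x.1 < x.2 ∧ f x.2 < f x.1) ∪
        (J.filter fun x => f p < f x).image fun x => (x, p) := by
    ext ⟨x, y⟩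
    simp only [Finset.mem_filter, Finset.mem_product, Finset.mem_insert, Finset.mem_union,
      Finset.mem_image, Prod.mk.injEq]
    constructor
    · rintro ⟨⟨hx, hy⟩, hxy, hf⟩
      rcases hy with rfl | hy
      · rcases hx with rfl | hx
        · exact absurd hxy (lt_irrefl _)
        · exact Or.inr ⟨x, ⟨hx, hf⟩, rfl, rfl⟩
      · rcases hx with rfl | hx
        · exact absurd (hp y hy) hxy.not_gt
        · exact Or.inl ⟨⟨hx, hy⟩, hxy, hf⟩
    · rintro (⟨⟨hx, hy⟩, hxy, hf⟩ | ⟨w, ⟨hw, hf⟩, rfl, rfl⟩)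
      · exact ⟨⟨Or.inr hx, Or.inr hy⟩, hxy, hf⟩
      · exact ⟨⟨Or.inr hw, Or.inl rfl⟩, hp _ hw, hf⟩
  rw [this, Finset.card_union_of_disjoint, Finset.card_image_of_injective]
  · intro x y h
    exact (Prod.ext_iff.1 h).1
  · rw [Finset.disjoint_left]
    rintro ⟨x, y⟩ h h'
    simp only [Finset.mem_filter, Finset.mem_product, Finset.mem_image, Prod.mk.injEq] at h h'
    obtain ⟨w, _, _, rfl⟩ := h'
    exact hpJ h.1.2

namespace Shape

variable (S : Shape N)

theorem initial_zero : S.initial 0 = ∅ := by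
  ext p
  simp only [initial, Finset.mem_filter, Nat.le_zero, Finset.card_eq_zero, Finset.notMem_empty,
    iff_false, not_and]
  intro hp h
  have : p ∈ S.P.filter (· ≤ p) := Finset.mem_filter.2 ⟨hp, le_rfl⟩
  rw [h] at this
  exact absurd this (Finset.notMem_empty p)

theorem initial_subset (k : ℕ) : S.initial k ⊆ S.P := Finset.filter_subset _ _

theorem initial_rank : S.initial S.rank = S.P :=
  Finset.filter_true_of_mem fun _ _ => Finset.card_le_card (Finset.filter_subset _ _)

/-- Passing from `k` to `k + 1` adds the next element of `P`. -/
theorem exists_initial_succ {k : ℕ} (hk : k < S.rank) : ∃ p ∈ S.P, p ∉ S.initial k ∧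
    (∀ x ∈ S.initial k, x < p) ∧ S.initial (k + 1) = insert p (S.initial k) := by
  have hlen : (S.P.orderEmbOfFin rfl : Fin S.P.card ↪o Fin N) = S.P.orderEmbOfFin rfl := rfl
  set e := S.P.orderEmbOfFin rfl with he
  have hcount : ∀ i : Fin S.P.card, (S.P.filter (· ≤ e i)).card = i.val + 1 := by
    intro i
    have : S.P.filter (· ≤ e i) = (Finset.Iic i).map e.toEmbedding := by
      ext x
      simp only [Finset.mem_filter, Finset.mem_map, Finset.mem_Iic]
      constructor
      · rintro ⟨hx, hxi⟩
        obtain ⟨j, rfl⟩ : x ∈ Set.range e := by rw [he, Finset.range_orderEmbOfFin]; exact hx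
        exact ⟨j, e.le_iff_le.1 hxi, rfl⟩
      · rintro ⟨j, hj, rfl⟩
        exact ⟨Finset.orderEmbOfFin_mem S.P rfl j, e.le_iff_le.2 hj⟩
    rw [this, Finset.card_map, Fin.card_Iic]
  have hmem : ∀ j x, x ∈ S.initial j ↔ ∃ i : Fin S.P.card, i.val < j ∧ e i = x := by
    intro j x
    constructor
    · intro hx
      obtain ⟨hx, hxj⟩ := Finset.mem_filter.1 hx
      obtain ⟨i, rfl⟩ : x ∈ Set.range e := by rw [he, Finset.range_orderEmbOfFin]; exact hx
      rw [hcount] at hxj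
      exact ⟨i, by omega, rfl⟩
    · rintro ⟨i, hi, rfl⟩
      refine Finset.mem_filter.2 ⟨Finset.orderEmbOfFin_mem S.P rfl i, ?_⟩
      rw [hcount]
      omega
  refine ⟨e ⟨k, hk⟩, Finset.orderEmbOfFin_mem S.P rfl _, ?_, ?_, ?_⟩
  · rw [hmem]
    rintro ⟨i, hi, h⟩
    have := e.injective h
    rw [this] at hi
    exact lt_irrefl _ hi
  · intro x hx
    obtain ⟨i, hi, rfl⟩ := (hmem k x).1 hx
    exact e.lt_iff_lt.2 hi
  · ext x
    rw [hmem, Finset.mem_insert, hmem]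
    constructor
    · rintro ⟨i, hi, rfl⟩
      rcases Nat.lt_succ_iff_lt_or_eq.1 hi with h | h
      · exact Or.inr ⟨i, h, rfl⟩
      · exact Or.inl (congrArg e (Fin.ext h))
    · rintro (rfl | ⟨i, hi, rfl⟩)
      · exact ⟨⟨k, hk⟩, Nat.lt_succ_self k, rfl⟩
      · exact ⟨i, by omega, rfl⟩

theorem card_initial {k : ℕ} (hk : k ≤ S.rank) : (S.initial k).card = k := by
  induction k with
  | zero => rw [initial_zero, Finset.card_empty]
  | succ k ih =>
    obtain ⟨p, _, hp, _, h⟩ := S.exists_initial_succ (Nat.lt_of_succ_le hk)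
    rw [h, Finset.card_insert_of_notMem hp, ih (by omega)]

theorem card_image {k : ℕ} (hk : k ≤ S.rank) : (S.image k).card = k := by
  rw [image, Finset.card_image_of_injective _ S.τ.injective, S.card_initial hk]

theorem image_insert {k : ℕ} {p : Fin N} (h : S.initial (k + 1) = insert p (S.initial k)) :
    S.image (k + 1) = insert (S.τ p) (S.image k) := by
  rw [image, h, Finset.image_insert]
  rfl

open scoped ComplexConjugate

/-- As `p` comes last, its new inversions are counted by the earlier images above τ(p). The same
number is the exponent of the sign when a minor is expanded along the row τ(p). -/
theorem phase_insert {k : ℕ} {p : Fin N} (hp : ∀ x ∈ S.initial k, x < p)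
    (h : S.initial (k + 1) = insert p (S.initial k)) :
    S.phase (k + 1) = S.phase k * ((-1) ^ ((S.image k).filter (S.τ p < ·)).card *
      conj (S.u p)) := by
  have hpk : p ∉ S.initial k := fun h => lt_irrefl _ (hp p h)
  have h1 : ((S.image k).filter (S.τ p < ·)).card =
      ((S.initial k).filter fun x => S.τ p < S.τ x).card := by
    rw [image, Finset.filter_image, Finset.card_image_of_injective _ S.τ.injective]
  have h2 := inversions_insert hp S.τ
  unfold phase
  rw [h, Finset.prod_insert hpk, h2, map_mul, h1, pow_add]
  ring

theorem phase_zero : S.phase 0 = 1 := by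
  unfold phase
  rw [inversions_subtype, initial_zero]
  simp

end Shape

end Lex

end REA

namespace REA

open scoped ComplexOrder InnerProductSpace ComplexConjugate

/-! ### The shapes given by arcs around a block of fixed points. -/

section ArcShape

variable {N : ℕ}

/-- The parameters of the shapes of finite dimensional representations: `m` vanishing rows, then
`l` nested arcs with phases `v`, which surround a block of fixed points with a common sign. -/
structure ArcParams (N : ℕ) where
  m : ℕ
  l : ℕ
  le : m + 2 * l ≤ N
  v : Fin N → ℂ
  sgn : ℝ
  sgn_eq : sgn = 1 ∨ sgn = -1
  v_zero : ∀ i : Fin N, i.val < m → v i = 0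
  v_norm : ∀ i : Fin N, m ≤ i.val → ‖v i‖ = 1
  v_symm : ∀ i j : Fin N, m ≤ i.val → i.val < m + l → i.val + j.val + 1 = N + m → v j = conj (v i)
  v_mid : ∀ i : Fin N, m + l ≤ i.val → i.val + l < N → v i = sgn

namespace ArcParams

variable (a : ArcParams N)

/-- The reflection of the arcs. -/
def flip (i : Fin N) : Fin N :=
  if h : i.val < a.m ∨ (a.m + a.l ≤ i.val ∧ i.val + a.l < N) then i
  else ⟨N - 1 + a.m - i.val, by omega⟩

theorem flip_of_fixed {i : Fin N} (h : i.val < a.m ∨ (a.m + a.l ≤ i.val ∧ i.val + a.l < N)) :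
    a.flip i = i := dif_pos h

theorem flip_of_arc {i : Fin N} (hm : a.m ≤ i.val)
    (h : i.val < a.m + a.l ∨ N ≤ i.val + a.l) : (a.flip i).val + i.val + 1 = N + a.m := by
  have hi := i.2
  rw [flip, dif_neg (by omega)]
  change N - 1 + a.m - i.val + i.val + 1 = N + a.m
  omega

/-- Presents the reflection through linear conditions on indices, so that later combinatorics is
arithmetic. -/
theorem flip_cases (i : Fin N) :
    (a.flip i = i ∧ (i.val < a.m ∨ (a.m + a.l ≤ i.val ∧ i.val + a.l < N))) ∨
    ((a.flip i).val + i.val + 1 = N + a.m ∧ a.m ≤ i.val ∧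
      (i.val < a.m + a.l ∨ N ≤ i.val + a.l)) := by
  by_cases h : i.val < a.m ∨ (a.m + a.l ≤ i.val ∧ i.val + a.l < N)
  · exact Or.inl ⟨a.flip_of_fixed h, h⟩
  · exact Or.inr ⟨a.flip_of_arc (by omega) (by omega), by omega, by omega⟩

theorem flip_flip (i : Fin N) : a.flip (a.flip i) = i := by
  have hle := a.le
  have hi := i.2
  rcases a.flip_cases i with ⟨h, _⟩ | ⟨h1, h2, h3⟩
  · rw [h, h]
  · rcases a.flip_cases (a.flip i) with ⟨h, h'⟩ | ⟨h4, h5, h6⟩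
    · exfalso; omega
    · exact Fin.ext (by omega)

theorem v_ne_zero {i : Fin N} (h : a.m ≤ i.val) : a.v i ≠ 0 := by
  intro h0
  have := a.v_norm i h
  rw [h0, norm_zero] at this
  exact zero_ne_one this

theorem v_ne_zero_iff {i : Fin N} : a.v i ≠ 0 ↔ a.m ≤ i.val :=
  ⟨fun h => not_lt.1 fun h' => h (a.v_zero i h'), a.v_ne_zero⟩

/-- The shape with the given parameters. -/
def shape : Shape N where
  τ := Function.Involutive.toPerm a.flip a.flip_flip
  u := a.v
  u_mem i := by
    rcases lt_or_ge i.val a.m with h | h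
    · exact Or.inl (a.v_zero i h)
    · exact Or.inr (a.v_norm i h)
  u_ne_zero i h := a.v_ne_zero (not_lt.1 fun h' => h (a.flip_of_fixed (Or.inl h')))

theorem mem_P {i : Fin N} : i ∈ a.shape.P ↔ a.m ≤ i.val := by
  rw [Shape.P, Finset.mem_filter]
  exact ⟨fun h => a.v_ne_zero_iff.1 h.2, fun h => ⟨Finset.mem_univ i, a.v_ne_zero h⟩⟩

/-- For these shapes P consists of all indices from m on, so its k smallest elements form an
interval. -/
theorem mem_initial {i : Fin N} {k : ℕ} :
    i ∈ a.shape.initial k ↔ a.m ≤ i.val ∧ i.val < a.m + k := by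
  rw [Shape.initial, Finset.mem_filter, mem_P]
  refine and_congr_right fun h => ?_
  have : a.shape.P.filter (· ≤ i) = Finset.Icc ⟨a.m, h.trans_lt i.2⟩ i := by
    ext x
    rw [Finset.mem_filter, mem_P, Finset.mem_Icc, Fin.le_def, Fin.le_def]
  rw [this, Fin.card_Icc]
  change i.val + 1 - a.m ≤ k ↔ _
  omega

theorem mem_image {i : Fin N} {k : ℕ} : i ∈ a.shape.image k ↔ a.flip i ∈ a.shape.initial k := by
  rw [Shape.image, Finset.mem_image]
  constructor
  · rintro ⟨x, hx, rfl⟩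
    exact (a.flip_flip x).symm ▸ hx
  · intro h
    exact ⟨_, h, a.flip_flip i⟩

theorem rank_eq : a.shape.rank = N - a.m := by
  rw [Shape.rank]
  rcases lt_or_ge a.m N with h | h
  · have : a.shape.P = Finset.Ici ⟨a.m, h⟩ := by
      ext x
      rw [mem_P, Finset.mem_Ici, Fin.le_def]
    rw [this, Fin.card_Ici]
  · have : a.shape.P = ∅ := by
      ext x
      rw [mem_P]
      have := x.2
      simp only [Finset.notMem_empty, iff_false]
      omega
    rw [this, Finset.card_empty, Nat.sub_eq_zero_of_le h]

theorem card_initial {k : ℕ} (hk : a.m + k ≤ N) : (a.shape.initial k).card = k :=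
  a.shape.card_initial (by rw [rank_eq]; omega)

theorem card_image {k : ℕ} (hk : a.m + k ≤ N) : (a.shape.image k).card = k :=
  a.shape.card_image (by rw [rank_eq]; omega)

theorem initial_succ {k : ℕ} (hk : a.m + k < N) :
    a.shape.initial (k + 1) = insert ⟨a.m + k, hk⟩ (a.shape.initial k) := by
  ext x
  rw [Finset.mem_insert, mem_initial, mem_initial, Fin.ext_iff]
  change _ ↔ x.val = a.m + k ∨ _
  omega

theorem phase_succ {k : ℕ} {p : Fin N} (hp : p.val = a.m + k) :
    a.shape.phase (k + 1) = a.shape.phase k *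
      ((-1) ^ ((a.shape.image k).filter (a.flip p < ·)).card * conj (a.v p)) := by
  obtain ⟨p, hpN⟩ := p
  obtain rfl : p = a.m + k := hp
  refine a.shape.phase_insert (fun x hx => ?_) (a.initial_succ hpN)
  rw [mem_initial] at hx
  exact Fin.lt_def.2 hx.2

end ArcParams

end ArcShape

/-! ### Matrices that fit the parameters, and passing an arc. -/

section Fit

variable {N : ℕ} {V : Type*} [NormedAddCommGroup V] [InnerProductSpace ℂ V]

/-- The conditions on the matrix of a representation which force its shape. -/
structure ArcParams.Fits (a : ArcParams N) (z : Fin N → Fin N → V →L[ℂ] V) : Prop where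
  pattern : ArcPattern z a.m a.l
  arc : ∀ i j : Fin N, a.m ≤ j.val → (j.val < a.m + a.l ∨ N ≤ j.val + a.l) →
    i.val + j.val + 1 = N + a.m → PosInj (conj (a.v j) • z i j)
  mid : ∀ b : Fin N, b.val = a.m + a.l → b.val + a.l < N → PosInj ((a.sgn : ℂ) • z b b)

namespace ArcParams.Fits

variable {a : ArcParams N} {q : ℝ} {z : Fin N → Fin N → V →L[ℂ] V}

/-- The matrix entry of an arc comes first in its row and column. -/
theorem col_eq_zero (hf : a.Fits z) {p : Fin N} (hm : a.m ≤ p.val)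
    (hp : p.val < a.m + a.l ∨ N ≤ p.val + a.l) {t : Fin N} (ht : t < a.flip p) : z t p = 0 := by
  have h := a.flip_of_arc hm hp
  have := a.le
  rw [Fin.lt_def] at ht
  exact hf.pattern _ _ (by omega) (by omega)

theorem row_eq_zero (hf : a.Fits z) {p : Fin N} (hm : a.m ≤ p.val)
    (hp : p.val < a.m + a.l ∨ N ≤ p.val + a.l) {t : Fin N} (ht : t < p) : z (a.flip p) t = 0 := by
  have h := a.flip_of_arc hm hp
  have := a.le
  rw [Fin.lt_def] at ht
  exact hf.pattern _ _ (by omega) (by omega)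

/-- The minors of the shape, one arc after the other. -/
theorem fminor_succ (hf : a.Fits z) (hq0 : 0 < q) (hZ : IsRE (q : ℂ) z) {k : ℕ} {p : Fin N}
    (hpk : p.val = a.m + k) (hp : p.val < a.m + a.l ∨ N ≤ p.val + a.l) :
    ∃ c : ℝ, 0 < c ∧ fminor (q : ℂ) z (a.shape.image (k + 1)) (a.shape.initial (k + 1)) =
      ((-1) ^ ((a.shape.image k).filter (a.flip p < ·)).card * (c : ℂ)) •
        (z (a.flip p) p * fminor (q : ℂ) z (a.shape.image k) (a.shape.initial k)) := by
  have hq : (q : ℂ) ≠ 0 := by exact_mod_cast hq0.ne'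
  have hq2 : (q : ℂ) ^ 2 + 1 ≠ 0 := by exact_mod_cast (by positivity : q ^ 2 + 1 ≠ 0)
  have hkN : a.m + k < N := hpk ▸ p.2
  have hJ : a.shape.initial (k + 1) = insert p (a.shape.initial k) := by
    rw [a.initial_succ hkN]
    congr 1
    exact Fin.ext hpk.symm
  have hI : a.shape.image (k + 1) = insert (a.flip p) (a.shape.image k) := a.shape.image_insert hJ
  have hpJ : p ∉ a.shape.initial k := by rw [a.mem_initial]; omega
  have hpI : a.flip p ∉ a.shape.image k := by rw [a.mem_image, a.flip_flip]; exact hpJ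
  have h := fminor_last hq hq2 hZ (I := a.shape.image (k + 1)) (J := a.shape.initial (k + 1))
    (by rw [a.card_image (by omega), a.card_initial (by omega)]) (s := a.flip p) (p := p)
    (by rw [hI]; exact Finset.mem_insert_self _ _) (by rw [hJ]; exact Finset.mem_insert_self _ _)
    (fun x hx => by rw [a.mem_initial] at hx; rw [Fin.le_def]; omega)
    (fun t ht => hf.row_eq_zero (by omega) hp ht)
  have he1 : (a.shape.image (k + 1)).erase (a.flip p) = a.shape.image k := by
    rw [hI, Finset.erase_insert hpI]
  have he2 : (a.shape.initial (k + 1)).erase p = a.shape.initial k := by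
    rw [hJ, Finset.erase_insert hpJ]
  have he3 : (a.shape.image (k + 1)).filter (a.flip p < ·) =
      (a.shape.image k).filter (a.flip p < ·) := by
    rw [hI, Finset.filter_insert, if_neg (lt_irrefl _)]
  rw [he1, he2, he3] at h
  set d := ((a.shape.image k).filter (a.flip p < ·)).card
  refine ⟨(q ^ d)⁻¹ * if p ∈ a.shape.image k then q⁻¹ else 1, ?_, ?_⟩
  · split_ifs <;> positivity
  · rw [h]
    congr 1
    rw [neg_pow, mul_inv, ← inv_pow (-1 : ℂ), inv_neg_one, Complex.ofReal_mul, mul_assoc]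
    congr 1
    split_ifs <;> simp

variable [FiniteDimensional ℂ V] [CompleteSpace V]

/-- Passing an arc preserves the sign of the minors. -/
theorem posInj_succ (hf : a.Fits z) (hq0 : 0 < q) (hZ : IsRE (q : ℂ) z) {k : ℕ} {p : Fin N}
    (hpk : p.val = a.m + k) (hp : p.val < a.m + a.l ∨ N ≤ p.val + a.l)
    (h : PosInj (a.shape.phase k • fminor (q : ℂ) z (a.shape.image k) (a.shape.initial k))) :
    PosInj (a.shape.phase (k + 1) •
      fminor (q : ℂ) z (a.shape.image (k + 1)) (a.shape.initial (k + 1))) := by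
  have hq : (q : ℂ) ≠ 0 := by exact_mod_cast hq0.ne'
  have hq2 : (q : ℂ) ^ 2 + 1 ≠ 0 := by exact_mod_cast (by positivity : q ^ 2 + 1 ≠ 0)
  have hkN : a.m + k < N := hpk ▸ p.2
  obtain ⟨c, hc, hm⟩ := hf.fminor_succ hq0 hZ hpk hp
  set K := fminor (q : ℂ) z (a.shape.image k) (a.shape.initial k) with hK
  set d := ((a.shape.image k).filter (a.flip p < ·)).card with hd
  have h1 : a.shape.phase (k + 1) • fminor (q : ℂ) z (a.shape.image (k + 1))
      (a.shape.initial (k + 1)) =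
      (c : ℂ) • ((conj (a.v p) • z (a.flip p) p) * (a.shape.phase k • K)) := by
    rw [hm, a.phase_succ hpk, smul_mul_smul_comm, smul_smul, smul_smul]
    congr 1
    -- The sign of the expansion and the inversions added to the phase cancel.
    have h2 : ((-1 : ℂ) ^ d) * (-1) ^ d = 1 := by rw [← mul_pow]; simp
    calc _ = (c : ℂ) * (conj (a.v p) * a.shape.phase k) * (((-1 : ℂ) ^ d) * (-1) ^ d) := by ring
      _ = _ := by rw [h2, mul_one]
  rw [h1]
  refine PosInj.smul ?_ (Complex.zero_lt_real.2 hc)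
  -- The arc entry q-commutes with the previous minor, so the product of the two positive operators
  -- is positive.
  have hX := hZ.qcomm hq (b := a.flip p) (d := p)
    (fun x hx => hf.col_eq_zero (by omega) hp hx) (fun x hx => hf.row_eq_zero (by omega) hp hx)
  have hcomm := fminor_qcomm hq hq2 hZ (wt_ne_zero hq (a.flip p) p) hX
    (I := a.shape.image k) (J := a.shape.initial k)
    (by rw [a.card_image (by omega), a.card_initial (by omega)])
  rw [← hK] at hcomm
  set α := ∏ i ∈ a.shape.image k, wt (q : ℂ) (a.flip p) p i
  set β := ∏ i ∈ a.shape.initial k, wt (q : ℂ) (a.flip p) p i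
  have hβ : β ≠ 0 := Finset.prod_ne_zero_iff.2 fun i _ => wt_ne_zero hq _ _ _
  refine (hf.arc (a.flip p) p (by omega) hp (a.flip_of_arc (by omega) hp)).mul h (c := β⁻¹ * α) ?_
  have h3 : z (a.flip p) p * K = (β⁻¹ * α) • (K * z (a.flip p) p) := by
    rw [mul_smul, hcomm, smul_smul, inv_mul_cancel₀ hβ, one_smul]
  rw [smul_mul_smul_comm, smul_mul_smul_comm, h3, smul_smul, smul_smul]
  congr 1
  ring

theorem phase_fminor_zero : a.shape.phase 0 • fminor (q : ℂ) z (a.shape.image 0)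
    (a.shape.initial 0) = 1 := by
  have h : a.shape.image 0 = ∅ := by rw [Shape.image, Shape.initial_zero, Finset.image_empty]
  rw [Shape.phase_zero, Shape.initial_zero, h, fminor_empty, if_pos rfl, one_smul]

theorem posInj_left (hf : a.Fits z) (hq0 : 0 < q) (hZ : IsRE (q : ℂ) z) {k : ℕ} (hk : k ≤ a.l) :
    PosInj (a.shape.phase k • fminor (q : ℂ) z (a.shape.image k) (a.shape.initial k)) := by
  have hle := a.le
  induction k with
  | zero =>
    rw [phase_fminor_zero]
    exact PosInj.one
  | succ k ih =>
    exact hf.posInj_succ hq0 hZ (p := ⟨a.m + k, by omega⟩) rfl (Or.inl (by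
      change a.m + k < a.m + a.l; omega)) (ih (by omega))

/-- The minor of all left arcs commutes with the middle block. -/
theorem commute_left (hf : a.Fits z) (hq0 : 0 < q) (hZ : IsRE (q : ℂ) z) {k : ℕ} (hk : k ≤ a.l)
    {i j : Fin N} (hi : a.m + a.l ≤ i.val ∧ i.val + a.l < N)
    (hj : a.m + a.l ≤ j.val ∧ j.val + a.l < N) :
    Commute (fminor (q : ℂ) z (a.shape.image k) (a.shape.initial k)) (z i j) := by
  have hle := a.le
  have hq : (q : ℂ) ≠ 0 := by exact_mod_cast hq0.ne'
  induction k with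
  | zero =>
    have h : a.shape.image 0 = ∅ := by rw [Shape.image, Shape.initial_zero, Finset.image_empty]
    rw [h, Shape.initial_zero, fminor_empty, if_pos rfl]
    exact Commute.one_left _
  | succ k ih =>
    set p : Fin N := ⟨a.m + k, by omega⟩ with hp
    have hpl : p.val < a.m + a.l ∨ N ≤ p.val + a.l := Or.inl (by
      change a.m + k < a.m + a.l; omega)
    have hpm : a.m ≤ p.val := Nat.le_add_right _ _
    obtain ⟨c, _, h⟩ := hf.fminor_succ hq0 hZ (p := p) rfl hpl
    rw [h]
    refine Commute.smul_left (Commute.mul_left ?_ (ih (by omega))) _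
    have hX := hZ.qcomm hq (b := a.flip p) (d := p)
      (fun x hx => hf.col_eq_zero hpm hpl hx) (fun x hx => hf.row_eq_zero hpm hpl hx) i j
    have hfp := a.flip_of_arc hpm hpl
    have hpv : p.val = a.m + k := rfl
    -- Indices of the block are not ends of an arc, so their weights are 1.
    have hwt : ∀ x : Fin N, a.m + a.l ≤ x.val ∧ x.val + a.l < N →
        wt (q : ℂ) (a.flip p) p x = 1 := by
      intro x hx
      rw [wt, if_neg, if_neg, one_mul]
      · rintro rfl; omega
      · rintro rfl; omega
    rw [hwt i hi, hwt j hj, one_smul, one_smul] at hX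
    exact hX.symm

end ArcParams.Fits

end Fit

end REA

namespace REA

open scoped ComplexOrder InnerProductSpace ComplexConjugate

/-! ### The middle block, and all minors of the shape. -/

section Middle

variable {N : ℕ}

namespace ArcParams

variable (a : ArcParams N)

/-- The inclusion of the block of fixed points. -/
def midEmb : Fin (N - a.m - 2 * a.l) ↪o Fin N :=
  OrderEmbedding.ofStrictMono (fun i => ⟨a.m + a.l + i.val, by omega⟩) fun i j h => by
    rw [Fin.lt_def] at h ⊢
    change a.m + a.l + i.val < a.m + a.l + j.val
    omega

theorem midEmb_val (i : Fin (N - a.m - 2 * a.l)) : (a.midEmb i).val = a.m + a.l + i.val := rfl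

theorem exists_midEmb {x : Fin N} (h1 : a.m + a.l ≤ x.val) (h2 : x.val + a.l < N) :
    ∃ i, a.midEmb i = x :=
  ⟨⟨x.val - a.m - a.l, by omega⟩, Fin.ext (by
    rw [midEmb_val]
    change a.m + a.l + (x.val - a.m - a.l) = x.val
    omega)⟩

theorem initial_mid {r : ℕ} (hr : a.m + 2 * a.l + r ≤ N) : a.shape.initial (a.l + r) =
    a.shape.initial a.l ∪
      (initialSet (N - a.m - 2 * a.l) r).map a.midEmb.toEmbedding := by
  ext x
  simp only [Finset.mem_union, mem_initial, Finset.mem_map, initialSet, Finset.mem_filter,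
    Finset.mem_univ, true_and, RelEmbedding.coe_toEmbedding]
  constructor
  · rintro ⟨h1, h2⟩
    by_cases h : x.val < a.m + a.l
    · exact Or.inl ⟨h1, h⟩
    · obtain ⟨i, rfl⟩ := a.exists_midEmb (not_lt.1 h) (by omega)
      rw [midEmb_val] at h2
      exact Or.inr ⟨i, by omega, rfl⟩
  · rintro (h | ⟨i, hi, rfl⟩)
    · omega
    · rw [midEmb_val]
      omega

theorem image_mid {r : ℕ} (hr : a.m + 2 * a.l + r ≤ N) : a.shape.image (a.l + r) =
    a.shape.image a.l ∪ (initialSet (N - a.m - 2 * a.l) r).map a.midEmb.toEmbedding := by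
  rw [Shape.image, a.initial_mid hr, Finset.image_union]
  congr 1
  ext x
  simp only [Finset.mem_image, Finset.mem_map, RelEmbedding.coe_toEmbedding]
  have hfix : ∀ i, a.shape.τ (a.midEmb i) = a.midEmb i := fun i =>
    a.flip_of_fixed (Or.inr (by rw [midEmb_val]; have := i.2; omega))
  constructor
  · rintro ⟨_, ⟨i, hi, rfl⟩, rfl⟩
    exact ⟨i, hi, (hfix i).symm⟩
  · rintro ⟨i, hi, rfl⟩
    exact ⟨_, ⟨i, hi, rfl⟩, hfix i⟩

/-- The rows of the left arcs are the last ones. -/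
theorem mem_image_of_arc {k : ℕ} (hk : k ≤ a.l ∨ N ≤ a.m + k + a.l) (hkN : a.m + k ≤ N)
    {x : Fin N} : x ∈ a.shape.image k ↔ N ≤ x.val + k := by
  rw [mem_image, mem_initial]
  have hle := a.le
  have hx := x.2
  rcases a.flip_cases x with ⟨h, h'⟩ | ⟨h1, h2, h3⟩
  · rw [h]; omega
  · omega

/-- Each fixed point of the block comes after all left ends of arcs and lies below their l images,
so it adds exactly l inversions and one factor of the common sign. -/
theorem phase_mid {r : ℕ} (hr : a.m + 2 * a.l + r ≤ N) :
    a.shape.phase (a.l + r) = a.shape.phase a.l * ((-1) ^ (a.l * r) * (a.sgn : ℂ) ^ r) := by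
  have hle := a.le
  induction r with
  | zero => simp
  | succ r ih =>
    have hp : a.m + (a.l + r) < N := by omega
    have hfix : a.flip ⟨a.m + (a.l + r), hp⟩ = ⟨a.m + (a.l + r), hp⟩ :=
      a.flip_of_fixed (Or.inr (by
        change a.m + a.l ≤ a.m + (a.l + r) ∧ a.m + (a.l + r) + a.l < N
        omega))
    rw [← add_assoc, a.phase_succ (p := ⟨a.m + (a.l + r), hp⟩) rfl, ih (by omega), hfix,
      a.v_mid _ (by change a.m + a.l ≤ a.m + (a.l + r); omega)
        (by change a.m + (a.l + r) + a.l < N; omega), Complex.conj_ofReal]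
    have hcount : ((a.shape.image (a.l + r)).filter (⟨a.m + (a.l + r), hp⟩ < ·)).card = a.l := by
      refine Eq.trans ?_ (a.card_image (k := a.l) (by omega))
      rw [a.image_mid (by omega), Finset.filter_union,
        Finset.filter_true_of_mem, Finset.filter_false_of_mem, Finset.union_empty]
      · intro x hx
        simp only [Finset.mem_map, initialSet, Finset.mem_filter, Finset.mem_univ, true_and,
          RelEmbedding.coe_toEmbedding] at hx
        obtain ⟨i, hi, rfl⟩ := hx
        rw [Fin.lt_def, midEmb_val]
        change ¬ a.m + (a.l + r) < a.m + a.l + i.val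
        omega
      · intro x hx
        rw [a.mem_image_of_arc (Or.inl le_rfl) (by omega)] at hx
        rw [Fin.lt_def]
        change a.m + (a.l + r) < x.val
        omega
    rw [hcount, mul_add, pow_add, pow_succ]
    ring

end ArcParams

variable {V : Type*} [NormedAddCommGroup V] [InnerProductSpace ℂ V] [FiniteDimensional ℂ V]
  [CompleteSpace V]

namespace ArcParams.Fits

variable {a : ArcParams N} {q : ℝ} {z : Fin N → Fin N → V →L[ℂ] V}

/-- The minor is, up to a power of -q, the product of a leading minor `D` of the block and the minor
`K` of the left arcs. `D` is governed by `posInj_leading` and `K` by `posInj_left`; they commute,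
since `K` commutes with the entries of the block. -/
theorem posInj_mid (hf : a.Fits z) (hq0 : 0 < q) (hq1 : q < 1) (hZ : IsRE (q : ℂ) z)
    (hs : ∀ i j, star (z i j) = z j i) {r : ℕ} (hr : a.m + 2 * a.l + r ≤ N) :
    PosInj (a.shape.phase (a.l + r) •
      fminor (q : ℂ) z (a.shape.image (a.l + r)) (a.shape.initial (a.l + r))) := by
  have hle := a.le
  have hq : (q : ℂ) ≠ 0 := by exact_mod_cast hq0.ne'
  have hq2 : (q : ℂ) ^ 2 + 1 ≠ 0 := by exact_mod_cast (by positivity : q ^ 2 + 1 ≠ 0)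
  set n := N - a.m - 2 * a.l with hn
  set e : Fin n ↪o Fin N := a.midEmb with he
  have hev : ∀ i, (e i).val = a.m + a.l + i.val := a.midEmb_val
  -- In the rows of the block everything to its left vanishes by the arc pattern, so restriction and
  -- factorization apply.
  have h0 : ∀ s t, t ∉ Set.range e → (∃ p, t < e p) → z (e s) t = 0 := by
    rintro s t ht ⟨p, hp⟩
    have hs2 := s.2
    have hp2 := p.2
    rw [Fin.lt_def, hev] at hp
    have : t.val < a.m + a.l := by
      by_contra hlt
      exact ht (a.exists_midEmb (by omega) (by omega))
    exact hf.pattern _ _ (Or.inr this) (by rw [hev]; omega)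
  have hZm := hZ.restrict e h0
  have hD := posInj_leading hq0 hq1 (ε := a.sgn)
    (by rcases a.sgn_eq with h | h <;> rw [h] <;> norm_num) n hZm (fun i j => hs _ _)
    (fun h => hf.mid _ (by rw [hev]; rfl) (by rw [hev]; change a.m + a.l + 0 + a.l < N; omega)) r
    (by omega)
  have hK := hf.posInj_left hq0 hZ (le_refl a.l)
  set D := fminor (q : ℂ) (fun i j => z (e i) (e j)) (initialSet n r) (initialSet n r) with hDd
  set K := fminor (q : ℂ) z (a.shape.image a.l) (a.shape.initial a.l) with hKd
  have hmul : fminor (q : ℂ) z (a.shape.image (a.l + r)) (a.shape.initial (a.l + r)) =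
      ((-(q : ℂ)) ^ (a.l * r))⁻¹ • (D * K) := by
    have hc : (initialSet n r).card = r := by
      rw [initialSet, Fin.card_filter_val_lt, min_eq_right (by omega)]
    rw [a.image_mid hr, a.initial_mid hr, fminor_union hq hq2 hZ e h0, a.card_image (by omega), hc]
    · intro x hx p
      rw [a.mem_image_of_arc (Or.inl le_rfl) (by omega)] at hx
      have := p.2
      rw [Fin.lt_def, hev]
      omega
    · intro x hx p
      rw [a.mem_initial] at hx
      rw [Fin.lt_def, hev]
      omega
    · rw [a.card_image (by omega), a.card_initial (by omega)]
    · rfl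
  have hcomm : D * K = K * D := by
    have h3 := fminor_qcomm hq hq2 hZm (f := fun _ => 1) (X := K) (fun _ => one_ne_zero)
      (fun i j => by
        rw [(hf.commute_left hq0 hZ le_rfl (i := e i) (j := e j) (by have := i.2; rw [hev]; omega)
          (by have := j.2; rw [hev]; omega)).eq]) (I := initialSet n r) (J := initialSet n r) rfl
    simpa only [Finset.prod_const_one, one_smul] using h3
  have hprod := hD.mul hK (c := 1) (by
    rw [one_smul, smul_mul_smul_comm, smul_mul_smul_comm, hcomm, mul_comm])
  have hfin : a.shape.phase (a.l + r) •
      fminor (q : ℂ) z (a.shape.image (a.l + r)) (a.shape.initial (a.l + r)) =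
      (((q ^ (a.l * r))⁻¹ : ℝ) : ℂ) •
        (((a.sgn : ℂ) ^ r • D) * (a.shape.phase a.l • K)) := by
    rw [hmul, a.phase_mid hr, smul_mul_smul_comm, smul_smul, smul_smul]
    congr 1
    have h2 : ((-1 : ℂ) ^ (a.l * r)) * (-1) ^ (a.l * r) = 1 := by rw [← mul_pow]; simp
    rw [neg_pow (q : ℂ), mul_inv, ← inv_pow (-1 : ℂ), inv_neg_one]
    push_cast
    calc _ = ((q : ℂ) ^ (a.l * r))⁻¹ * ((a.sgn : ℂ) ^ r * a.shape.phase a.l) *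
          (((-1 : ℂ) ^ (a.l * r)) * (-1) ^ (a.l * r)) := by ring
      _ = _ := by rw [h2, mul_one]
  rw [hfin]
  exact hprod.smul (Complex.zero_lt_real.2 (by positivity))

/-- All minors of the shape have the right sign. -/
theorem posInj_minor (hf : a.Fits z) (hq0 : 0 < q) (hq1 : q < 1) (hZ : IsRE (q : ℂ) z)
    (hs : ∀ i j, star (z i j) = z j i) {k : ℕ} (hk : a.m + k ≤ N) :
    PosInj (a.shape.phase k • fminor (q : ℂ) z (a.shape.image k) (a.shape.initial k)) := by
  have hle := a.le
  rcases le_total k a.l with h | h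
  · exact hf.posInj_left hq0 hZ h
  obtain ⟨r, rfl⟩ := Nat.exists_eq_add_of_le h
  rcases le_total (a.m + 2 * a.l + r) N with h2 | h2
  · exact hf.posInj_mid hq0 hq1 hZ hs h2
  -- Beyond the block there are only right ends of arcs, passed one at a time.
  obtain ⟨s, hs'⟩ := Nat.exists_eq_add_of_le (show N - a.m - 2 * a.l ≤ r by omega)
  subst hs'
  induction s with
  | zero => exact hf.posInj_mid hq0 hq1 hZ hs (by omega)
  | succ s ih =>
    have hp : a.m + (a.l + (N - a.m - 2 * a.l + s)) < N := by omega
    exact hf.posInj_succ hq0 hZ (k := a.l + (N - a.m - 2 * a.l + s))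
      (p := ⟨a.m + (a.l + (N - a.m - 2 * a.l + s)), hp⟩) rfl (Or.inr (by
        change N ≤ a.m + (a.l + (N - a.m - 2 * a.l + s)) + a.l
        omega)) (ih (by omega) (by omega) (by omega))

/-- Minors with a column before the shape vanish. -/
theorem fminor_eq_zero_of_lt (hf : a.Fits z) (hq0 : 0 < q) (hZ : IsRE (q : ℂ) z)
    {I J : Finset (Fin N)} (hIJ : I.card = J.card) {x : Fin N} (hx : x ∈ J) (hxm : x.val < a.m) :
    fminor (q : ℂ) z I J = 0 := by
  have hq : (q : ℂ) ≠ 0 := by exact_mod_cast hq0.ne'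
  have hq2 : (q : ℂ) ^ 2 + 1 ≠ 0 := by exact_mod_cast (by positivity : q ^ 2 + 1 ≠ 0)
  refine fminor_eq_zero_of_col hq hq2 hZ (x := x) (fun i j hj => ?_) hIJ hx
  rw [Fin.le_def] at hj
  have := i.2
  exact hf.pattern _ _ (Or.inr (by omega)) (by omega)

/-- Minors of lexicographically smaller rows vanish. -/
theorem fminor_eq_zero_of_setLT (hf : a.Fits z) (hq0 : 0 < q) (hZ : IsRE (q : ℂ) z) {k : ℕ}
    (hk : a.m + k ≤ N) {I : Finset (Fin N)} (hI : I.card = k) (hlt : setLT I (a.shape.image k)) :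
    fminor (q : ℂ) z I (a.shape.initial k) = 0 := by
  have hle := a.le
  have hq : (q : ℂ) ≠ 0 := by exact_mod_cast hq0.ne'
  have hq2 : (q : ℂ) ^ 2 + 1 ≠ 0 := by exact_mod_cast (by positivity : q ^ 2 + 1 ≠ 0)
  have hIJ : I.card = (a.shape.initial k).card := by rw [hI, a.card_initial hk]
  obtain ⟨x, hxI, hx, -, hall⟩ := exists_of_setLT (by rw [hI, a.card_image hk]) hlt
  -- Under these inequalities the row `x` vanishes in all columns up to the last column of the
  -- minor.
  have hrow : (x.val + k < N ∧ (x.val < a.m + a.l ∨ k ≤ a.l)) →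
      fminor (q : ℂ) z I (a.shape.initial k) = 0 := by
    rintro ⟨h1, h2⟩
    refine fminor_eq_zero_of_row hq hq2 hZ hIJ hxI fun p hp t ht => ?_
    rw [a.mem_initial] at hp
    rw [Fin.le_def] at ht
    exact hf.pattern _ _ (by omega) (by omega)
  by_cases hk1 : k ≤ a.l ∨ N ≤ a.m + k + a.l
  · rw [a.mem_image_of_arc hk1 hk] at hx
    exact hrow (by omega)
  obtain ⟨r, rfl⟩ := Nat.exists_eq_add_of_le (show a.l ≤ k by omega)
  have hr : a.m + 2 * a.l + r ≤ N := by omega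
  by_cases hx1 : x.val < a.m + a.l
  · exact hrow (by omega)
  rw [a.image_mid hr] at hx hall
  have hxtop : x.val + a.l < N := by
    by_contra hcon
    exact hx (Finset.mem_union_left _
      ((a.mem_image_of_arc (Or.inl le_rfl) (by omega)).2 (by omega)))
  obtain ⟨i, rfl⟩ := a.exists_midEmb (not_lt.1 hx1) hxtop
  have hi : r ≤ i.val := by
    by_contra hcon
    refine hx (Finset.mem_union_right _ (Finset.mem_map.2 ⟨i, ?_, rfl⟩))
    simp only [initialSet, Finset.mem_filter, Finset.mem_univ, true_and]
    omega
  -- By lexicographic minimality, I contains the first r indices of the block as well as `x`: at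
  -- least r + 1 rows that are not among the last l.
  have hsub : (insert i (initialSet (N - a.m - 2 * a.l) r)).map a.midEmb.toEmbedding ⊆
      I.filter fun x => ¬ N ≤ x.val + a.l := by
    intro y hy
    obtain ⟨j, hj, rfl⟩ := Finset.mem_map.1 hy
    have hj2 := j.2
    rw [Finset.mem_filter]
    refine ⟨?_, by rw [RelEmbedding.coe_toEmbedding, a.midEmb_val]; omega⟩
    rcases Finset.mem_insert.1 hj with rfl | hj
    · exact hxI
    · refine hall _ (Finset.mem_union_right _ (Finset.mem_map.2 ⟨j, hj, rfl⟩)) ?_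
      simp only [initialSet, Finset.mem_filter, Finset.mem_univ, true_and] at hj
      rw [RelEmbedding.coe_toEmbedding, Fin.lt_def, a.midEmb_val, a.midEmb_val]
      omega
  have hcard := Finset.card_le_card hsub
  rw [Finset.card_map, Finset.card_insert_of_notMem (by simp [initialSet, hi]), initialSet,
    Fin.card_filter_val_lt, min_eq_right (by omega)] at hcard
  have hsum := Finset.card_filter_add_card_filter_not (s := I) (fun x => N ≤ x.val + a.l)
  -- So fewer than l rows of I are among the last l, and only those can be nonzero on the l columns
  -- of the left arcs.
  refine fminor_eq_zero_of_card_lt hq hq2 hZ (L := a.shape.initial a.l)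
    (U := fun x => N ≤ x.val + a.l) (fun x y hxy hx => ?_) (fun s hs x hx t ht => ?_) hIJ ?_ ?_
  · rw [Fin.le_def] at hxy
    omega
  · rw [a.mem_initial] at hx
    rw [Fin.le_def] at ht
    exact hf.pattern _ _ (Or.inr (by omega)) (by omega)
  · intro y hy
    rw [a.mem_initial] at hy ⊢
    omega
  · rw [a.card_initial (by omega)]
    omega

end ArcParams.Fits

end Middle

end REA

namespace REA

open scoped ComplexOrder InnerProductSpace ComplexConjugate

/-! ### Every finite-dimensional irreducible representation has a shape. -/

section HasShape

variable {V : Type*} [NormedAddCommGroup V] [InnerProductSpace ℂ V] [CompleteSpace V]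
  {N : ℕ} {q : ℝ} {π : OqH q N →⋆ₐ[ℂ] (V →L[ℂ] V)}

theorem starIdeal_le_ker {s : Set (OqH q N)} (h : ∀ x ∈ s, π x = 0) :
    starIdeal s ≤ TwoSidedIdeal.ker π := by
  refine TwoSidedIdeal.span_le.2 ?_
  rintro x (hx | ⟨y, hy, rfl⟩)
  · exact (TwoSidedIdeal.mem_ker π).2 (h x hx)
  · refine (TwoSidedIdeal.mem_ker π).2 ?_
    rw [map_star, h y hy, star_zero]

theorem mem_starIdeal {s : Set (OqH q N)} {x : OqH q N} (hx : x ∈ s) : x ∈ starIdeal s :=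
  TwoSidedIdeal.subset_span (Or.inl hx)

theorem rep_qMinor (hq0 : 0 < q) (π : OqH q N →⋆ₐ[ℂ] (V →L[ℂ] V)) {I J : Finset (Fin N)}
    (hIJ : I.card = J.card) :
    π (qMinor q I J) = fminor (q : ℂ) (fun i j => π (Z q i j)) I J := by
  have hq : (q : ℂ) ≠ 0 := by exact_mod_cast hq0.ne'
  have hq2 : (q : ℂ) ^ 2 + 1 ≠ 0 := by exact_mod_cast (by positivity : q ^ 2 + 1 ≠ 0)
  rw [qMinor_eq_fminor hq hq2 hIJ]
  exact (fminor_map (Z := Z q) π.toAlgHom I J).symm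

variable [FiniteDimensional ℂ V]

theorem ArcParams.Fits.posInj_rep {a : ArcParams N} (hf : a.Fits fun i j => π (Z q i j))
    (hq0 : 0 < q) (hq1 : q < 1) {k : ℕ} (hk : k ≤ a.shape.rank) :
    PosInj (a.shape.phase k • π (a.shape.minor q k)) := by
  have hmr : a.m ≤ N := by have := a.le; omega
  rw [a.rank_eq] at hk
  rw [Shape.minor, rep_qMinor hq0 π (by rw [a.card_image (by omega), a.card_initial (by omega)])]
  exact hf.posInj_minor hq0 hq1 (isRE_rep π) (star_rep π) (by omega)

/-- A representation whose matrix fits the parameters has the corresponding shape. -/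
theorem ArcParams.Fits.hasShape {a : ArcParams N} (hf : a.Fits fun i j => π (Z q i j))
    (hq0 : 0 < q) (hq1 : q < 1) : HasShape π a.shape := by
  have hmr : a.m ≤ N := by have := a.le; omega
  refine ⟨?_, fun k _ hk => ?_, fun k _ hk => (hf.posInj_rep hq0 hq1 hk).1⟩
  · refine starIdeal_le_ker ?_
    rintro x (hx | ⟨k, hk, I, J, hI, hJ, hlt, rfl⟩)
    · have hle : rankIdeal q N (a.shape.rank + 1) ≤ TwoSidedIdeal.ker π := by
        refine starIdeal_le_ker ?_
        rintro _ ⟨I, J, hI, hJ, rfl⟩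
        rw [rep_qMinor hq0 π (hI.trans hJ.symm)]
        -- A set with more elements than P contains the index of a zero column, together with which
        -- all earlier columns vanish.
        obtain ⟨y, hy, hym⟩ : ∃ y ∈ J, y.val < a.m := by
          by_contra! hno
          have : J ⊆ a.shape.P := fun y hy => a.mem_P.2 (hno y hy)
          have := Finset.card_le_card this
          rw [hJ, ← Shape.rank] at this
          omega
        exact hf.fminor_eq_zero_of_lt hq0 (isRE_rep π) (hI.trans hJ.symm) hy hym
      exact (TwoSidedIdeal.mem_ker π).1 (hle hx)
    · rw [rep_qMinor hq0 π (hI.trans hJ.symm)]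
      rw [a.rank_eq] at hk
      rcases hlt with h | ⟨rfl, h⟩
      -- P is final in [N], so a column set lexicographically before P_[k] must contain an index
      -- below m.
      · obtain ⟨y, hy, hyk, ⟨w, hw, hyw⟩, -⟩ := exists_of_setLT
          (by rw [hJ, a.card_initial (by omega)]) h
        rw [a.mem_initial] at hyk hw
        rw [Fin.lt_def] at hyw
        exact hf.fminor_eq_zero_of_lt hq0 (isRE_rep π) (hI.trans hJ.symm) hy (by omega)
      · exact hf.fminor_eq_zero_of_setLT hq0 (isRE_rep π) (by omega) hI h
  · refine LinearMap.ker_eq_bot.2 fun v w h => (hf.posInj_rep hq0 hq1 hk).2 ?_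
    have h' : π (a.shape.minor q k) v = π (a.shape.minor q k) w := h
    change a.shape.phase k • π (a.shape.minor q k) v = a.shape.phase k • π (a.shape.minor q k) w
    rw [h']

/-- The matrix of an irreducible finite dimensional representation fits some parameters. -/
theorem IsIrreducible.exists_fits (hπ : IsIrreducible π) (hq0 : 0 < q) (hq1 : q < 1) :
    ∃ a : ArcParams N, a.Fits fun i j => π (Z q i j) := by
  have hnt := hπ.1
  obtain ⟨m, l, hle, hp, hne, hmid⟩ := exists_arcPattern hq0 hq1 (isRE_rep π) (star_rep π)
  have hf : ∀ i : Fin N, ∃ u : ℂ, ‖u‖ = 1 ∧ (m ≤ i.val → i.val < m + l →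
      ∀ j : Fin N, i.val + j.val + 1 = N + m → PosInj (conj u • π (Z q i j))) := by
    intro i
    by_cases h : m ≤ i.val ∧ i.val < m + l
    · have hj : N - 1 + m - i.val < N := by omega
      obtain ⟨u, hu, hu'⟩ := hπ.exists_phase_entry hq0 (b := i) (d := ⟨N - 1 + m - i.val, hj⟩)
        (fun x hx => by
          rw [Fin.lt_def] at hx
          exact hp _ _ (Or.inl (by omega)) (by
            change x.val + (N - 1 + m - i.val) + 1 < N + m; omega))
        (fun x hx => by
          rw [Fin.lt_def] at hx
          change x.val < N - 1 + m - i.val at hx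
          exact hp _ _ (Or.inl h.2) (by omega))
        (hne i _ h.1 h.2 (by
          change i.val + (N - 1 + m - i.val) + 1 = N + m; omega))
      refine ⟨u, hu, fun _ _ j hj' => ?_⟩
      obtain rfl : j = ⟨N - 1 + m - i.val, hj⟩ := Fin.ext (by
        change j.val = N - 1 + m - i.val; omega)
      exact hu'
    · exact ⟨1, norm_one, fun h1 h2 => absurd ⟨h1, h2⟩ h⟩
  choose f hf1 hf2 using hf
  obtain ⟨ε, hε, hε'⟩ : ∃ ε : ℝ, (ε = 1 ∨ ε = -1) ∧ ∀ b : Fin N, b.val = m + l → b.val + l < N →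
      PosInj ((ε : ℂ) • π (Z q b b)) := by
    by_cases h : m + 2 * l < N
    · set b : Fin N := ⟨m + l, by omega⟩ with hb
      have hbv : b.val = m + l := rfl
      have hz := hmid b rfl h
      obtain ⟨u, hu, hu'⟩ := hπ.exists_phase_entry hq0 (b := b) (d := b)
        (fun x hx => by
          rw [Fin.lt_def] at hx
          exact hp _ _ (Or.inl (by omega)) (by omega))
        (fun x hx => by
          rw [Fin.lt_def] at hx
          exact hp _ _ (Or.inr (by omega)) (by omega)) hz
      -- A diagonal entry and its positive multiple are self-adjoint, so the phase is real, that is,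
      -- a sign.
      have hsa : u = conj u := by
        have h1 := hu'.1.isSelfAdjoint.star_eq
        rw [star_smul, star_rep] at h1
        have h2 : star (conj u) = u := Complex.conj_conj u
        rw [h2] at h1
        exact smul_left_injective ℂ hz h1
      have hre : (u.re : ℂ) = u := Complex.conj_eq_iff_re.1 hsa.symm
      refine ⟨u.re, ?_, fun c hc _ => ?_⟩
      · rw [← hre, Complex.norm_real, Real.norm_eq_abs] at hu
        exact eq_or_eq_neg_of_abs_eq hu
      · obtain rfl : c = b := Fin.ext hc
        rw [hre, hsa]
        exact hu'
    · exact ⟨1, Or.inl rfl, fun b hb hb' => absurd hb' (by omega)⟩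
  -- `f i` is the phase of the arc entry in the row `i` of a left end. It belongs to the column of
  -- the right end; the left end, as a column, belongs to the adjoint entry and gets the conjugate.
  let v : Fin N → ℂ := fun i => if i.val < m then 0 else if i.val < m + l then conj (f i) else
    if h : N ≤ i.val + l then f ⟨N - 1 + m - i.val, by omega⟩ else ε
  have hv1 : ∀ i : Fin N, i.val < m → v i = 0 := fun i h => if_pos h
  have hv2 : ∀ i : Fin N, m ≤ i.val → i.val < m + l → v i = conj (f i) := fun i h h' => by
    simp only [v, if_neg h.not_gt, if_pos h']
  have hv3 : ∀ i j : Fin N, m ≤ i.val → i.val < m + l → i.val + j.val + 1 = N + m →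
      v j = f i := by
    intro i j h h' hij
    have e : (⟨N - 1 + m - j.val, by omega⟩ : Fin N) = i := Fin.ext (by
      change N - 1 + m - j.val = i.val; omega)
    simp only [v]
    rw [if_neg (by omega), if_neg (by omega), dif_pos (by omega), e]
  have hv4 : ∀ i : Fin N, m + l ≤ i.val → i.val + l < N → v i = ε := by
    intro i h h'
    simp only [v]
    rw [if_neg (by omega), if_neg (by omega), dif_neg (by omega)]
  have hcases : ∀ i : Fin N, m ≤ i.val → i.val < m + l ∨ (m + l ≤ i.val ∧ i.val + l < N) ∨
      ∃ j : Fin N, m ≤ j.val ∧ j.val < m + l ∧ j.val + i.val + 1 = N + m := by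
    intro i hi
    by_cases h1 : i.val < m + l
    · exact Or.inl h1
    · by_cases h2 : i.val + l < N
      · exact Or.inr (Or.inl ⟨by omega, h2⟩)
      · have := i.2
        refine Or.inr (Or.inr ⟨⟨N - 1 + m - i.val, by omega⟩, ?_, ?_, ?_⟩)
        · change m ≤ N - 1 + m - i.val; omega
        · change N - 1 + m - i.val < m + l; omega
        · change N - 1 + m - i.val + i.val + 1 = N + m; omega
  refine ⟨⟨m, l, hle, v, ε, hε, hv1, fun i hi => ?_, fun i j h h' hij => ?_, hv4⟩, hp,
    fun i j hj hj' hij => ?_, hε'⟩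
  · rcases hcases i hi with h | h | ⟨j, h1, h2, h3⟩
    · rw [hv2 i hi h, Complex.norm_conj, hf1]
    · rw [hv4 i h.1 h.2]
      rcases hε with h | h <;> simp [h]
    · rw [hv3 j i h1 h2 h3, hf1]
  · rw [hv3 i j h h' hij, hv2 i h h', Complex.conj_conj]
  · change m ≤ j.val at hj
    change j.val < m + l ∨ N ≤ j.val + l at hj'
    change i.val + j.val + 1 = N + m at hij
    change PosInj (conj (v j) • π (Z q i j))
    by_cases h : j.val < m + l
    · have h1 := hf2 j hj h i (by omega)
      have h2 := h1.1.isSelfAdjoint.star_eq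
      rw [star_smul, star_rep] at h2
      have h3 : star (conj (f j)) = f j := Complex.conj_conj _
      rw [h3] at h2
      rw [hv2 j hj h, Complex.conj_conj, h2]
      exact h1
    · rw [hv3 i j (by omega) (by omega) hij]
      exact hf2 i (by omega) (by omega) j hij

end HasShape

/-! ### Uniqueness of the shape. -/

section Unique

variable {V : Type*} [NormedAddCommGroup V] [InnerProductSpace ℂ V] [CompleteSpace V]
  {N : ℕ} {q : ℝ} {π : OqH q N →⋆ₐ[ℂ] (V →L[ℂ] V)}

theorem HasShape.minor_ne_zero [Nontrivial V] {S : Shape N} (h : HasShape π S) {k : ℕ} (hk1 : 1 ≤ k)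
    (hk : k ≤ S.rank) : π (S.minor q k) ≠ 0 := by
  intro h0
  obtain ⟨v, hv⟩ := exists_ne (0 : V)
  have h1 : v ∈ LinearMap.ker (π (S.minor q k) : V →ₗ[ℂ] V) := by
    change π (S.minor q k) v = 0
    rw [h0]; rfl
  rw [show LinearMap.ker (π (S.minor q k) : V →ₗ[ℂ] V) = ⊥ from h.2.1 k hk1 hk] at h1
  exact hv h1

/-- Otherwise `S'` would have a nonvanishing minor of size one more than the rank of `S`, and the
ideal of `S` kills all of these. -/
theorem HasShape.rank_le [Nontrivial V] {S S' : Shape N} (h : HasShape π S) (h' : HasShape π S') :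
    S'.rank ≤ S.rank := by
  by_contra! hlt
  refine h'.minor_ne_zero (k := S.rank + 1) (by omega) hlt ((TwoSidedIdeal.mem_ker π).1 (h.1 ?_))
  refine mem_starIdeal (Or.inl (mem_starIdeal ?_))
  exact ⟨_, _, S'.card_image hlt, S'.card_initial hlt, rfl⟩

theorem HasShape.not_pairLT [Nontrivial V] {S S' : Shape N} (h : HasShape π S)
    (h' : HasShape π S') {k : ℕ} (hk1 : 1 ≤ k) (hk : k ≤ S.rank) (hk' : k ≤ S'.rank) :
    ¬ pairLT (S'.initial k) (S'.image k) (S.initial k) (S.image k) := by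
  intro hlt
  refine h'.minor_ne_zero hk1 hk' ((TwoSidedIdeal.mem_ker π).1 (h.1 ?_))
  exact mem_starIdeal (Or.inr ⟨k, hk, _, _, S'.card_image hk', S'.card_initial hk', hlt, rfl⟩)

/-- Each shape's minor of size k is nonzero and all lexicographically smaller ones vanish; applied
in both directions, the two index pairs agree. -/
theorem HasShape.initial_eq [Nontrivial V] {S S' : Shape N} (h : HasShape π S)
    (h' : HasShape π S') {k : ℕ} (hk : k ≤ S.rank) :
    S.initial k = S'.initial k ∧ S.image k = S'.image k := by
  have hr : S.rank = S'.rank := le_antisymm (h'.rank_le h) (h.rank_le h')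
  rcases Nat.eq_zero_or_pos k with rfl | hk1
  · rw [Shape.image, Shape.image, Shape.initial_zero, Shape.initial_zero]
    simp
  have h1 := h.not_pairLT h' hk1 hk (hr ▸ hk)
  have h2 := h'.not_pairLT h hk1 (hr ▸ hk) hk
  unfold pairLT at h1 h2
  push Not at h1 h2
  have e1 : S.initial k = S'.initial k := by
    rcases setLT_trichotomy (S.initial k) (S'.initial k) with h3 | h3 | h3
    · exact absurd h3 h2.1
    · exact h3
    · exact absurd h3 h1.1
  refine ⟨e1, ?_⟩
  rcases setLT_trichotomy (S.image k) (S'.image k) with h3 | h3 | h3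
  · exact absurd h3 (h2.2 e1)
  · exact h3
  · exact absurd h3 (h1.2 e1.symm)

theorem norm_prod_initial (S : Shape N) (k : ℕ) : ‖∏ p ∈ S.initial k, S.u p‖ = 1 := by
  rw [norm_prod]
  refine Finset.prod_eq_one fun p hp => ?_
  have h1 : S.u p ≠ 0 := (Finset.mem_filter.1 (S.initial_subset k hp)).2
  exact (S.u_mem p).resolve_left h1

/-- The shape of a representation is unique. -/
theorem HasShape.unique [Nontrivial V] {S S' : Shape N} (h : HasShape π S) (h' : HasShape π S') :
    S' = S := by
  have hr : S.rank = S'.rank := le_antisymm (h'.rank_le h) (h.rank_le h')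
  have hP : S.P = S'.P := by
    rw [← S.initial_rank, ← S'.initial_rank, ← hr]
    exact (h.initial_eq h' le_rfl).1
  -- The permutation is recovered one point at a time, as the element by which consecutive images
  -- differ.
  have hτ : ∀ k, k ≤ S.rank → ∀ p ∈ S.initial k, S.τ p = S'.τ p := by
    intro k
    induction k with
    | zero => intro _ p hp; rw [Shape.initial_zero] at hp; simp at hp
    | succ k ih =>
      intro hk p hp
      obtain ⟨p0, _, hp0, _, hins⟩ := S.exists_initial_succ (Nat.lt_of_succ_le hk)
      rw [hins, Finset.mem_insert] at hp
      rcases hp with rfl | hp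
      · have e0 := h.initial_eq h' (k := k) (by omega)
        have e1 := h.initial_eq h' hk
        have i1 := S.image_insert hins
        have i2 := S'.image_insert (k := k) (p := p) (by rw [← e0.1, ← e1.1, hins])
        rw [← e0.2, ← e1.2, i1] at i2
        have hnot : S.τ p ∉ S.image k := by
          intro hmem
          obtain ⟨x, hx, hxp⟩ := Finset.mem_image.1 hmem
          exact hp0 (S.τ.injective hxp ▸ hx)
        have hmem : S.τ p ∈ insert (S'.τ p) (S.image k) := i2 ▸ Finset.mem_insert_self _ _
        exact (Finset.mem_insert.1 hmem).resolve_right hnot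
      · exact ih (by omega) p hp
  have hprod : ∀ k, k ≤ S.rank → ∏ p ∈ S.initial k, S.u p = ∏ p ∈ S'.initial k, S'.u p := by
    intro k hk
    rcases Nat.eq_zero_or_pos k with rfl | hk1
    · rw [Shape.initial_zero, Shape.initial_zero, Finset.prod_empty, Finset.prod_empty]
    have e := h.initial_eq h' hk
    have hmin : S'.minor q k = S.minor q k := by rw [Shape.minor, Shape.minor, e.1, e.2]
    have hK := h.minor_ne_zero hk1 hk
    have hpos := h.2.2 k hk1 hk
    have hpos' := h'.2.2 k hk1 (hr ▸ hk)
    rw [hmin] at hpos'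
    set U := ∏ p ∈ S.initial k, S.u p with hU
    set U' := ∏ p ∈ S'.initial k, S'.u p with hU'
    have hinv : inversions (fun p : {p // p ∈ S'.initial k} => S'.τ p) =
        inversions (fun p : {p // p ∈ S.initial k} => S.τ p) := by
      rw [inversions_subtype, inversions_subtype, ← e.1]
      congr 1
      refine Finset.filter_congr fun x hx => ?_
      rw [Finset.mem_product] at hx
      rw [hτ k hk _ hx.1, hτ k hk _ hx.2]
    rw [Shape.phase, ← hU'] at hpos'
    rw [Shape.phase, ← hU] at hpos
    rw [hinv] at hpos'
    set c : ℂ := (-1) ^ inversions (fun p : {p // p ∈ S.initial k} => S.τ p) with hc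
    have hUU : U * conj U = 1 := by
      rw [Complex.mul_conj, Complex.normSq_eq_norm_sq, norm_prod_initial]
      simp
    have hne : (c * conj U) • π (S.minor q k) ≠ 0 := by
      refine smul_ne_zero (mul_ne_zero (pow_ne_zero _ (by norm_num)) ?_) hK
      exact right_ne_zero_of_mul_eq_one hUU
    have hrw : (c * conj U') • π (S.minor q k) =
        (U * conj U') • ((c * conj U) • π (S.minor q k)) := by
      rw [smul_smul]
      congr 1
      calc c * conj U' = c * conj U' * (U * conj U) := by rw [hUU, mul_one]
        _ = _ := by ring
    rw [hrw] at hpos'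
    -- Both phases make the same nonzero operator positive, so the unit scalar relating them is
    -- nonnegative and equals 1.
    have hge : 0 ≤ U * conj U' := by
      have h1 := (LinearMap.IsPositive.isPositive_smul_iff (T := (((c * conj U) • π (S.minor q k) :
        V →L[ℂ] V) : V →ₗ[ℂ] V)) hpos (fun h0 => hne (ContinuousLinearMap.coe_injective h0))
        (α := U * conj U')).1 hpos'
      exact h1
    have hnorm : ‖U * conj U'‖ = 1 := by
      rw [norm_mul, Complex.norm_conj, norm_prod_initial, norm_prod_initial, one_mul]
    have hone : U * conj U' = 1 := by
      have h1 := Complex.eq_re_of_ofReal_le hge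
      rw [Complex.eq_coe_norm_of_nonneg hge, hnorm]
      simp
    have hUU' : conj U' * U' = 1 := by
      rw [mul_comm, Complex.mul_conj, Complex.normSq_eq_norm_sq, norm_prod_initial]
      simp
    calc U = U * (conj U' * U') := by rw [hUU', mul_one]
      _ = U' := by rw [← mul_assoc, hone, one_mul]
  -- Quotients of consecutive products give the single values.
  have hu : ∀ k, k ≤ S.rank → ∀ p ∈ S.initial k, S.u p = S'.u p := by
    intro k
    induction k with
    | zero => intro _ p hp; rw [Shape.initial_zero] at hp; simp at hp
    | succ k ih =>
      intro hk p hp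
      obtain ⟨p0, _, hp0, _, hins⟩ := S.exists_initial_succ (Nat.lt_of_succ_le hk)
      have e0 := h.initial_eq h' (k := k) (by omega)
      have e1 := h.initial_eq h' hk
      rw [hins, Finset.mem_insert] at hp
      rcases hp with rfl | hp
      · have h1 := hprod (k + 1) hk
        have h2 := hprod k (by omega)
        rw [← e1.1, hins, Finset.prod_insert hp0, Finset.prod_insert hp0, h2, ← e0.1] at h1
        refine mul_right_cancel₀ ?_ h1
        rw [e0.1, ← norm_ne_zero_iff, norm_prod_initial]
        exact one_ne_zero
      · exact ih (by omega) p hp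
  have hP1 : ∀ p, p ∉ S.P → S.u p = 0 := fun p hp => by
    by_contra hne
    exact hp (Finset.mem_filter.2 ⟨Finset.mem_univ p, hne⟩)
  have hP2 : ∀ p, p ∉ S.P → S'.u p = 0 := fun p hp => by
    by_contra hne
    exact hp (hP ▸ Finset.mem_filter.2 ⟨Finset.mem_univ p, hne⟩)
  refine Shape.ext (Equiv.ext fun p => ?_) (funext fun p => ?_)
  · by_cases hp : p ∈ S.P
    · exact (hτ S.rank le_rfl p (by rw [S.initial_rank]; exact hp)).symm
    · have h1 : S.τ p = p := by
        by_contra hne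
        exact S.u_ne_zero p hne (hP1 p hp)
      have h2 : S'.τ p = p := by
        by_contra hne
        exact S'.u_ne_zero p hne (hP2 p hp)
      rw [h1, h2]
  · by_cases hp : p ∈ S.P
    · exact (hu S.rank le_rfl p (by rw [S.initial_rank]; exact hp)).symm
    · rw [hP1 p hp, hP2 p hp]

end Unique

end REA

namespace REA

open scoped ComplexOrder InnerProductSpace ComplexConjugate

/-! ### Scalar solutions of the reflection equation. -/

namespace ArcParams

variable {N : ℕ} (a : ArcParams N)

theorem sgn_mul_sgn : (a.sgn : ℂ) * a.sgn = 1 := by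
  rcases a.sgn_eq with h | h <;> simp [h]

theorem v_flip (i : Fin N) : a.v (a.flip i) = conj (a.v i) := by
  have hle := a.le
  rcases a.flip_cases i with ⟨h, h' | h'⟩ | ⟨h1, h2, h3⟩
  · rw [h, a.v_zero i h', map_zero]
  · rw [h, a.v_mid i h'.1 h'.2, Complex.conj_ofReal]
  · by_cases h4 : i.val < a.m + a.l
    · exact a.v_symm i (a.flip i) h2 h4 (by omega)
    · rw [a.v_symm (a.flip i) i (by omega) (by omega) (by omega), Complex.conj_conj]

theorem v_flip_mul_v (i : Fin N) : a.v (a.flip i) * a.v i = if a.m ≤ i.val then 1 else 0 := by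
  rw [v_flip]
  split_ifs with h
  · rw [mul_comm, Complex.mul_conj, Complex.normSq_eq_norm_sq, a.v_norm i h]
    simp
  · rw [a.v_zero i (by omega), mul_zero]

/-- The values of the generators under the character of the given parameters. -/
def entry (i j : Fin N) : ℂ := if i = a.flip j then a.v j else 0

theorem star_entry (i j : Fin N) : star (a.entry i j) = a.entry j i := by
  rw [entry, entry]
  by_cases h : i = a.flip j
  · have h' : j = a.flip i := by rw [h, a.flip_flip]
    rw [if_pos h, if_pos h', h, v_flip]
    rfl
  · rw [if_neg h, if_neg (fun h' => h (by rw [h', a.flip_flip])), star_zero]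

theorem entry_mul_entry (b x d : Fin N) : a.entry b x * a.entry x d =
    if x = a.flip b then (if b = d ∧ a.m ≤ b.val then 1 else 0) else 0 := by
  rw [entry, entry]
  by_cases hx : x = a.flip b
  · have hb : b = a.flip x := by rw [hx, a.flip_flip]
    rw [if_pos hb, if_pos hx]
    by_cases hbd : b = d
    · rw [← hbd, if_pos hx, hx, v_flip_mul_v]
      simp
    · rw [if_neg (fun h => hbd (by rw [hb, h, a.flip_flip])), if_neg (fun h => hbd h.1), mul_zero]
  · rw [if_neg (fun h => hx (by rw [h, a.flip_flip])), if_neg hx, zero_mul]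

theorem sum_entry_mul_entry (c b d : Fin N) : ∑ x with x < c, a.entry b x * a.entry x d =
    if b = d ∧ a.m ≤ b.val ∧ a.flip b < c then 1 else 0 := by
  simp only [entry_mul_entry, Finset.sum_ite_eq', Finset.mem_filter, Finset.mem_univ, true_and,
    Finset.sum_ite_eq]
  by_cases h : a.flip b < c <;> simp [h]

theorem entry_diag (b : Fin N) : a.entry b b =
    if a.m + a.l ≤ b.val ∧ b.val + a.l < N ∨ 2 * b.val + 1 = N + a.m then a.v b else 0 := by
  rw [entry]
  by_cases hm : a.m ≤ b.val
  · refine if_congr ?_ rfl rfl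
    rcases a.flip_cases b with ⟨h, h'⟩ | ⟨h1, h2, h3⟩
    · simp only [h, true_iff]
      omega
    · rw [Fin.ext_iff]
      omega
  · rw [a.v_zero b (by omega)]
    simp

theorem entry_diag_mul {b c : Fin N} (h : b < c) : a.entry b b * a.entry c c =
    if a.m + a.l ≤ b.val ∧ c.val + a.l < N then 1 else 0 := by
  have hle := a.le
  rw [Fin.lt_def] at h
  by_cases hh : a.m + a.l ≤ b.val ∧ c.val + a.l < N
  · rw [if_pos hh, entry, entry, a.flip_of_fixed (by omega), a.flip_of_fixed (by omega), if_pos rfl,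
      if_pos rfl, a.v_mid b (by omega) (by omega), a.v_mid c (by omega) (by omega), sgn_mul_sgn]
  · rw [if_neg hh, entry_diag, entry_diag]
    by_cases h1 : a.m + a.l ≤ b.val ∧ b.val + a.l < N ∨ 2 * b.val + 1 = N + a.m
    · rw [if_neg (c := _ ∨ 2 * c.val + 1 = N + a.m) (by omega), mul_zero]
    · rw [if_neg h1, zero_mul]

/-- The scalar counterpart of `opTrace_relation`. The common sign of the fixed points matters here:
the product of two of their entries must be 1. -/
theorem flip_lt_add {b c : Fin N} (h : b < c) :
    (if a.m ≤ c.val ∧ a.flip c < b then (1 : ℂ) else 0) + a.entry b b * a.entry c c =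
      if a.m ≤ b.val ∧ a.flip b < c then 1 else 0 := by
  have hle := a.le
  rw [entry_diag_mul a h]
  rw [Fin.lt_def] at h
  simp only [Fin.lt_def]
  rcases a.flip_cases b with ⟨h1, h1'⟩ | ⟨h1, h2, h3⟩ <;>
  rcases a.flip_cases c with ⟨h4, h4'⟩ | ⟨h4, h5, h6⟩ <;>
  (try rw [h1]) <;> (try rw [h4]) <;> split_ifs <;> first | omega | simp

/-- The reflection reverses the order of the indices from m on, except between two fixed points. -/
theorem flip_lt_flip {b c : Fin N} (h : b < c) (hm : a.m ≤ b.val)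
    (hbc : ¬ (a.flip b = b ∧ a.flip c = c)) : a.flip c < a.flip b := by
  have hle := a.le
  rw [Fin.lt_def] at h ⊢
  rcases a.flip_cases b with ⟨h1, h1'⟩ | ⟨h1, h2, h3⟩ <;>
  rcases a.flip_cases c with ⟨h4, h4'⟩ | ⟨h4, h5, h6⟩
  · exact absurd ⟨h1, h4⟩ hbc
  · rw [h1]; omega
  · rw [h4]; omega
  · omega

theorem entry_ne_zero {i j : Fin N} (h : a.entry i j ≠ 0) : i = a.flip j ∧ a.m ≤ j.val := by
  rw [entry] at h
  split_ifs at h with h'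
  · exact ⟨h', a.v_ne_zero_iff.1 h⟩
  · exact absurd rfl h

theorem reY_entry (q : ℂ) (i b c d : Fin N) : reY q a.entry i b c d =
    (if i = c then q⁻¹ else 1) * (a.entry b c * a.entry i d) +
      if i = c ∧ b = d ∧ a.m ≤ b.val ∧ a.flip b < i then q⁻¹ - q else 0 := by
  rw [reY, sum_entry_mul_entry, smul_eq_mul, smul_eq_mul]
  congr 1
  by_cases h : i = c
  · simp [h]
  · simp [h]

/-- Each row and each column has at most one nonzero entry, so few index patterns survive. With two
equal rows or columns both sides agree at once, as for i = c, b = d. The pattern i = d, b = c is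
`flip_lt_add`. In all others only products of two entries remain, and these match because the
reflection reverses the order. -/
theorem isRE_entry (q : ℂ) : IsRE q a.entry := by
  intro i b c d
  simp only [reY_entry, smul_eq_mul]
  have hz : ∀ x y z : Fin N, y ≠ z → a.entry x y * a.entry x z = 0 := by
    intro x y z hyz
    by_contra h
    have h1 := (a.entry_ne_zero (left_ne_zero_of_mul h)).1
    have h2 := (a.entry_ne_zero (right_ne_zero_of_mul h)).1
    exact hyz (by rw [← a.flip_flip y, ← h1, h2, a.flip_flip])
  have hz' : ∀ x y z : Fin N, x ≠ y → a.entry x z * a.entry y z = 0 := by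
    intro x y z hxy
    by_contra h
    have h1 := (a.entry_ne_zero (left_ne_zero_of_mul h)).1
    have h2 := (a.entry_ne_zero (right_ne_zero_of_mul h)).1
    exact hxy (by rw [h1, h2])
  by_cases hib : i = b
  · subst hib
    by_cases hcd : c = d
    · subst hcd; simp
    · rw [hz i c d hcd, hz i d c (Ne.symm hcd)]
      have h1 : ¬ (i = c ∧ i = d ∧ a.m ≤ i.val ∧ a.flip i < i) := fun h => hcd (h.1 ▸ h.2.1)
      have h2 : ¬ (i = d ∧ i = c ∧ a.m ≤ i.val ∧ a.flip i < i) := fun h => hcd (h.2.1 ▸ h.1)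
      simp [h1, h2]
  by_cases hcd : c = d
  · subst hcd
    rw [hz' i b c hib, hz' b i c (Ne.symm hib)]
    have h1 : ∀ P, ¬ (b = c ∧ i = c ∧ P) := fun P h => hib (h.2.1.trans h.1.symm)
    have h2 : ∀ P, ¬ (i = c ∧ b = c ∧ P) := fun P h => hib (h.1.trans h.2.1.symm)
    simp [h1, h2, hib]
  rw [if_neg hib, if_neg hcd, mul_comm (a.entry b d) (a.entry i c), one_mul, one_mul]
  by_cases h1 : i = c ∧ b = d
  · obtain ⟨rfl, rfl⟩ := h1
    simp [hib, Ne.symm hib]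
  by_cases h2 : i = d ∧ b = c
  · obtain ⟨rfl, rfl⟩ := h2
    have hbi := Ne.symm hib
    simp only [hib, hbi, false_and, and_false, if_false, if_true, true_and, add_zero]
    rcases lt_or_gt_of_ne hib with h | h
    · have hf := a.flip_lt_add h
      rw [if_neg h.not_gt, if_pos h, zero_mul, add_zero]
      rw [add_assoc]
      congr 1
      have e : ∀ (P : Prop) [Decidable P], (if P then q⁻¹ - q else 0) =
          (q⁻¹ - q) * if P then 1 else 0 := fun P _ => by split_ifs <;> simp
      rw [e, e (a.m ≤ b.val ∧ _), ← hf]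
      ring
    · have hf := a.flip_lt_add h
      rw [if_neg h.not_gt, if_pos h, zero_mul, add_zero]
      rw [add_assoc]
      congr 1
      have e : ∀ (P : Prop) [Decidable P], (if P then q⁻¹ - q else 0) =
          (q⁻¹ - q) * if P then 1 else 0 := fun P _ => by split_ifs <;> simp
      rw [e, e (a.m ≤ b.val ∧ _), ← hf]
      ring
  have n1 : ∀ P, ¬ (b = c ∧ i = d ∧ P) := fun P h => h2 ⟨h.2.1, h.1⟩
  have n2 : ∀ P, ¬ (i = d ∧ b = c ∧ P) := fun P h => h2 ⟨h.1, h.2.1⟩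
  have n3 : ∀ P, ¬ (i = c ∧ b = d ∧ P) := fun P h => h1 ⟨h.1, h.2.1⟩
  simp only [n1, n2, n3, if_false, add_zero]
  congr 1
  -- If this product is nonzero, then b = c or i = d would lead back to the excluded pattern, so no
  -- factor q⁻¹ appears.
  · by_cases hW : a.entry i c * a.entry b d = 0
    · rw [hW, mul_zero, mul_zero]
    · have e1 := (a.entry_ne_zero (left_ne_zero_of_mul hW)).1
      have e2 := (a.entry_ne_zero (right_ne_zero_of_mul hW)).1
      have hbc : b ≠ c := fun h => h2 ⟨by rw [e1, ← h, e2, a.flip_flip], h⟩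
      have hid : i ≠ d := fun h => h2 ⟨h, by rw [e2, ← h, e1, a.flip_flip]⟩
      rw [if_neg hbc, if_neg hid]
  -- If this product is nonzero, `b` and `i` are the reflections of `c` and `d`, so b < i holds
  -- exactly when d < c.
  · by_cases hU : a.entry b c * a.entry i d = 0
    · rw [hU, mul_zero, mul_zero, mul_zero]
    · have e1 := a.entry_ne_zero (left_ne_zero_of_mul hU)
      have e2 := a.entry_ne_zero (right_ne_zero_of_mul hU)
      have hfix : ∀ x y : Fin N, (x = c ∧ y = d ∨ x = d ∧ y = c) →
          ¬ (a.flip x = x ∧ a.flip y = y) := by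
        rintro x y (⟨rfl, rfl⟩ | ⟨rfl, rfl⟩) ⟨h3, h4⟩
        · exact h2 ⟨e2.1.trans h4, e1.1.trans h3⟩
        · exact h2 ⟨e2.1.trans h3, e1.1.trans h4⟩
      congr 1
      rcases lt_or_gt_of_ne hcd with h | h
      · have := a.flip_lt_flip h e1.2 (hfix c d (Or.inl ⟨rfl, rfl⟩))
        rw [← e1.1, ← e2.1] at this
        rw [if_neg this.not_gt, if_neg h.not_gt]
      · have := a.flip_lt_flip h e2.2 (hfix d c (Or.inr ⟨rfl, rfl⟩))
        rw [← e1.1, ← e2.1] at this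
        rw [if_pos this, if_pos h]

end ArcParams

/-! ### Characters from hermitian scalar solutions. -/

section Character

variable {N : ℕ} {q : ℝ}

/-- The homomorphism from the free algebra with given values on the generators. -/
def freeLift (A : Fin N → Fin N → ℂ) : FreeZ N →ₐ[ℂ] ℂ :=
  FreeAlgebra.lift ℂ fun p => A p.1 p.2

theorem freeLift_freeGen (A : Fin N → Fin N → ℂ) (i j : Fin N) :
    freeLift A (freeGen i j) = A i j :=
  FreeAlgebra.lift_ι_apply (R := ℂ) (fun p : Fin N × Fin N => A p.1 p.2) (i, j)

theorem freeLift_star {A : Fin N → Fin N → ℂ} (hA : ∀ i j, star (A i j) = A j i) (x : FreeZ N) :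
    freeLift A (star x) = star (freeLift A x) := by
  refine FreeAlgebra.induction ℂ (Fin N × Fin N)
    (motive := fun x => freeLift A (star (x : FreeZ N)) = star (freeLift A x)) ?_ ?_ ?_ ?_ x
  · intro c
    have h : freeLift A (star (algebraMap ℂ (FreeZ N) c)) =
        star (freeLift A (algebraMap ℂ (FreeZ N) c)) := by
      rw [star_algebraMap_freeZ, AlgHom.commutes, AlgHom.commutes]
      rfl
    exact h
  · rintro ⟨i, j⟩
    have h : freeLift A (star (freeGen i j)) = star (freeLift A (freeGen i j)) := by
      rw [star_freeGen, freeLift_freeGen, freeLift_freeGen, hA]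
    exact h
  · intro x y hx hy
    have h : ∀ x y : FreeZ N, freeLift A (star x) = star (freeLift A x) →
        freeLift A (star y) = star (freeLift A y) →
        freeLift A (star (x * y)) = star (freeLift A (x * y)) := by
      intro x y hx hy
      rw [star_mul, map_mul, map_mul, star_mul, hx, hy]
    exact h x y hx hy
  · intro x y hx hy
    have h : ∀ x y : FreeZ N, freeLift A (star x) = star (freeLift A x) →
        freeLift A (star y) = star (freeLift A y) →
        freeLift A (star (x + y)) = star (freeLift A (x + y)) := by
      intro x y hx hy
      rw [star_add, map_add, map_add, star_add, hx, hy]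
    exact h x y hx hy

/-- A hermitian scalar solution of the reflection equation gives a `*`-character. -/
theorem exists_character {A : Fin N → Fin N → ℂ} (hA : IsRE (q : ℂ) A)
    (hA' : ∀ i j, star (A i j) = A j i) :
    ∃ χ : OqH q N →⋆ₐ[ℂ] ℂ, ∀ i j, χ (Z q i j) = A i j := by
  have hrel : ∀ ⦃x y : FreeZ N⦄, ReflRel q N x y → freeLift A x = freeLift A y := by
    have h := (isRE_iff_forall q (freeLift A)).1 (by simpa only [freeLift_freeGen] using hA)
    intro x y hxy
    cases hxy with
    | fwd x y => exact h x y
    | bwd x y => exact (h x y).symm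
  let f : OqH q N →ₐ[ℂ] ℂ := RingQuot.liftAlgHom ℂ ⟨freeLift A, hrel⟩
  have hf : ∀ x, f (toOqH q N x) = freeLift A x := fun x =>
    RingQuot.liftAlgHom_mkAlgHom_apply ℂ (freeLift A) hrel x
  refine ⟨{ f with map_star' := fun x => ?_ }, fun i j => ?_⟩
  · obtain ⟨x, rfl⟩ := toOqH_surjective x
    change f (star (toOqH q N x)) = star (f (toOqH q N x))
    rw [star_toOqH, hf, hf, freeLift_star hA']
  · exact (hf _).trans (freeLift_freeGen A i j)

/-- The conditions in `Fits` are all that was used to determine the shape, so a scalar matrix that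
satisfies them yields a character of the same shape. -/
theorem ArcParams.exists_fits_character (a : ArcParams N) :
    ∃ χ : OqH q N →⋆ₐ[ℂ] ℂ, a.Fits fun i j => characterRep χ (Z q i j) := by
  have hle := a.le
  obtain ⟨χ, hχ⟩ := exists_character (q := q) (a.isRE_entry q) a.star_entry
  have hrep : ∀ i j, characterRep χ (Z q i j) = a.entry i j • (1 : ℂ →L[ℂ] ℂ) := by
    intro i j
    rw [← hχ, ← Algebra.algebraMap_eq_smul_one]
    rfl
  refine ⟨χ, fun i j h hij => ?_, fun i j hj hj' hij => ?_, fun b hb hb' => ?_⟩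
  · have h0 : a.entry i j = 0 := by
      by_contra hne
      obtain ⟨h1, h2⟩ := a.entry_ne_zero hne
      rcases a.flip_cases j with ⟨h3, h4⟩ | ⟨h3, h4, h5⟩
      · rw [h3] at h1; subst h1; omega
      · rw [h1] at hij; omega
    rw [hrep, h0]
    exact zero_smul ℂ _
  · have h := a.flip_of_arc hj hj'
    rw [hrep, ArcParams.entry, if_pos (Fin.ext (by omega)), smul_smul, mul_comm, Complex.mul_conj,
      Complex.normSq_eq_norm_sq, a.v_norm j hj]
    simpa using PosInj.one
  · rw [hrep, ArcParams.entry, a.flip_of_fixed (by omega), if_pos rfl,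
      a.v_mid b (by omega) (by omega), smul_smul, a.sgn_mul_sgn, one_smul]
    exact PosInj.one

end Character

end REA

namespace REA

open scoped ComplexOrder InnerProductSpace ComplexConjugate

/-! ### Big cell representations. -/

section BigCell

variable {V : Type*} [NormedAddCommGroup V] [InnerProductSpace ℂ V]
  {N : ℕ} {q : ℝ}

theorem TrivialKer.ne_zero [CompleteSpace V] [Nontrivial V] {π : OqH q N →⋆ₐ[ℂ] (V →L[ℂ] V)}
    {z : OqH q N} (h : TrivialKer π z) : π z ≠ 0 := by
  intro h0
  obtain ⟨v, hv⟩ := exists_ne (0 : V)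
  have h1 : v ∈ LinearMap.ker (π z : V →ₗ[ℂ] V) := by
    change π z v = 0
    rw [h0]; rfl
  rw [show LinearMap.ker (π z : V →ₗ[ℂ] V) = ⊥ from h] at h1
  exact hv h1

namespace ArcParams

variable {a : ArcParams N}

/-- If the first entry does not vanish, then there are no vanishing rows and no arcs. -/
theorem Fits.eq_zero {z : Fin N → Fin N → V →L[ℂ] V} (hf : a.Fits z) {i : Fin N}
    (hi : i.val = 0) (hz : z i i ≠ 0) : a.m = 0 ∧ a.l = 0 := by
  have hle := a.le
  have hN := i.2
  by_contra h
  exact hz (hf.pattern i i (by omega) (by omega))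

theorem flip_eq_self (hm : a.m = 0) (hl : a.l = 0) (i : Fin N) : a.flip i = i :=
  a.flip_of_fixed (by have := i.2; omega)

theorem v_eq_sgn (hm : a.m = 0) (hl : a.l = 0) (i : Fin N) : a.v i = a.sgn :=
  a.v_mid i (by omega) (by have := i.2; omega)

theorem minor_eq_leadingMinor (hm : a.m = 0) (hl : a.l = 0) (k : ℕ) :
    a.shape.minor q k = leadingMinor q N k := by
  have h1 : a.shape.initial k = initialSet N k := by
    ext i
    rw [a.mem_initial, initialSet, Finset.mem_filter]
    simp [hm]
  have h2 : a.shape.image k = initialSet N k := by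
    ext i
    rw [a.mem_image, a.flip_eq_self hm hl, h1]
  rw [Shape.minor, leadingMinor, h1, h2]

theorem bigCellShape_eq (hm : a.m = 0) (hl : a.l = 0) {ε : Fin N → SignType} {s : SignType}
    (hε : ∀ i, partialSign ε i = s) (hs : (s : ℂ) = a.sgn) : bigCellShape ε = a.shape := by
  refine Shape.ext (Equiv.ext fun i => (a.flip_eq_self hm hl i).symm) (funext fun i => ?_)
  change ((partialSign ε i : SignType) : ℂ) = a.v i
  rw [hε, hs, a.v_eq_sgn hm hl]

end ArcParams

/-- The signs whose partial products are all equal to `s`. -/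
def constSign (N : ℕ) (s : SignType) (i : Fin N) : SignType := if i.val = 0 then s else 1

theorem partialSign_constSign (s : SignType) (i : Fin N) : partialSign (constSign N s) i = s := by
  rw [partialSign, Finset.prod_eq_single (⟨0, i.pos⟩ : Fin N)]
  · exact if_pos rfl
  · intro j _ hj
    exact if_neg fun h => hj (Fin.ext h)
  · intro h
    exact absurd (Finset.mem_Iic.2 (Fin.le_def.2 (Nat.zero_le _))) h

theorem isStandard_constSign {s : SignType} (hs : s ≠ 0) : IsStandard (constSign N s) N := by
  refine ⟨le_rfl, fun i => ⟨fun _ => i.2, fun _ => ?_⟩⟩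
  rw [constSign]
  split_ifs
  · exact hs
  · exact one_ne_zero

variable [CompleteSpace V] {π : OqH q N →⋆ₐ[ℂ] (V →L[ℂ] V)}

/-- The last minor of the shape does not vanish. Positive rank is needed because a shape constrains
only minors of size at least 1. -/
theorem HasShape.hasRank [Nontrivial V] {S : Shape N} (h : HasShape π S) (h1 : 1 ≤ S.rank) :
    HasRank π S.rank := by
  refine ⟨fun x hx => h.1 (mem_starIdeal (Or.inl hx)), fun hle => ?_⟩
  refine h.minor_ne_zero h1 le_rfl ((TwoSidedIdeal.mem_ker π).1 (hle (mem_starIdeal ?_)))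
  exact ⟨_, _, S.card_image le_rfl, S.card_initial le_rfl, rfl⟩

/-- A representation with injective first entry is a big cell representation with a sign. -/
theorem IsIrreducible.bigCell (hπ : IsIrreducible π) {a : ArcParams N}
    (hf : a.Fits fun i j => π (Z q i j)) (hS : HasShape π a.shape) (hN : 0 < N)
    (hZ : TrivialKer π (Z q (⟨0, hN⟩ : Fin N) (⟨0, hN⟩ : Fin N))) :
    (∀ k, 1 ≤ k → k ≤ N → TrivialKer π (leadingMinor q N k)) ∧
      ∃ ε : Fin N → SignType, IsBigCell π ε ∧
        ((∀ i, partialSign ε i = 1) ∨ (∀ i, partialSign ε i = -1)) := by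
  have hnt := hπ.1
  obtain ⟨hm, hl⟩ := hf.eq_zero rfl hZ.ne_zero
  have hr : a.shape.rank = N := by rw [a.rank_eq, hm, Nat.sub_zero]
  refine ⟨fun k hk hk' => ?_, ?_⟩
  · rw [← a.minor_eq_leadingMinor hm hl]
    exact hS.2.1 k hk (hr.symm ▸ hk')
  · have hrank := hS.hasRank (hr.symm ▸ hN)
    rw [hr] at hrank
    have key : ∀ s : SignType, s ≠ 0 → (s : ℂ) = a.sgn → IsBigCell π (constSign N s) := by
      intro s hs hsa
      refine ⟨hπ, N, isStandard_constSign hs, hrank, ?_⟩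
      rw [a.bigCellShape_eq hm hl (partialSign_constSign s) hsa]
      exact hS
    rcases a.sgn_eq with h | h
    · exact ⟨constSign N 1, key 1 one_ne_zero (by simp [h]), Or.inl (partialSign_constSign 1)⟩
    · exact ⟨constSign N (-1), key (-1) (by decide) (by simp [h]),
        Or.inr (partialSign_constSign (-1))⟩

end BigCell

end REA

theorem mainTheorem8 (q : ℝ) (hq0 : 0 < q) (hq1 : q < 1) (N : ℕ)
    {V : Type*} [NormedAddCommGroup V] [InnerProductSpace ℂ V] [CompleteSpace V]
    [FiniteDimensional ℂ V] (π : REA.OqH q N →⋆ₐ[ℂ] (V →L[ℂ] V)) (hπ : REA.IsIrreducible π) :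
    (∃ S : REA.Shape N,
      REA.HasShape π S ∧ (∀ S' : REA.Shape N, REA.HasShape π S' → S' = S) ∧
        ∃ χ : REA.OqH q N →⋆ₐ[ℂ] ℂ, REA.HasShape (REA.characterRep χ) S) ∧
    (∀ hN : 0 < N, REA.TrivialKer π (REA.Z q (⟨0, hN⟩ : Fin N) (⟨0, hN⟩ : Fin N)) →
      (∀ k, 1 ≤ k → k ≤ N → REA.TrivialKer π (REA.leadingMinor q N k)) ∧
      ∃ ε : Fin N → SignType, REA.IsBigCell π ε ∧
        ((∀ i, REA.partialSign ε i = 1) ∨ (∀ i, REA.partialSign ε i = -1))) := by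
  have hnt := hπ.1
  obtain ⟨a, hf⟩ := hπ.exists_fits hq0 hq1
  have hS := hf.hasShape hq0 hq1
  -- The parameters extracted from π are reused for the character, which makes the two shapes equal
  -- by construction.
  obtain ⟨χ, hχ⟩ := a.exists_fits_character (q := q)
  exact ⟨⟨a.shape, hS, fun S' h' => hS.unique h', χ, hχ.hasShape hq0 hq1⟩,
    fun hN hZ => hπ.bigCell hf hS hN hZ⟩
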